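/- Let $\kappa\ge 0$ be an integer, $\alpha\in[0,1]$, $\gamma:=\kappa+\alpha$, $1<p<\infty$, and let $A\in\mathbb R$ and $c>0$. There is a finite constant $C$, depending only on $\kappa,\alpha,p,A,c$, such that the following holds. Let $\Omega\subseteq\mathbb R$ be open and let $\phi$ be a real-valued function on $\Omega$ that is locally $C^{\kappa+1,\alpha}$ (that is, $\phi\in C^{\kappa+1}(\Omega)$ and $\phi^{(\kappa+1)}$ is locally Hölder continuous with exponent $\alpha$), with $\phi'>0$ on $\Omega$. Let $\ell:\overline\Omega\to\mathbb R$ be admissible with constants $A,c$, that is: $\ell\ge 0$ on $\Omega$, $\ell=0$ on $\partial\Omega$, $|\ell(x)-\ell(y)|\le|x-y|$ for all $x,y\in\overline\Omega$; $$|\phi^{(j+1)}(x)|\,\ell(x)^j\le A\,\phi'(x)\qquad\text{for all } x\in\Omega,\ 1\le j\le\kappa;$$ and $$|\phi^{(\kappa+1)}(x)-\phi^{(\kappa+1)}(y)|\,\ell(x)^{\kappa+\alpha}\le A\,\phi'(x)\,|x-y|^\alpha\qquad\text{for all } x,y\in\Omega\text{ with }|x-y|\le c\,\ell(x).$$ Then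 for every complex-valued $f\in L^p(\Omega)$ and every $t>0$, the function $C_-(e^{it\phi}f\mathbf 1_\Omega)\in L^p(\mathbb R)$ is well defined and $$\|C_-(e^{it\phi}f\mathbf 1_\Omega)\|_{L^p(\mathbb R)}\le \frac{C}{t^{\gamma}}\left[\left\|\frac{f}{(\phi'\ell)^\gamma}\right\|_{L^p(\Omega)}+\left\|\frac{f}{(\phi')^\gamma}\right\|_{X^p_\gamma(\Omega)}\right],$$ where the norms on the right may be infinite (and where, for $\gamma>0$, $f/(\phi'\ell)^\gamma$ is read as $0$ where $f=0$ and as $\infty$ where $f\ne0$ and $\ell=0$; for $\gamma=0$ it is $f$). Here $C_-$ is the Fourier multiplier operator with symbol $\mathbf 1_{\xi<0}$ (for $\hat f(\xi)=\int e^{-2\pi i x\xi}f(x)\,dx$), extended from Schwartz functions to $L^p(\mathbb R)$ by continuity. The seminorm $X^p_\beta(\Omega)$ is defined by $\|F\|_{X^p_0(\Omega)}:=\|F\|_{L^p(\Omega)}$; for $0<\beta<1$, $$\|F\|_{X^p_\beta(\Omega)}:=\left(\int_\Omega\left|\sup_{0<\delta<\ell(x)}\frac1{\delta^{1+\beta}}\int_{-\delta/2}^{\delta/2}|F(x+u)-F(x)|\,du\right|^p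 dx\right)^{1/p};$$ and for $\beta\ge1$, $\|F\|_{X^p_\beta(\Omega)}:=\|F^{(j)}\|_{X^p_{\beta-j}(\Omega)}$ with $j=\lfloor\beta\rfloor$ and $F^{(j)}$ the weak derivative on $\Omega$ (the seminorm is $\infty$ if there is no locally integrable weak derivative). -/

import Mathlib

open MeasureTheory Filter Topology Set
open scoped ENNReal NNReal FourierTransform SchwartzMap ContDiff

noncomputable section

/-- The phase hypotheses on the open set `Ω`: `φ` is locally `C^{κ+1,α}` on `Ω` and `φ' > 0` on `Ω`.
The function `φ` is only ever evaluated near points of `Ω`. -/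
structure IsPhase (κ : ℕ) (α : ℝ) (Ω : Set ℝ) (φ : ℝ → ℝ) : Prop where
  contDiffOn : ContDiffOn ℝ ((κ + 1 : ℕ) : WithTop ℕ∞) φ Ω
  locally_holder : ∀ x ∈ Ω, ∃ r > 0, ∃ K : ℝ, ∀ y ∈ Ω ∩ Metric.ball x r,
    ∀ z ∈ Ω ∩ Metric.ball x r,
      |iteratedDeriv (κ + 1) φ y - iteratedDeriv (κ + 1) φ z| ≤ K * |y - z| ^ α
  deriv_pos : ∀ x ∈ Ω, 0 < deriv φ x

/-- `ℓ` is admissible for `(φ, κ, α)` on `Ω`, where `A` is the implied constant in the two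
derivative bounds and `c` is the smallness constant in the condition "`|y - x|` is much smaller
than `ℓ x`". Since `ℓ` is prescribed on the boundary, the Lipschitz condition is imposed on the
closure of `Ω`. -/
structure IsAdmissible (κ : ℕ) (α A c : ℝ) (Ω : Set ℝ) (φ ℓ : ℝ → ℝ) : Prop where
  nonneg : ∀ x ∈ Ω, 0 ≤ ℓ x
  eq_zero_of_frontier : ∀ x ∈ frontier Ω, ℓ x = 0
  lipschitz : ∀ x ∈ closure Ω, ∀ y ∈ closure Ω, |ℓ x - ℓ y| ≤ |x - y|
  deriv_bound : ∀ x ∈ Ω, ∀ j : ℕ, 1 ≤ j → j ≤ κ →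
    |iteratedDeriv (j + 1) φ x| * ℓ x ^ j ≤ A * deriv φ x
  holder_bound : ∀ x ∈ Ω, ∀ y ∈ Ω, |y - x| ≤ c * ℓ x →
    |iteratedDeriv (κ + 1) φ x - iteratedDeriv (κ + 1) φ y| * ℓ x ^ ((κ : ℝ) + α)
      ≤ A * deriv φ x * |x - y| ^ α

/-- `g` is the weak derivative of order `j` of `F` on the open set `Ω`; both functions are locally
integrable on `Ω`, and test functions are compactly supported in `Ω`. -/
structure IsWeakDeriv (Ω : Set ℝ) (j : ℕ) (F g : ℝ → ℂ) : Prop where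
  locallyIntegrableOn : LocallyIntegrableOn F Ω
  locallyIntegrableOn_deriv : LocallyIntegrableOn g Ω
  integral_eq : ∀ ψ : ℝ → ℝ, ContDiff ℝ ∞ ψ → HasCompactSupport ψ → tsupport ψ ⊆ Ω →
    ∫ x, iteratedDeriv j ψ x • F x = (-1 : ℂ) ^ j * ∫ x, ψ x • g x

/-- The localized fractional maximal function
`sup_{0 < δ < ℓ x} δ^{-(1+β)} ∫_{-δ/2}^{δ/2} |g (x + u) - g x| du`, with values in `[0, ∞]`. -/
def fracMaximal (ℓ : ℝ → ℝ) (β : ℝ) (g : ℝ → ℂ) (x : ℝ) : ℝ≥0∞ :=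
  ⨆ δ ∈ Ioo 0 (ℓ x), ENNReal.ofReal (1 / δ ^ (1 + β)) *
    ∫⁻ u in Icc (-(δ / 2)) (δ / 2), ‖g (x + u) - g x‖ₑ

/-- The seminorm `X^p_β(Ω)` for `0 ≤ β < 1`: the `L^p(Ω)` norm if `β = 0`, and the `L^p(Ω)` norm of
the localized fractional maximal function if `0 < β < 1`. -/
def fracSeminorm (Ω : Set ℝ) (ℓ : ℝ → ℝ) (p β : ℝ) (g : ℝ → ℂ) : ℝ≥0∞ :=
  if β = 0 then eLpNorm g (ENNReal.ofReal p) (volume.restrict Ω)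
  else (∫⁻ x in Ω, fracMaximal ℓ β g x ^ p) ^ (1 / p)

/-- The seminorm `X^p_β(Ω)` for every `β ≥ 0`. For `β ≥ 1` it is the `X^p_{β-j}(Ω)` seminorm of the
weak derivative of order `j = ⌊β⌋`, and it is `∞` if there is no such weak derivative. (The weak
derivative is unique up to null sets, so that the infimum is over a single class.) -/
def xSeminorm (Ω : Set ℝ) (ℓ : ℝ → ℝ) (p β : ℝ) (F : ℝ → ℂ) : ℝ≥0∞ :=
  if β < 1 then fracSeminorm Ω ℓ p β F
  else ⨅ (g : ℝ → ℂ) (_ : IsWeakDeriv Ω ⌊β⌋₊ F g), fracSeminorm Ω ℓ p (β - (⌊β⌋₊ : ℝ)) g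

/-- The Fourier multiplier with symbol `1_{ξ < 0}` on Schwartz functions. -/
def cauchyMinusSchwartz (ψ : 𝓢(ℝ, ℂ)) : ℝ → ℂ :=
  𝓕⁻ ((Iio (0 : ℝ)).indicator (𝓕 (ψ : ℝ → ℂ)))

/-- `h = C_- g` in `L^p(ℝ)`, where `C_-` is the Fourier multiplier operator with symbol
`1_{ξ < 0}`, extended from Schwartz functions to `L^p(ℝ)` by continuity. -/
def IsCauchyMinus (p : ℝ≥0∞) (g h : ℝ → ℂ) : Prop :=
  MemLp g p volume ∧ MemLp h p volume ∧ ∃ ψ : ℕ → 𝓢(ℝ, ℂ),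
    Tendsto (fun n => eLpNorm (fun x => ψ n x - g x) p volume) atTop (𝓝 0) ∧
    Tendsto (fun n => eLpNorm (fun x => cauchyMinusSchwartz (ψ n) x - h x) p volume) atTop (𝓝 0)

/-- The `L^p(Ω)` norm of `f / (φ' ℓ)^γ`, computed in `[0, ∞]`: the quotient is `∞` where `f ≠ 0` and
the denominator vanishes, and it is `0` where `f = 0`. -/
def weightedNorm (Ω : Set ℝ) (φ ℓ : ℝ → ℝ) (p γ : ℝ) (f : ℝ → ℂ) : ℝ≥0∞ :=
  (∫⁻ x in Ω, (‖f x‖ₑ / ENNReal.ofReal ((deriv φ x * ℓ x) ^ γ)) ^ p) ^ (1 / p)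

end

/-! Pair the function `C_-(e^{itφ} f 1_Ω)` with a Schwartz function ψ. The transpose of `C_-` is
`C_+`, and `C_+ ψ` is the boundary value of the Cauchy integral h of ψ, which is holomorphic in the
upper half-plane. If G extends `e^{itφ} f 1_Ω` to the half-plane and vanishes for large y, Green's
formula bounds the pairing by the integral of |(∂x + i∂y)G| |h|
(`enorm_integral_mul_cauchyPlus_le`). Moreover |h(x + iy)| is at most 8 times the maximal function
of `C_+ ψ` at x, uniformly in y (`enorm_cauchyInt_le`). So it is enough to find G for which the
y-integral of |(∂x + i∂y)G| is at most t^{-γ} times a function whose L^p norm is controlled by the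
right-hand side.

To build G, write e^{itφ} f = F (φ')^γ e^{itφ} with F = f/(φ')^γ, replace F, φ' and φ separately by
averages over [x - y, x + y] against one complex kernel η, and cut off to scales y small compared to
ℓ(x). The kernel has mass one and first moment i (`exists_isExtensionKer`). Hence the average of φ
is close to φ(x) + iyφ'(x), and the exponential is at most e^{-tyφ'(x)/2}. In addition, ∂x + i∂y of
an average is 1/y times an average against a multiple of ζ^{(κ+2)}, with ζ a bump. Integration by
parts therefore makes it as small as the smoothness of the averaged function permits: of order
y^{γ-1} times the maximal function defining the X^p_γ seminorm for F (`exists_dbar_majorant`), and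
of relative order (y/ℓ)^γ for the phase (`exists_phaseBounds`). The factor ℓ^{-γ} lost on the phase
is recovered from the average of F, which is at most ℓ^γ times the maximal function of f/(φ'ℓ)^γ;
where the cutoff is differentiated, y is comparable to ℓ and the same bound suffices.

All terms are thus dominated by m(x) φ'(x)^γ y^{γ-1} e^{-tyφ'(x)/4}, where m is the sum of the two
maximal functions (`norm_dbar_product_le`, `exists_extension`). The y-integral of the last three
factors is 4^γ Γ(γ) t^{-γ}, whatever the value of φ'(x); this is what the weight (φ')^{-γ} is for.
Hölder's inequality and the maximal theorem conclude.

Two classical facts are proved along the way: the maximal inequality (`lintegral_maxFn_rpow_le`) and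
the L^p boundedness of `C_+` (`eLpNorm_cauchyPlus_le`), the latter by M. Riesz's argument with
powers of holomorphic functions of positive real part. For γ = 0 the boundedness of `C_-` is the
whole statement. -/

/-! ### The Hardy–Littlewood maximal inequality. -/

/-- The Hardy–Littlewood maximal function on `ℝ` over balls of dyadic radii, with the averages
normalised by the radius. -/
noncomputable def maxFn (f : ℝ → ℝ≥0∞) (x : ℝ) : ℝ≥0∞ :=
  ⨆ n : ℤ, ENNReal.ofReal ((2 : ℝ) ^ (-n)) * ∫⁻ s in Metric.ball x ((2 : ℝ) ^ n), f s

theorem measurable_lintegral_ball {f : ℝ → ℝ≥0∞} (hf : Measurable f) (r : ℝ) :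
    Measurable fun x => ∫⁻ s in Metric.ball x r, f s := by
  have h1 : ∀ x, ∫⁻ s in Metric.ball x r, f s
      = ∫⁻ s, (({q : ℝ × ℝ | dist q.2 q.1 < r}).indicator (fun q => f q.2)) (x, s) := by
    intro x
    rw [← lintegral_indicator Metric.isOpen_ball.measurableSet]
    rfl
  simp_rw [h1]
  apply Measurable.lintegral_prod_right'
  refine (hf.comp measurable_snd).indicator ?_
  exact measurableSet_lt (by fun_prop) (by fun_prop)

theorem measurable_maxFn {f : ℝ → ℝ≥0∞} (hf : Measurable f) : Measurable (maxFn f) :=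
  Measurable.iSup fun _ => (measurable_lintegral_ball hf _).const_mul _

theorem exists_zpow_two_mem {r : ℝ} (hr : 0 < r) : ∃ n : ℤ, r < (2 : ℝ) ^ n ∧ (2 : ℝ) ^ n ≤ 2 * r := by
  obtain ⟨n, h1, h2⟩ := exists_mem_Ico_zpow hr (one_lt_two : (1 : ℝ) < 2)
  refine ⟨n + 1, h2, ?_⟩
  rw [zpow_add_one₀ two_ne_zero]
  linarith

/-- Rounding the radius up to a power of two at most doubles it. Since `maxFn` divides by the radius
and not by the length, this is the only loss. -/
theorem lintegral_closedBall_le_maxFn (f : ℝ → ℝ≥0∞) (x : ℝ) {r : ℝ} (hr : 0 < r) :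
    ∫⁻ s in Metric.closedBall x r, f s ≤ ENNReal.ofReal (2 * r) * maxFn f x := by
  obtain ⟨n, h1, h2⟩ := exists_zpow_two_mem hr
  have hpos : (0 : ℝ) < 2 ^ n := by positivity
  calc ∫⁻ s in Metric.closedBall x r, f s ≤ ∫⁻ s in Metric.ball x ((2 : ℝ) ^ n), f s :=
        lintegral_mono_set (Metric.closedBall_subset_ball h1)
    _ = ENNReal.ofReal ((2 : ℝ) ^ n) * (ENNReal.ofReal ((2 : ℝ) ^ (-n)) *
          ∫⁻ s in Metric.ball x ((2 : ℝ) ^ n), f s) := by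
        rw [← mul_assoc, ← ENNReal.ofReal_mul hpos.le, zpow_neg, mul_inv_cancel₀ hpos.ne']
        simp
    _ ≤ _ := by
        gcongr
        exact le_iSup (fun n : ℤ => ENNReal.ofReal ((2 : ℝ) ^ (-n)) *
          ∫⁻ s in Metric.ball x ((2 : ℝ) ^ n), f s) n

theorem maxFn_congr_ae {f g : ℝ → ℝ≥0∞} (h : f =ᵐ[volume] g) : maxFn f = maxFn g := by
  funext x
  unfold maxFn
  congr 1
  funext n
  congr 1
  exact lintegral_congr_ae (ae_restrict_of_ae h)

theorem maxFn_add_const_le {f g : ℝ → ℝ≥0∞} {c : ℝ≥0∞} (hg : Measurable g)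
    (h : ∀ x, f x ≤ g x + c) (x : ℝ) :
    maxFn f x ≤ maxFn g x + 2 * c := by
  unfold maxFn
  refine iSup_le fun n => ?_
  have hpos : (0 : ℝ) < 2 ^ n := by positivity
  calc _ ≤ ENNReal.ofReal ((2 : ℝ) ^ (-n)) * ∫⁻ s in Metric.ball x ((2 : ℝ) ^ n), (g s + c) := by
        gcongr; exact h _
    _ = ENNReal.ofReal ((2 : ℝ) ^ (-n)) * (∫⁻ s in Metric.ball x ((2 : ℝ) ^ n), g s)
          + 2 * c := by
        rw [lintegral_add_left hg, mul_add]
        congr 1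
        rw [setLIntegral_const, Real.volume_ball, mul_comm c, ← mul_assoc,
          ← ENNReal.ofReal_mul (by positivity), mul_left_comm, zpow_neg,
          inv_mul_cancel₀ hpos.ne']
        simp
    _ ≤ _ := by
        gcongr
        exact le_iSup (fun n : ℤ => ENNReal.ofReal ((2 : ℝ) ^ (-n)) *
          ∫⁻ s in Metric.ball x ((2 : ℝ) ^ n), g s) n

/-- The weak type `(1, 1)` inequality. -/
theorem volume_lt_maxFn_le {f : ℝ → ℝ≥0∞} (hf : ∫⁻ s, f s ≠ ⊤) {l : ℝ} (hl : 0 < l) :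
    volume {x | ENNReal.ofReal l < maxFn f x} ≤ ENNReal.ofReal (8 / l) * ∫⁻ s, f s := by
  have key : ∀ x : {x | ENNReal.ofReal l < maxFn f x}, ∃ n : ℤ,
      ENNReal.ofReal (l * 2 ^ n) ≤ ∫⁻ s in Metric.ball (x : ℝ) ((2 : ℝ) ^ n), f s := by
    rintro ⟨x, hx⟩
    obtain ⟨n, hn⟩ := lt_iSup_iff.1 (show ENNReal.ofReal l < maxFn f x from hx)
    refine ⟨n, ?_⟩
    have hpos : (0 : ℝ) < 2 ^ n := by positivity
    calc ENNReal.ofReal (l * 2 ^ n) = ENNReal.ofReal ((2 : ℝ) ^ n) * ENNReal.ofReal l := by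
          rw [mul_comm, ENNReal.ofReal_mul hpos.le]
      _ ≤ ENNReal.ofReal ((2 : ℝ) ^ n) * (ENNReal.ofReal ((2 : ℝ) ^ (-n)) *
          ∫⁻ s in Metric.ball x ((2 : ℝ) ^ n), f s) := by gcongr
      _ = _ := by
        rw [← mul_assoc, ← ENNReal.ofReal_mul hpos.le, zpow_neg, mul_inv_cancel₀ hpos.ne']
        simp
  choose n hn using key
  -- The radii are bounded because `l * 2 ^ n` is at most the total integral. Enlarging by 4 gives
  -- intervals of length `8 * 2 ^ n`, whence the constant 8.
  obtain ⟨u, -, hdisj, hcov⟩ := Vitali.exists_disjoint_subfamily_covering_enlargement_ball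
    (univ : Set {x | ENNReal.ofReal l < maxFn f x}) (fun x => (x : ℝ)) (fun x => (2 : ℝ) ^ n x)
    ((∫⁻ s, f s).toReal / l) (by
      intro a _
      rw [le_div_iff₀ hl, mul_comm]
      rw [← ENNReal.ofReal_le_iff_le_toReal hf]
      exact (hn a).trans (setLIntegral_le_lintegral _ _)) 4 (by norm_num)
  have hcount : u.Countable := hdisj.countable_of_isOpen (fun _ _ => Metric.isOpen_ball)
    (fun a _ => Metric.nonempty_ball.2 (by positivity))
  calc volume {x | ENNReal.ofReal l < maxFn f x}
      ≤ volume (⋃ b ∈ u, Metric.ball (b : ℝ) (4 * (2 : ℝ) ^ n b)) := by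
        apply measure_mono
        intro x hx
        obtain ⟨b, hb, hsub⟩ := hcov ⟨x, hx⟩ (mem_univ _)
        exact mem_biUnion hb (hsub (Metric.mem_ball_self (by positivity)))
    _ ≤ ∑' b : u, volume (Metric.ball (b : ℝ) (4 * (2 : ℝ) ^ n b)) :=
        measure_biUnion_le _ hcount _
    _ ≤ ∑' b : u, ENNReal.ofReal (8 / l) * ∫⁻ s in Metric.ball (b : ℝ) ((2 : ℝ) ^ n b), f s := by
        refine ENNReal.tsum_le_tsum fun b => ?_
        refine le_trans (le_of_eq ?_) (mul_le_mul_right (hn b) _)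
        rw [Real.volume_ball, ← ENNReal.ofReal_mul (by positivity)]
        congr 1
        field_simp
        ring
    _ = ENNReal.ofReal (8 / l) * ∫⁻ s in ⋃ b ∈ u, Metric.ball (b : ℝ) ((2 : ℝ) ^ n b), f s := by
        rw [ENNReal.tsum_mul_left, lintegral_biUnion hcount
          (fun _ _ => Metric.isOpen_ball.measurableSet) hdisj]
    _ ≤ _ := by gcongr; exact Measure.restrict_le_self

/-- The part of `f` below `l / 4` contributes at most `l / 2` to `maxFn f`, so the weak type bound
is needed only for the part above `l / 4`. That part is integrable, being at most `(4 / l) ^ (p - 1)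
* f ^ p`. -/
theorem volume_lt_maxFn_le_of_rpow {p : ℝ} (hp : 1 < p) {f : ℝ → ℝ≥0∞} (hf : Measurable f)
    (hfp : ∫⁻ s, f s ^ p ≠ ⊤) {l : ℝ} (hl : 0 < l) :
    volume {x | ENNReal.ofReal l < maxFn f x} ≤
      ENNReal.ofReal (16 / l) * ∫⁻ s in {s | ENNReal.ofReal (l / 4) < f s}, f s := by
  set S := {s | ENNReal.ofReal (l / 4) < f s} with hS
  have hSm : MeasurableSet S := measurableSet_lt measurable_const hf
  have hfin : ∫⁻ s, S.indicator f s ≠ ⊤ := by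
    have h1 : ∀ s, S.indicator f s ≤ ENNReal.ofReal ((4 / l) ^ (p - 1)) * f s ^ p := by
      intro s
      by_cases hs : s ∈ S
      · rw [indicator_of_mem hs]
        have hs' : ENNReal.ofReal (l / 4) < f s := hs
        rcases eq_or_ne (f s) ⊤ with h | h
        · rw [h, ENNReal.top_rpow_of_pos (by linarith), ENNReal.mul_top]
          · simpa using by positivity
        · have h0 : f s ≠ 0 := (bot_le.trans_lt hs').ne'
          have e1 : f s ^ p = f s ^ (p - 1) * f s := by
            conv_rhs => rw [← ENNReal.rpow_one (f s), ← ENNReal.rpow_mul, one_mul]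
            rw [← ENNReal.rpow_add _ _ h0 h]; simp
          rw [e1, ← mul_assoc]
          refine le_mul_of_one_le_left (by positivity) ?_
          rw [← ENNReal.ofReal_rpow_of_pos (by positivity),
            ← ENNReal.mul_rpow_of_nonneg _ _ (by linarith)]
          refine ENNReal.one_le_rpow ?_ (by linarith)
          calc (1 : ℝ≥0∞) = ENNReal.ofReal (4 / l) * ENNReal.ofReal (l / 4) := by
                rw [← ENNReal.ofReal_mul (by positivity)]
                field_simp; simp
            _ ≤ _ := by gcongr
      · rw [indicator_of_notMem hs]; exact bot_le
    refine ne_top_of_le_ne_top ?_ (lintegral_mono h1)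
    rw [lintegral_const_mul' _ _ ENNReal.ofReal_ne_top]
    exact ENNReal.mul_ne_top ENNReal.ofReal_ne_top hfp
  have hle : {x | ENNReal.ofReal l < maxFn f x} ⊆
      {x | ENNReal.ofReal (l / 2) < maxFn (S.indicator f) x} := by
    intro x hx
    have hx' : ENNReal.ofReal l < maxFn f x := hx
    have h2 := maxFn_add_const_le (f := f) (g := S.indicator f) (c := ENNReal.ofReal (l / 4))
      (hf.indicator hSm) (by
        intro s
        by_cases hs : s ∈ S
        · rw [indicator_of_mem hs]; exact le_self_add
        · rw [indicator_of_notMem hs, zero_add]; exact not_lt.1 hs) x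
    by_contra h3
    have h3' : maxFn (S.indicator f) x ≤ ENNReal.ofReal (l / 2) := not_lt.1 h3
    have : ENNReal.ofReal l < ENNReal.ofReal l := by
      calc _ < _ := hx'
        _ ≤ _ := h2
        _ ≤ ENNReal.ofReal (l / 2) + ENNReal.ofReal (l / 2) := by
            gcongr
            rw [show (2 : ℝ≥0∞) = ENNReal.ofReal 2 by simp, ← ENNReal.ofReal_mul (by norm_num)]
            apply ENNReal.ofReal_le_ofReal; linarith
        _ = ENNReal.ofReal l := by
            rw [← ENNReal.ofReal_add (by positivity) (by positivity)]; congr 1; ring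
    exact lt_irrefl _ this
  calc _ ≤ _ := measure_mono hle
    _ ≤ _ := volume_lt_maxFn_le hfin (by positivity)
    _ = _ := by
      rw [lintegral_indicator hSm]
      congr 2
      field_simp; norm_num

theorem lintegral_rpow_sub_two_Ioo {p : ℝ} (hp : 1 < p) {a : ℝ} (ha : 0 ≤ a) :
    ∫⁻ l in Ioo 0 a, ENNReal.ofReal (l ^ (p - 2)) = ENNReal.ofReal (a ^ (p - 1) / (p - 1)) := by
  rw [← ofReal_integral_eq_lintegral_ofReal]
  · rw [← integral_Ioc_eq_integral_Ioo, ← intervalIntegral.integral_of_le ha,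
      integral_rpow (Or.inl (by linarith))]
    rw [Real.zero_rpow (by linarith)]
    congr 1
    rw [show p - 2 + 1 = p - 1 by ring]; ring
  · exact ((intervalIntegrable_iff_integrableOn_Ioo_of_le ha).1
      (intervalIntegral.intervalIntegrable_rpow' (by linarith)))
  · filter_upwards [ae_restrict_mem measurableSet_Ioo] with l hl
    exact Real.rpow_nonneg hl.1.le _

/-- The maximal inequality in `L^p`, with an explicit constant. -/
theorem lintegral_maxFn_rpow_le {p : ℝ} (hp : 1 < p) :
    ∃ C : ℝ≥0, ∀ f : ℝ → ℝ≥0∞, Measurable f →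
      ∫⁻ x, maxFn f x ^ p ≤ C * ∫⁻ x, f x ^ p := by
  -- The summand 1 keeps the constant nonzero, so that the right-hand side is `⊤` when the integral
  -- of `f ^ p` is.
  refine ⟨Real.toNNReal (p * 16 * (4 ^ (p - 1) / (p - 1))) + 1, fun f hf => ?_⟩
  rcases eq_or_ne (∫⁻ s, f s ^ p) ⊤ with hfp | hfp
  · rw [hfp, ENNReal.mul_top (by simp)]; exact le_top
  refine le_trans ?_ (mul_le_mul_left (ENNReal.coe_le_coe.2
    (le_self_add (a := Real.toNNReal (p * 16 * (4 ^ (p - 1) / (p - 1)))))) _)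
  have hfae : ∀ᵐ s, f s < ⊤ := by
    filter_upwards [ae_lt_top' (hf.pow_const p).aemeasurable hfp] with s hs
    by_contra h
    rw [not_lt, top_le_iff] at h
    rw [h, ENNReal.top_rpow_of_pos (by linarith)] at hs
    exact lt_irrefl _ hs
  have hMm := measurable_maxFn hf
  -- The layer cake formula is for real-valued functions, so it is applied to truncations; monotone
  -- convergence removes them at the end.
  have trunc : ∀ N : ℕ, ∫⁻ x, (min (maxFn f x) N) ^ p ≤
      (Real.toNNReal (p * 16 * (4 ^ (p - 1) / (p - 1))) : ℝ≥0∞) * ∫⁻ x, f x ^ p := by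
    intro N
    have hne : ∀ x, min (maxFn f x) N ≠ ⊤ := fun x =>
      ne_top_of_le_ne_top (ENNReal.natCast_ne_top N) (min_le_right _ _)
    have e1 : ∀ x, (min (maxFn f x) N) ^ p = ENNReal.ofReal ((min (maxFn f x) N).toReal ^ p) := by
      intro x
      rw [← ENNReal.ofReal_rpow_of_nonneg ENNReal.toReal_nonneg (by linarith),
        ENNReal.ofReal_toReal (hne x)]
    simp_rw [e1]
    rw [lintegral_rpow_eq_lintegral_meas_lt_mul volume
      (ae_of_all _ fun x => ENNReal.toReal_nonneg)
      (hMm.min measurable_const).ennreal_toReal.aemeasurable (by linarith)]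
    calc ENNReal.ofReal p * ∫⁻ l in Ioi (0 : ℝ), volume {x | l < (min (maxFn f x) N).toReal} *
          ENNReal.ofReal (l ^ (p - 1))
        ≤ ENNReal.ofReal p * ∫⁻ l in Ioi (0 : ℝ), ∫⁻ s, ENNReal.ofReal 16 *
          (({q : ℝ × ℝ | ENNReal.ofReal (q.1 / 4) < f q.2}).indicator
            (fun q => f q.2 * ENNReal.ofReal (q.1 ^ (p - 2)))) (l, s) := by
          gcongr ENNReal.ofReal p * ?_
          refine setLIntegral_mono' measurableSet_Ioi fun l hl => ?_
          have hl' : (0 : ℝ) < l := hl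
          calc _ ≤ volume {x | ENNReal.ofReal l < maxFn f x} * ENNReal.ofReal (l ^ (p - 1)) := by
                gcongr ?_ * _
                apply measure_mono
                intro x hx
                have hx' : l < (min (maxFn f x) N).toReal := hx
                exact ((ENNReal.ofReal_lt_iff_lt_toReal hl'.le (hne x)).2 hx').trans_le
                  (min_le_left _ _)
            _ ≤ (ENNReal.ofReal (16 / l) * ∫⁻ s in {s | ENNReal.ofReal (l / 4) < f s}, f s) *
                ENNReal.ofReal (l ^ (p - 1)) := by
                gcongr
                exact volume_lt_maxFn_le_of_rpow hp hf hfp hl'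
            _ = _ := by
                have hm : MeasurableSet {s | ENNReal.ofReal (l / 4) < f s} :=
                  measurableSet_lt measurable_const hf
                rw [lintegral_const_mul' _ _ ENNReal.ofReal_ne_top,
                  mul_comm _ (ENNReal.ofReal (l ^ (p - 1))), ← mul_assoc,
                  ← ENNReal.ofReal_mul (by positivity)]
                have : l ^ (p - 1) * (16 / l) = 16 * l ^ (p - 2) := by
                  rw [show p - 1 = (p - 2) + 1 by ring, Real.rpow_add_one hl'.ne']
                  field_simp
                rw [this, ENNReal.ofReal_mul (by norm_num), mul_assoc]
                congr 1
                rw [← lintegral_const_mul' _ _ ENNReal.ofReal_ne_top, ← lintegral_indicator hm]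
                refine lintegral_congr fun s => ?_
                by_cases hs : ENNReal.ofReal (l / 4) < f s
                · rw [indicator_of_mem (by exact hs), indicator_of_mem (by exact hs), mul_comm]
                · rw [indicator_of_notMem (by exact hs), indicator_of_notMem (by exact hs)]
      _ = ENNReal.ofReal p * ∫⁻ s, ∫⁻ l in Ioi (0 : ℝ), ENNReal.ofReal 16 *
          (({q : ℝ × ℝ | ENNReal.ofReal (q.1 / 4) < f q.2}).indicator
            (fun q => f q.2 * ENNReal.ofReal (q.1 ^ (p - 2)))) (l, s) := by
          rw [lintegral_lintegral_swap]
          refine Measurable.aemeasurable (Measurable.const_mul ?_ _)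
          refine Measurable.indicator ?_ ?_
          · exact (hf.comp measurable_snd).mul
              (ENNReal.measurable_ofReal.comp (measurable_fst.pow_const _))
          · exact measurableSet_lt (by fun_prop) (hf.comp measurable_snd)
      -- After Tonelli, each `s` sees only the levels `l < 4 * f s`, and `l ^ (p - 2)` is integrable
      -- at zero because `p > 1`.
      _ ≤ ENNReal.ofReal p * ∫⁻ s, ENNReal.ofReal 16 *
            (ENNReal.ofReal (4 ^ (p - 1) / (p - 1)) * f s ^ p) := by
          gcongr ENNReal.ofReal p * ?_
          refine lintegral_mono_ae ?_
          filter_upwards [hfae] with s hs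
          rw [lintegral_const_mul' _ _ ENNReal.ofReal_ne_top]
          gcongr
          set a := (f s).toReal with ha
          have hfs : f s = ENNReal.ofReal a := (ENNReal.ofReal_toReal hs.ne).symm
          have ha0 : 0 ≤ a := ENNReal.toReal_nonneg
          calc _ ≤ ∫⁻ l in Ioi (0 : ℝ), (Ioo 0 (4 * a)).indicator
                (fun l => f s * ENNReal.ofReal (l ^ (p - 2))) l := by
                refine setLIntegral_mono' measurableSet_Ioi fun l hl => ?_
                have hl' : (0 : ℝ) < l := hl
                by_cases h : ENNReal.ofReal (l / 4) < f s
                · rw [indicator_of_mem (by exact h), indicator_of_mem]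
                  rw [hfs, ENNReal.ofReal_lt_ofReal_iff_of_nonneg (by positivity)] at h
                  exact ⟨hl', by linarith⟩
                · rw [indicator_of_notMem (by exact h)]; exact bot_le
            _ ≤ ∫⁻ l in Ioo 0 (4 * a), f s * ENNReal.ofReal (l ^ (p - 2)) := by
                rw [← lintegral_indicator measurableSet_Ioo]
                exact setLIntegral_le_lintegral _ _
            _ = f s * ENNReal.ofReal ((4 * a) ^ (p - 1) / (p - 1)) := by
                rw [lintegral_const_mul' _ _ hs.ne, lintegral_rpow_sub_two_Ioo hp (by positivity)]
            _ = _ := by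
                rw [hfs, ENNReal.ofReal_rpow_of_nonneg ha0 (by linarith),
                  ← ENNReal.ofReal_mul ha0, ← ENNReal.ofReal_mul (by
                    have : 0 < p - 1 := by linarith
                    positivity), Real.mul_rpow (by norm_num) ha0]
                congr 1
                rcases ha0.eq_or_lt with h | h
                · rw [← h, Real.zero_rpow (by linarith), Real.zero_rpow (by linarith)]; ring
                · rw [show a ^ p = a ^ (p - 1) * a by
                    rw [← Real.rpow_add_one h.ne']; congr 1; ring]
                  ring
      _ = _ := by
          rw [lintegral_const_mul' _ _ ENNReal.ofReal_ne_top,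
            lintegral_const_mul' _ _ ENNReal.ofReal_ne_top, ← mul_assoc, ← mul_assoc,
            ← ENNReal.ofReal_mul (by linarith), ← ENNReal.ofReal_mul (by linarith)]
          rfl
  have hsup : ∀ x, maxFn f x ^ p = ⨆ N : ℕ, (min (maxFn f x) N) ^ p := by
    intro x
    have hmono : Monotone fun N : ℕ => (min (maxFn f x) (N : ℝ≥0∞)) ^ p := by
      intro a b hab
      have : (a : ℝ≥0∞) ≤ b := by exact_mod_cast hab
      dsimp only
      gcongr
    refine tendsto_nhds_unique (f := fun N : ℕ => (min (maxFn f x) (N : ℝ≥0∞)) ^ p) ?_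
      (tendsto_atTop_iSup hmono)
    have h1 : Tendsto (fun N : ℕ => min (maxFn f x) (N : ℝ≥0∞)) atTop (𝓝 (maxFn f x)) := by
      have := (tendsto_const_nhds (x := maxFn f x)).min ENNReal.tendsto_nat_nhds_top
      simpa using this
    exact (ENNReal.continuous_rpow_const.tendsto _).comp h1
  simp_rw [hsup]
  rw [lintegral_iSup]
  · exact iSup_le trunc
  · intro N
    exact (hMm.min measurable_const).pow_const p
  · intro a b hab x
    have : (a : ℝ≥0∞) ≤ b := by exact_mod_cast hab
    dsimp only
    gcongr

/-! ### The Cauchy integral: derivative and decay. -/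

/-- The Cauchy integral of a function on the real line. -/
noncomputable def cauchyInt (f : ℝ → ℂ) (z : ℂ) : ℂ :=
  (2 * Real.pi * Complex.I)⁻¹ * ∫ s : ℝ, f s / ((s : ℂ) - z)

/-- The complex derivative of the Cauchy integral. -/
noncomputable def cauchyIntDeriv (f : ℝ → ℂ) (z : ℂ) : ℂ :=
  (2 * Real.pi * Complex.I)⁻¹ * ∫ s : ℝ, f s / ((s : ℂ) - z) ^ 2

/-- Integrability of a function against the weight `1 + |s|`. -/
structure FastDecay (f : ℝ → ℂ) : Prop where
  aesm : AEStronglyMeasurable f volume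
  integrable : Integrable (fun s => (1 + |s|) * ‖f s‖)

theorem FastDecay.integrable_self {f : ℝ → ℂ} (hf : FastDecay f) : Integrable f := by
  refine hf.integrable.mono hf.aesm (ae_of_all _ fun s => ?_)
  rw [Real.norm_of_nonneg (by positivity)]
  nlinarith [abs_nonneg s, norm_nonneg (f s), mul_nonneg (abs_nonneg s) (norm_nonneg (f s))]

theorem FastDecay.mono {f g : ℝ → ℂ} (hf : FastDecay f) (hg : AEStronglyMeasurable g volume)
    (h : ∀ s, ‖g s‖ ≤ ‖f s‖) : FastDecay g := by
  refine ⟨hg, hf.integrable.mono ?_ (ae_of_all _ fun s => ?_)⟩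
  · exact (by fun_prop : Continuous fun s : ℝ => 1 + |s|).aestronglyMeasurable.mul hg.norm
  · rw [Real.norm_of_nonneg (by positivity), Real.norm_of_nonneg (by positivity)]
    gcongr
    exact h s

theorem im_le_norm_sub (s : ℝ) (z : ℂ) : z.im ≤ ‖(s : ℂ) - z‖ := by
  have := Complex.abs_im_le_norm ((s : ℂ) - z)
  simp only [Complex.sub_im, Complex.ofReal_im, zero_sub, abs_neg] at this
  exact (le_abs_self _).trans this

theorem abs_sub_re_le_norm_sub (s : ℝ) (z : ℂ) : |s - z.re| ≤ ‖(s : ℂ) - z‖ := by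
  simpa using Complex.abs_re_le_norm ((s : ℂ) - z)

/-- Combine |Re z| ≤ |s| + |s - z| with 1 ≤ |s - z|/d. This converts the weight `1 + |s|` on a
density into decay of its Cauchy integral along horizontal lines. -/
theorem norm_sub_inv_le {d : ℝ} (hd : 0 < d) {z : ℂ} (hz : d ≤ z.im) (s : ℝ) :
    ‖(s : ℂ) - z‖⁻¹ ≤ ((1 + |s|) * (d⁻¹ + 1)) / (1 + |z.re|) := by
  have h1 := im_le_norm_sub s z
  have h2 := abs_sub_re_le_norm_sub s z
  set N := ‖(s : ℂ) - z‖
  have hN : 0 < N := by linarith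
  rw [inv_eq_one_div, div_le_div_iff₀ hN (by positivity)]
  have h3 : |z.re| ≤ |s| + N := by
    have := abs_sub_abs_le_abs_sub z.re s
    rw [abs_sub_comm] at this
    linarith
  have h4 : 1 ≤ d⁻¹ * N := by
    rw [inv_mul_eq_div, le_div_iff₀ hd]; linarith
  nlinarith [abs_nonneg s, mul_nonneg (abs_nonneg s) hN.le]

theorem FastDecay.integrable_div_pow {f : ℝ → ℂ} (hf : FastDecay f) {z : ℂ} (hz : 0 < z.im)
    (n : ℕ) : Integrable fun s : ℝ => f s / ((s : ℂ) - z) ^ n := by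
  refine (hf.integrable_self.norm.mul_const ((z.im ^ n)⁻¹)).mono' ?_ (ae_of_all _ fun s => ?_)
  · exact (hf.aesm.aemeasurable.div (Measurable.aemeasurable
      (f := fun s : ℝ => ((s : ℂ) - z) ^ n) (by fun_prop))).aestronglyMeasurable
  · rw [norm_div, norm_pow, div_eq_mul_inv]
    gcongr
    exact im_le_norm_sub s z

theorem hasDerivAt_cauchyInt {f : ℝ → ℂ} (hf : FastDecay f) {z : ℂ} (hz : 0 < z.im) :
    HasDerivAt (cauchyInt f) (cauchyIntDeriv f z) z := by
  have hne : ∀ w ∈ Metric.ball z (z.im / 2), z.im / 2 ≤ w.im := by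
    intro w hw
    have := (Complex.abs_im_le_norm (w - z)).trans_lt (mem_ball_iff_norm.1 hw)
    rw [Complex.sub_im, abs_lt] at this
    linarith
  have hne' : ∀ w ∈ Metric.ball z (z.im / 2), ∀ s : ℝ, (s : ℂ) - w ≠ 0 := fun w hw s =>
    norm_pos_iff.1 (lt_of_lt_of_le (by linarith [hne w hw]) (im_le_norm_sub s w))
  have hz' : 0 < z.im / 2 := by positivity
  refine HasDerivAt.const_mul _ ?_
  refine (hasDerivAt_integral_of_dominated_loc_of_deriv_le (𝕜 := ℂ)
    (F := fun w (s : ℝ) => f s / ((s : ℂ) - w)) (F' := fun w (s : ℝ) => f s / ((s : ℂ) - w) ^ 2)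
    (bound := fun s => ‖f s‖ * ((z.im / 2) ^ 2)⁻¹)
    (Metric.ball_mem_nhds z hz') ?_ ?_ ?_ ?_ ?_ ?_).2
  · filter_upwards [Metric.ball_mem_nhds z hz'] with w hw
    simpa using (hf.integrable_div_pow (hz'.trans_le (hne w hw)) 1).aestronglyMeasurable
  · simpa using hf.integrable_div_pow hz 1
  · exact (hf.integrable_div_pow hz 2).aestronglyMeasurable
  · refine ae_of_all _ fun s w hw => ?_
    rw [norm_div, norm_pow, div_eq_mul_inv]
    gcongr
    exact (hne w hw).trans (im_le_norm_sub s w)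
  · exact hf.integrable_self.norm.mul_const _
  · refine ae_of_all _ fun s w hw => ?_
    have h1 : HasDerivAt (fun w : ℂ => (s : ℂ) - w) (-1) w := by
      simpa using (hasDerivAt_id w).const_sub (s : ℂ)
    have h2 := (h1.inv (hne' w hw s)).const_mul (f s)
    rw [neg_neg, one_div] at h2
    simp only [div_eq_mul_inv]
    exact h2

/-- A constant controlling the decay of the Cauchy integral. -/
noncomputable def decayConst (f : ℝ → ℂ) (d : ℝ) : ℝ :=
  (∫ s, (1 + |s|) * ‖f s‖) * (d⁻¹ + 1)

theorem decayConst_nonneg (f : ℝ → ℂ) {d : ℝ} (hd : 0 < d) : 0 ≤ decayConst f d :=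
  mul_nonneg (integral_nonneg fun s => by positivity) (by positivity)

theorem norm_two_pi_I_inv_le : ‖(2 * Real.pi * Complex.I : ℂ)⁻¹‖ ≤ 1 := by
  rw [norm_inv, norm_mul, norm_mul, Complex.norm_I, mul_one, Complex.norm_real,
    Complex.norm_ofNat, Real.norm_of_nonneg Real.pi_pos.le]
  exact inv_le_one_of_one_le₀ (by linarith [Real.pi_gt_three])

theorem norm_cauchyInt_le {f : ℝ → ℂ} (hf : FastDecay f) {d : ℝ} (hd : 0 < d) {z : ℂ}
    (hz : d ≤ z.im) : ‖cauchyInt f z‖ ≤ decayConst f d * (1 + |z.re|)⁻¹ := by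
  rw [cauchyInt, norm_mul]
  refine (mul_le_of_le_one_left (norm_nonneg _) norm_two_pi_I_inv_le).trans ?_
  calc _ ≤ ∫ s : ℝ, ((1 + |s|) * ‖f s‖) * ((d⁻¹ + 1) * (1 + |z.re|)⁻¹) := by
        refine norm_integral_le_of_norm_le (hf.integrable.mul_const _) (ae_of_all _ fun s => ?_)
        rw [norm_div, div_eq_mul_inv]
        calc _ ≤ ‖f s‖ * (((1 + |s|) * (d⁻¹ + 1)) / (1 + |z.re|)) := by
              gcongr; exact norm_sub_inv_le hd hz s
          _ = _ := by ring
    _ = _ := by rw [integral_mul_const, decayConst]; ring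

theorem norm_cauchyIntDeriv_le {f : ℝ → ℂ} (hf : FastDecay f) {d : ℝ} (hd : 0 < d) {z : ℂ}
    (hz : d ≤ z.im) : ‖cauchyIntDeriv f z‖ ≤ decayConst f d * d⁻¹ * (1 + |z.re|)⁻¹ := by
  rw [cauchyIntDeriv, norm_mul]
  refine (mul_le_of_le_one_left (norm_nonneg _) norm_two_pi_I_inv_le).trans ?_
  calc _ ≤ ∫ s : ℝ, ((1 + |s|) * ‖f s‖) * ((d⁻¹ + 1) * d⁻¹ * (1 + |z.re|)⁻¹) := by
        refine norm_integral_le_of_norm_le (hf.integrable.mul_const _) (ae_of_all _ fun s => ?_)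
        rw [norm_div, div_eq_mul_inv, norm_pow, sq, mul_inv]
        have h2 : ‖(s : ℂ) - z‖⁻¹ ≤ d⁻¹ := inv_anti₀ hd (hz.trans (im_le_norm_sub s z))
        calc _ ≤ ‖f s‖ * ((((1 + |s|) * (d⁻¹ + 1)) / (1 + |z.re|)) * d⁻¹) := by
              gcongr; exact norm_sub_inv_le hd hz s
          _ = _ := by ring
    _ = _ := by rw [integral_mul_const, decayConst]; ring

/-! ### The Poisson kernel. -/

/-- The Poisson kernel of the upper half-plane. -/
noncomputable def poissonKer (y s : ℝ) : ℝ := y / (Real.pi * (s ^ 2 + y ^ 2))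

theorem poissonKer_pos {y : ℝ} (hy : 0 < y) (s : ℝ) : 0 < poissonKer y s := by
  unfold poissonKer; have := Real.pi_pos; positivity

theorem continuous_poissonKer {y : ℝ} (hy : 0 < y) : Continuous (poissonKer y) := by
  unfold poissonKer
  refine continuous_const.div (by fun_prop) fun s => ?_
  have := Real.pi_pos; positivity

theorem poissonKer_eq {y : ℝ} (hy : 0 < y) (s : ℝ) :
    poissonKer y s = ProbabilityTheory.cauchyPDFReal 0 y.toNNReal s := by
  rw [poissonKer, ProbabilityTheory.cauchyPDFReal_def]
  have := Real.pi_pos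
  simp only [sub_zero, Real.coe_toNNReal y hy.le]
  field_simp

theorem integrable_poissonKer {y : ℝ} (hy : 0 < y) : Integrable (poissonKer y) := by
  rw [funext (poissonKer_eq hy)]
  exact ProbabilityTheory.integrable_cauchyPDFReal 0

theorem integral_poissonKer {y : ℝ} (hy : 0 < y) : ∫ s, poissonKer y s = 1 := by
  rw [funext (poissonKer_eq hy)]
  exact ProbabilityTheory.integral_cauchyPDFReal_eq_one 0 (by simpa using hy)

theorem lintegral_poissonKer {y : ℝ} (hy : 0 < y) :
    ∫⁻ s, ENNReal.ofReal (poissonKer y s) = 1 := by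
  rw [← ofReal_integral_eq_lintegral_ofReal (integrable_poissonKer hy)
    (ae_of_all _ fun s => (poissonKer_pos hy s).le), integral_poissonKer hy, ENNReal.ofReal_one]

/-- Convolution with the Poisson kernel is a contraction of `L^p`. -/
theorem lintegral_poisson_rpow_le {p : ℝ} (hp : 1 < p) {f : ℝ → ℝ≥0∞} (hf : AEMeasurable f)
    {y : ℝ} (hy : 0 < y) :
    ∫⁻ x, (∫⁻ s, ENNReal.ofReal (poissonKer y (x - s)) * f s) ^ p ≤ ∫⁻ s, f s ^ p := by
  have hpq := Real.HolderConjugate.conjExponent hp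
  set q := p.conjExponent
  have hP : ∀ x, Measurable fun s => ENNReal.ofReal (poissonKer y (x - s)) := fun x =>
    ENNReal.measurable_ofReal.comp ((continuous_poissonKer hy).comp (by fun_prop)).measurable
  -- Jensen's inequality for the probability density P, obtained from Hölder's inequality by writing
  -- P as P^{1/q} P^{1/p}.
  have h1 : ∀ x, (∫⁻ s, ENNReal.ofReal (poissonKer y (x - s)) * f s) ^ p ≤
      ∫⁻ s, ENNReal.ofReal (poissonKer y (x - s)) * f s ^ p := by
    intro x
    set P := fun s => ENNReal.ofReal (poissonKer y (x - s)) with hPdef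
    have hPne : ∀ s, P s ≠ ⊤ := fun s => ENNReal.ofReal_ne_top
    have hP0 : ∀ s, P s ≠ 0 := fun s => by
      simpa [hPdef] using poissonKer_pos hy (x - s)
    have e0 : ∫⁻ s, P s = 1 := by
      rw [hPdef, lintegral_sub_left_eq_self (fun s => ENNReal.ofReal (poissonKer y s)) x]
      exact lintegral_poissonKer hy
    have e1 : ∀ s, P s * f s = ((fun s => P s ^ (1 / q)) * fun s => P s ^ (1 / p) * f s) s := by
      intro s
      simp only [Pi.mul_apply]
      rw [← mul_assoc, ← ENNReal.rpow_add _ _ (hP0 s) (hPne s)]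
      congr 1
      rw [one_div, one_div, add_comm, hpq.inv_add_inv_eq_one, ENNReal.rpow_one]
    have e2 := ENNReal.lintegral_mul_le_Lp_mul_Lq volume hpq.symm
      (f := fun s => P s ^ (1 / q)) (g := fun s => P s ^ (1 / p) * f s)
      ((hP x).pow_const _).aemeasurable (((hP x).pow_const _).aemeasurable.mul hf)
    simp_rw [← e1] at e2
    have e3 : ∀ s, (P s ^ (1 / q)) ^ q = P s := fun s => by
      rw [← ENNReal.rpow_mul, one_div, inv_mul_cancel₀ hpq.symm.ne_zero, ENNReal.rpow_one]
    have e4 : ∀ s, (P s ^ (1 / p) * f s) ^ p = P s * f s ^ p := fun s => by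
      rw [ENNReal.mul_rpow_of_nonneg _ _ (by linarith), ← ENNReal.rpow_mul, one_div,
        inv_mul_cancel₀ (by linarith), ENNReal.rpow_one]
    simp_rw [e3, e4, e0, ENNReal.one_rpow, one_mul] at e2
    calc _ ≤ ((∫⁻ s, P s * f s ^ p) ^ (1 / p)) ^ p := by gcongr
      _ = _ := by
        rw [← ENNReal.rpow_mul, one_div, inv_mul_cancel₀ (by linarith), ENNReal.rpow_one]
  calc _ ≤ ∫⁻ x, ∫⁻ s, ENNReal.ofReal (poissonKer y (x - s)) * f s ^ p := lintegral_mono h1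
    _ = ∫⁻ s, ∫⁻ x, ENNReal.ofReal (poissonKer y (x - s)) * f s ^ p := by
        rw [lintegral_lintegral_swap]
        refine AEMeasurable.mul ?_ ((hf.comp_quasiMeasurePreserving
          Measure.quasiMeasurePreserving_snd).pow_const p)
        refine (ENNReal.measurable_ofReal.comp ?_).aemeasurable
        exact ((continuous_poissonKer hy).comp (by fun_prop)).measurable
    _ = _ := by
        refine lintegral_congr fun s => ?_
        have hm : Measurable fun x => ENNReal.ofReal (poissonKer y (x - s)) :=
          ENNReal.measurable_ofReal.comp
            ((continuous_poissonKer hy).comp (by fun_prop)).measurable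
        rw [lintegral_mul_const'' _ hm.aemeasurable,
          lintegral_sub_right_eq_self (fun x => ENNReal.ofReal (poissonKer y x)) s,
          lintegral_poissonKer hy, one_mul]

/-- For real s, the real part of 1/(πi(s - z)) is the Poisson kernel. Consequently twice the Cauchy
integral of a nonnegative function takes values in the closed right half-plane. -/
theorem two_mul_re_cauchyInt {f : ℝ → ℝ} (hf : FastDecay fun s => (f s : ℂ)) {x y : ℝ}
    (hy : 0 < y) :
    (2 * cauchyInt (fun s => (f s : ℂ)) (x + y * Complex.I)).re
      = ∫ s, poissonKer y (x - s) * f s := by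
  have hz : 0 < ((x : ℂ) + y * Complex.I).im := by simpa using hy
  have hint : Integrable fun s : ℝ => (Real.pi * Complex.I : ℂ)⁻¹ *
      ((f s : ℂ) / ((s : ℂ) - (x + y * Complex.I))) := by
    simpa using (hf.integrable_div_pow hz 1).const_mul ((Real.pi * Complex.I : ℂ)⁻¹)
  have hpi : (Real.pi : ℂ) ≠ 0 := by exact_mod_cast Real.pi_ne_zero
  have e : 2 * cauchyInt (fun s => (f s : ℂ)) (x + y * Complex.I) =
      ∫ s : ℝ, (Real.pi * Complex.I : ℂ)⁻¹ *
        ((f s : ℂ) / ((s : ℂ) - (x + y * Complex.I))) := by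
    rw [cauchyInt, integral_const_mul, ← mul_assoc]
    congr 1
    field_simp
  rw [e]
  have := (integral_re hint)
  simp only [RCLike.re_to_complex] at this
  rw [← this]
  refine integral_congr_ae (ae_of_all _ fun s => ?_)
  simp only [poissonKer]
  have h1 : (Real.pi * Complex.I : ℂ)⁻¹ = ((Real.pi⁻¹ : ℝ) : ℂ) * (-Complex.I) := by
    rw [mul_inv, Complex.inv_I]; push_cast; ring
  have h2 : ((s : ℂ) - (x + y * Complex.I)) ≠ 0 :=
    norm_pos_iff.1 (hz.trans_le (im_le_norm_sub s _))
  rw [h1, mul_assoc, Complex.re_ofReal_mul, div_eq_mul_inv, Complex.inv_def]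
  simp [Complex.normSq_apply]
  have := Real.pi_pos
  field_simp
  ring

/-! ### M. Riesz's argument for nonnegative functions and `1 < p ≤ 2`. -/

/-- The angle θ₀ is the midpoint of π/(2p) and π/2. For |θ| ≥ θ₀ the angle pθ lies beyond π/2 and,
since p ≤ 2, not beyond π, so cos(pθ) is negative and bounded away from zero: this fixes `b`. For
|θ| ≤ θ₀ the cosine of θ is bounded below, and a large `a` suffices. Scaled by |z|^p, the inequality
bounds |z|^p by (Re z)^p up to a multiple of Re z^p, whose integral will vanish. -/
theorem exists_one_le_cos_rpow_sub {p : ℝ} (hp : 1 < p) (hp2 : p ≤ 2) :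
    ∃ a b : ℝ, 0 ≤ a ∧ 0 ≤ b ∧ ∀ θ : ℝ, |θ| ≤ Real.pi / 2 →
      1 ≤ a * Real.cos θ ^ p - b * Real.cos (θ * p) := by
  have hpi := Real.pi_pos
  set θ₀ := Real.pi * (p + 1) / (4 * p) with hθ₀
  have hθp : θ₀ * p = Real.pi * (p + 1) / 4 := by rw [hθ₀]; field_simp
  have h0 : 0 < θ₀ := by positivity
  have h1 : θ₀ < Real.pi / 2 := by
    rw [hθ₀, div_lt_div_iff₀ (by positivity) (by norm_num)]
    nlinarith
  have h2 : Real.cos (θ₀ * p) < 0 := by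
    apply Real.cos_neg_of_pi_div_two_lt_of_lt
    · rw [hθp]; nlinarith
    · rw [hθp]; nlinarith
  have h3 : 0 < Real.cos θ₀ := Real.cos_pos_of_mem_Ioo ⟨by linarith, h1⟩
  have h3' : 0 < Real.cos θ₀ ^ p := Real.rpow_pos_of_pos h3 p
  set b := (-Real.cos (θ₀ * p))⁻¹ with hb
  have hb0 : 0 < b := inv_pos.2 (by linarith)
  have hb1 : b * Real.cos (θ₀ * p) = -1 := by
    rw [hb, inv_neg, neg_mul, inv_mul_cancel₀ h2.ne]
  refine ⟨(1 + b) / Real.cos θ₀ ^ p, b, by positivity, hb0.le, ?_⟩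
  suffices h : ∀ θ : ℝ, 0 ≤ θ → θ ≤ Real.pi / 2 →
      1 ≤ (1 + b) / Real.cos θ₀ ^ p * Real.cos θ ^ p - b * Real.cos (θ * p) by
    intro θ hθ
    have := h |θ| (abs_nonneg _) hθ
    rw [Real.cos_abs] at this
    rcases abs_cases θ with ⟨e, -⟩ | ⟨e, -⟩
    · rwa [e] at this
    · rwa [e, neg_mul, Real.cos_neg] at this
  intro θ hθ0 hθ1
  have hc0 : 0 ≤ Real.cos θ := Real.cos_nonneg_of_mem_Icc ⟨by linarith, hθ1⟩
  rcases le_total θ θ₀ with h | h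
  · have h4 : Real.cos θ₀ ^ p ≤ Real.cos θ ^ p := by
      refine Real.rpow_le_rpow h3.le (Real.cos_le_cos_of_nonneg_of_le_pi hθ0 (by linarith) h)
        (by linarith)
    have h5 : 1 + b ≤ (1 + b) / Real.cos θ₀ ^ p * Real.cos θ ^ p := by
      rw [div_mul_eq_mul_div, le_div_iff₀ h3']
      gcongr
    nlinarith [Real.cos_le_one (θ * p)]
  · have h4 : Real.cos (θ * p) ≤ Real.cos (θ₀ * p) := by
      apply Real.cos_le_cos_of_nonneg_of_le_pi (by positivity) (by nlinarith)
      gcongr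
    have h5 : 0 ≤ (1 + b) / Real.cos θ₀ ^ p * Real.cos θ ^ p := by positivity
    nlinarith

theorem norm_rpow_le_of_re_pos {a b p : ℝ}
    (h : ∀ θ : ℝ, |θ| ≤ Real.pi / 2 → 1 ≤ a * Real.cos θ ^ p - b * Real.cos (θ * p))
    {z : ℂ} (hz : 0 < z.re) : ‖z‖ ^ p ≤ a * z.re ^ p - b * (z ^ (p : ℂ)).re := by
  have h1 := h z.arg (Complex.abs_arg_le_pi_div_two_iff.2 hz.le)
  have hc : 0 ≤ Real.cos z.arg := Real.cos_nonneg_of_mem_Icc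
    (abs_le.1 (Complex.abs_arg_le_pi_div_two_iff.2 hz.le))
  rw [Complex.cpow_ofReal_re]
  have e : z.re ^ p = ‖z‖ ^ p * Real.cos z.arg ^ p := by
    rw [← Real.mul_rpow (norm_nonneg _) hc, Complex.norm_mul_cos_arg]
  rw [e]
  have := Real.rpow_nonneg (norm_nonneg z) p
  nlinarith

theorem integrable_one_add_abs_rpow {p : ℝ} (hp : 1 < p) :
    Integrable fun x : ℝ => (1 + |x|) ^ (-p) := by
  have := integrable_one_add_norm (E := ℝ) (μ := volume) (r := p) (by simpa using hp)
  simpa using this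

theorem hasDerivAt_horizontal {Φ : ℂ → ℂ} {Φ' : ℂ} {x y : ℝ}
    (h : HasDerivAt Φ Φ' (x + y * Complex.I)) :
    HasDerivAt (fun x : ℝ => Φ (x + y * Complex.I)) Φ' x := by
  have h1 : HasDerivAt (fun x : ℝ => (x : ℂ) + y * Complex.I) 1 x :=
    (Complex.ofRealCLM.hasDerivAt (x := x)).add_const _
  have h2 := HasDerivAt.comp x h h1
  rw [mul_one] at h2
  exact h2

theorem hasDerivAt_vertical {Φ : ℂ → ℂ} {Φ' : ℂ} {x y : ℝ}
    (h : HasDerivAt Φ Φ' (x + y * Complex.I)) :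
    HasDerivAt (fun y : ℝ => Φ (x + y * Complex.I)) (Φ' * Complex.I) y := by
  have h1 : HasDerivAt (fun y : ℝ => (x : ℂ) + y * Complex.I) Complex.I y := by
    simpa using ((Complex.ofRealCLM.hasDerivAt (x := y)).mul_const Complex.I).const_add (x : ℂ)
  exact HasDerivAt.comp y h h1

/-- Cauchy's theorem on horizontal lines, for functions decaying in the upper half-plane. -/
theorem integral_horizontal_eq_zero {Φ Φ' : ℂ → ℂ} {p : ℝ} (hp : 1 < p)
    (hd : ∀ z : ℂ, 0 < z.im → HasDerivAt Φ (Φ' z) z)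
    (hb : ∀ d > 0, ∃ C, ∀ z : ℂ, d ≤ z.im → ‖Φ z‖ ≤ C * (1 + |z.re|) ^ (-p) ∧
      ‖Φ' z‖ ≤ C * (1 + |z.re|) ^ (-p))
    (hlim : ∀ x : ℝ, Tendsto (fun y : ℝ => Φ (x + y * Complex.I)) atTop (𝓝 0))
    {y : ℝ} (hy : 0 < y) : ∫ x : ℝ, Φ (x + y * Complex.I) = 0 := by
  have hdx : ∀ x y : ℝ, 0 < y → HasDerivAt (fun x : ℝ => Φ (x + y * Complex.I))
      (Φ' (x + y * Complex.I)) x := by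
    exact fun x y hy => hasDerivAt_horizontal (hd _ (by simpa using hy))
  have hdy : ∀ x y : ℝ, 0 < y → HasDerivAt (fun y : ℝ => Φ (x + y * Complex.I))
      (Φ' (x + y * Complex.I) * Complex.I) y := by
    exact fun x y hy => hasDerivAt_vertical (hd _ (by simpa using hy))
  have hcont : ∀ y : ℝ, 0 < y → Continuous fun x : ℝ => Φ (x + y * Complex.I) := fun y hy =>
    continuous_iff_continuousAt.2 fun x => (hdx x y hy).continuousAt
  have hm' : ∀ y : ℝ, 0 < y → AEStronglyMeasurable (fun x : ℝ => Φ' (x + y * Complex.I)) volume := by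
    intro y hy
    have : (fun x : ℝ => Φ' (x + y * Complex.I)) = deriv fun x : ℝ => Φ (x + y * Complex.I) :=
      funext fun x => (hdx x y hy).deriv.symm
    rw [this]
    exact (measurable_deriv _).aestronglyMeasurable
  have hint : ∀ y : ℝ, 0 < y → Integrable (fun x : ℝ => Φ (x + y * Complex.I)) := by
    intro y hy
    obtain ⟨C, hC⟩ := hb y hy
    refine ((integrable_one_add_abs_rpow hp).const_mul C).mono' (hcont y hy).aestronglyMeasurable
      (ae_of_all _ fun x => ?_)
    simpa using (hC (x + y * Complex.I) (by simp)).1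
  have hint' : ∀ y : ℝ, 0 < y → Integrable (fun x : ℝ => Φ' (x + y * Complex.I)) := by
    intro y hy
    obtain ⟨C, hC⟩ := hb y hy
    refine ((integrable_one_add_abs_rpow hp).const_mul C).mono' (hm' y hy)
      (ae_of_all _ fun x => ?_)
    simpa using (hC (x + y * Complex.I) (by simp)).2
  -- The vertical derivative is i times the horizontal one, and the latter has integral zero. So the
  -- integral does not depend on the height, and it tends to zero at infinity.
  have hJ : ∀ y : ℝ, 0 < y → HasDerivAt (fun y : ℝ => ∫ x : ℝ, Φ (x + y * Complex.I)) 0 y := by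
    intro y hy
    obtain ⟨C, hC⟩ := hb (y / 2) (by positivity)
    have hball : ∀ w ∈ Metric.ball y (y / 2), y / 2 ≤ w := by
      intro w hw
      have := abs_lt.1 (Real.dist_eq w y ▸ Metric.mem_ball.1 hw)
      linarith
    have := (hasDerivAt_integral_of_dominated_loc_of_deriv_le
      (F := fun y x : ℝ => Φ (x + y * Complex.I))
      (F' := fun y x : ℝ => Φ' (x + y * Complex.I) * Complex.I)
      (bound := fun x => C * (1 + |x|) ^ (-p)) (μ := volume) (x₀ := y)
      (Metric.ball_mem_nhds y (by positivity : 0 < y / 2)) ?_ (hint y hy) ?_ ?_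
      ((integrable_one_add_abs_rpow hp).const_mul C) ?_).2
    · rw [integral_mul_const, integral_eq_zero_of_hasDerivAt_of_integrable
        (fun x => hdx x y hy) (hint' y hy) (hint y hy), zero_mul] at this
      exact this
    · filter_upwards [lt_mem_nhds hy] with w hw using (hcont w hw).aestronglyMeasurable
    · exact (hm' y hy).mul_const _
    · refine ae_of_all _ fun x w hw => ?_
      simpa using (hC (x + w * Complex.I) (by simpa using hball w hw)).2
    · refine ae_of_all _ fun x w hw => hdy x w (by linarith [hball w hw])
  have hconst : ∀ Y ∈ Ioi y, ∫ x : ℝ, Φ (x + Y * Complex.I) = ∫ x : ℝ, Φ (x + y * Complex.I) := by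
    intro Y hY
    refine constant_of_derivWithin_zero (a := y) (b := Y)
      (f := fun y : ℝ => ∫ x : ℝ, Φ (x + y * Complex.I)) ?_ ?_ Y ⟨le_of_lt hY, le_rfl⟩
    · intro w hw
      exact (hJ w (hy.trans_le hw.1)).differentiableAt.differentiableWithinAt
    · intro w hw
      exact ((hJ w (hy.trans_le hw.1)).hasDerivWithinAt).derivWithin
        (uniqueDiffOn_Icc hY w ⟨hw.1, hw.2.le⟩)
  have hlimJ : Tendsto (fun Y : ℝ => ∫ x : ℝ, Φ (x + Y * Complex.I)) atTop (𝓝 0) := by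
    obtain ⟨C, hC⟩ := hb 1 one_pos
    have := tendsto_integral_filter_of_dominated_convergence (μ := volume) (l := atTop)
      (F := fun Y x : ℝ => Φ (x + Y * Complex.I)) (f := fun _ => 0)
      (fun x => C * (1 + |x|) ^ (-p)) ?_ ?_ ((integrable_one_add_abs_rpow hp).const_mul C)
      (ae_of_all _ fun x => hlim x)
    · simpa using this
    · filter_upwards [eventually_gt_atTop 0] with Y hY using (hcont Y hY).aestronglyMeasurable
    · filter_upwards [eventually_ge_atTop 1] with Y hY
      refine ae_of_all _ fun x => ?_
      simpa using (hC (x + Y * Complex.I) (by simpa using hY)).1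
  refine tendsto_nhds_unique (tendsto_const_nhds.congr' ?_) hlimJ
  filter_upwards [eventually_gt_atTop y] with Y hY using (hconst Y hY).symm

theorem norm_cauchyInt_le_div {f : ℝ → ℂ} (hf : FastDecay f) {z : ℂ} (hz : 0 < z.im) :
    ‖cauchyInt f z‖ ≤ (∫ s, ‖f s‖) / z.im := by
  rw [cauchyInt, norm_mul]
  refine (mul_le_of_le_one_left (norm_nonneg _) norm_two_pi_I_inv_le).trans ?_
  rw [div_eq_mul_inv, ← integral_mul_const]
  refine norm_integral_le_of_norm_le (hf.integrable_self.norm.mul_const _)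
    (ae_of_all _ fun s => ?_)
  rw [norm_div, div_eq_mul_inv]
  gcongr
  exact im_le_norm_sub s z

/-- Strict positivity keeps the Cauchy integral off the branch cut of the complex power; the price
is that functions vanishing almost everywhere are treated separately. -/
theorem integral_poisson_pos {f : ℝ → ℝ} (hf : FastDecay fun s => (f s : ℂ)) (h0 : ∀ s, 0 ≤ f s)
    (hne : ¬ f =ᵐ[volume] 0) {y : ℝ} (hy : 0 < y) (x : ℝ) :
    0 < ∫ s, poissonKer y (x - s) * f s := by
  have hfi : Integrable f := by
    have := hf.integrable_self.re
    simpa using this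
  have hP : ∀ s, 0 < poissonKer y (x - s) := fun s => poissonKer_pos hy _
  rw [integral_pos_iff_support_of_nonneg (fun s => mul_nonneg (hP s).le (h0 s))]
  · have : (Function.support fun s => poissonKer y (x - s) * f s) = Function.support f := by
      ext s; simp [(hP s).ne']
    rw [this, pos_iff_ne_zero]
    intro h
    exact hne (by rw [Filter.EventuallyEq, ae_iff]; exact h)
  · refine hfi.bdd_mul (c := 1 / (Real.pi * y)) ?_ ?_
    · exact ((continuous_poissonKer hy).comp (by fun_prop)).aestronglyMeasurable
    · refine ae_of_all _ fun s => ?_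
      rw [Real.norm_of_nonneg (hP s).le, poissonKer]
      have := Real.pi_pos
      rw [div_le_div_iff₀ (by positivity) (by positivity)]
      nlinarith [mul_nonneg this.le (sq_nonneg (x - s))]

/-- Let Z be twice the Cauchy integral. Its real part is positive, so Z^p is holomorphic, and it
integrates to zero on every horizontal line. The trigonometric inequality then bounds the integral
of |Z|^p by that of (Re Z)^p, and Re Z is a Poisson integral of `f`. -/
theorem lintegral_cauchyInt_rpow_le_of_nonneg {p : ℝ} (hp : 1 < p) (hp2 : p ≤ 2) :
    ∃ C : ℝ≥0, ∀ f : ℝ → ℝ, FastDecay (fun s => (f s : ℂ)) → (∀ s, 0 ≤ f s) → ∀ y : ℝ, 0 < y →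
      ∫⁻ x : ℝ, ‖cauchyInt (fun s => (f s : ℂ)) (x + y * Complex.I)‖ₑ ^ p ≤
        C * ∫⁻ s, ‖f s‖ₑ ^ p := by
  obtain ⟨a, b, ha, hb, hab⟩ := exists_one_le_cos_rpow_sub hp hp2
  refine ⟨a.toNNReal, fun f hf h0 y hy => ?_⟩
  have hp0 : p ≠ 0 := by linarith
  by_cases hne : f =ᵐ[volume] 0
  · have h1 : ∀ z, cauchyInt (fun s => (f s : ℂ)) z = 0 := by
      intro z
      rw [cauchyInt, integral_eq_zero_of_ae, mul_zero]
      filter_upwards [hne] with s hs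
      simp [hs]
    simp [h1, ENNReal.zero_rpow_of_pos (by linarith : 0 < p)]
  set Z : ℂ → ℂ := fun z => 2 * cauchyInt (fun s => (f s : ℂ)) z with hZ
  have hZre : ∀ z : ℂ, 0 < z.im → 0 < (Z z).re := by
    intro z hz
    have := two_mul_re_cauchyInt hf (x := z.re) hz
    rw [Complex.re_add_im] at this
    rw [hZ]
    simp only [this]
    exact integral_poisson_pos hf h0 hne hz _
  have hZd : ∀ z : ℂ, 0 < z.im → HasDerivAt Z (2 * cauchyIntDeriv (fun s => (f s : ℂ)) z) z :=
    fun z hz => (hasDerivAt_cauchyInt hf hz).const_mul 2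
  have hZb : ∀ d > 0, ∀ z : ℂ, d ≤ z.im →
      ‖Z z‖ ≤ 2 * decayConst (fun s => (f s : ℂ)) d * (1 + |z.re|)⁻¹ := by
    intro d hd z hz
    have := norm_cauchyInt_le hf hd hz
    rw [hZ, norm_mul, Complex.norm_ofNat]
    linarith
  have hZb' : ∀ d > 0, ∀ z : ℂ, d ≤ z.im → ‖2 * cauchyIntDeriv (fun s => (f s : ℂ)) z‖ ≤
      2 * (decayConst (fun s => (f s : ℂ)) d * d⁻¹) * (1 + |z.re|)⁻¹ := by
    intro d hd z hz
    have := norm_cauchyIntDeriv_le hf hd hz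
    rw [norm_mul, Complex.norm_ofNat]
    linarith
  have hzero : ∫ x : ℝ, (Z (x + y * Complex.I)) ^ (p : ℂ) = 0 := by
    refine integral_horizontal_eq_zero (Φ := fun z => Z z ^ (p : ℂ))
      (Φ' := fun z => p * Z z ^ ((p : ℂ) - 1) * (2 * cauchyIntDeriv (fun s => (f s : ℂ)) z))
      hp ?_ ?_ ?_ hy
    · intro z hz
      exact (hZd z hz).cpow_const (Or.inl (hZre z hz))
    · intro d hd
      set B := 2 * decayConst (fun s => (f s : ℂ)) d with hB
      set B' := 2 * (decayConst (fun s => (f s : ℂ)) d * d⁻¹) with hB'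
      have hB0 : 0 ≤ B := mul_nonneg zero_le_two (decayConst_nonneg _ hd)
      have hB0' : 0 ≤ B' :=
        mul_nonneg zero_le_two (mul_nonneg (decayConst_nonneg _ hd) (inv_pos.2 hd).le)
      refine ⟨max (B ^ p) (p * B ^ (p - 1) * B'), fun z hz => ⟨?_, ?_⟩⟩
      · have hz' : Z z ≠ 0 := fun h => by
          have := hZre z (hd.trans_le hz); rw [h] at this; simp at this
        rw [Complex.norm_cpow_real]
        calc ‖Z z‖ ^ p ≤ (B * (1 + |z.re|)⁻¹) ^ p := by
              gcongr; exact hZb d hd z hz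
          _ = B ^ p * (1 + |z.re|) ^ (-p) := by
              rw [Real.mul_rpow hB0 (by positivity), Real.inv_rpow (by positivity),
                Real.rpow_neg (by positivity)]
          _ ≤ _ := by gcongr; exact le_max_left _ _
      · rw [norm_mul, norm_mul, show ((p : ℂ) - 1) = ((p - 1 : ℝ) : ℂ) by push_cast; rfl,
          Complex.norm_cpow_real, Complex.norm_real, Real.norm_of_nonneg (by linarith)]
        have hp1 : 0 ≤ p - 1 := by linarith
        calc p * ‖Z z‖ ^ (p - 1) * _
            ≤ p * (B * (1 + |z.re|)⁻¹) ^ (p - 1) * (B' * (1 + |z.re|)⁻¹) := by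
              gcongr
              · exact hZb d hd z hz
              · exact hZb' d hd z hz
          _ = p * B ^ (p - 1) * B' * (1 + |z.re|) ^ (-p) := by
              rw [Real.mul_rpow hB0 (by positivity), Real.inv_rpow (by positivity),
                ← Real.rpow_neg (by positivity)]
              have : (1 + |z.re|) ^ (-p) = (1 + |z.re|) ^ (-(p - 1)) * (1 + |z.re|)⁻¹ := by
                rw [← Real.rpow_neg_one, ← Real.rpow_add (by positivity)]; congr 1; ring
              rw [this]; ring
          _ ≤ _ := by gcongr; exact le_max_right _ _
    · intro x
      rw [tendsto_zero_iff_norm_tendsto_zero]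
      have h1 : Tendsto (fun Y : ℝ => (2 * ((∫ s, ‖(f s : ℂ)‖) / Y)) ^ p) atTop (𝓝 0) := by
        have h2 : Tendsto (fun Y : ℝ => 2 * ((∫ s, ‖(f s : ℂ)‖) / Y)) atTop (𝓝 0) := by
          simpa using (tendsto_const_nhds.div_atTop tendsto_id).const_mul (2 : ℝ)
        simpa [Real.zero_rpow hp0] using h2.rpow_const (p := p) (Or.inr (by linarith))
      refine squeeze_zero' (Eventually.of_forall fun _ => norm_nonneg _) ?_ h1
      filter_upwards [eventually_gt_atTop 0] with Y hY
      have hz : 0 < ((x : ℂ) + Y * Complex.I).im := by simpa using hY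
      rw [Complex.norm_cpow_real]
      gcongr
      rw [hZ, norm_mul, Complex.norm_ofNat]
      gcongr
      simpa using norm_cauchyInt_le_div hf hz
  have hline : ∀ x : ℝ, 0 < ((x : ℂ) + y * Complex.I).im := fun x => by simpa using hy
  have hZcont : Continuous fun x : ℝ => Z (x + y * Complex.I) := by
    refine continuous_iff_continuousAt.2 fun x => ?_
    exact ContinuousAt.comp (f := fun x : ℝ => (x : ℂ) + y * Complex.I)
      (hZd _ (hline x)).continuousAt (by fun_prop)
  have hdom : Integrable fun x : ℝ => (2 * decayConst (fun s => (f s : ℂ)) y) ^ p *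
      (1 + |x|) ^ (-p) := (integrable_one_add_abs_rpow hp).const_mul _
  have hnormb : ∀ x : ℝ, ‖Z (x + y * Complex.I)‖ ^ p ≤
      (2 * decayConst (fun s => (f s : ℂ)) y) ^ p * (1 + |x|) ^ (-p) := by
    intro x
    have h := hZb y hy (x + y * Complex.I) (by simp)
    have h2 : ((x : ℂ) + y * Complex.I).re = x := by simp
    rw [h2] at h
    have hB0 : 0 ≤ 2 * decayConst (fun s => (f s : ℂ)) y :=
      mul_nonneg zero_le_two (decayConst_nonneg _ hy)
    calc _ ≤ (2 * decayConst (fun s => (f s : ℂ)) y * (1 + |x|)⁻¹) ^ p := by gcongr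
      _ = _ := by
        rw [Real.mul_rpow hB0 (by positivity), Real.inv_rpow (by positivity),
          Real.rpow_neg (by positivity)]
  have i1 : Integrable fun x : ℝ => (Z (x + y * Complex.I)).re ^ p := by
    refine hdom.mono' ?_ (ae_of_all _ fun x => ?_)
    · exact ((Complex.continuous_re.comp hZcont).rpow_const
        fun x => Or.inr (by linarith)).aestronglyMeasurable
    · have := (hZre _ (hline x)).le
      rw [Real.norm_of_nonneg (by positivity)]
      refine le_trans ?_ (hnormb x)
      gcongr
      exact Complex.re_le_norm _
  have i2 : Integrable fun x : ℝ => (Z (x + y * Complex.I)) ^ (p : ℂ) := by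
    refine hdom.mono' ?_ (ae_of_all _ fun x => ?_)
    · refine Continuous.aestronglyMeasurable ?_
      refine hZcont.cpow continuous_const fun x => Or.inl (hZre _ (hline x))
    · rw [Complex.norm_cpow_real]
      exact hnormb x
  have i3 : Integrable fun x : ℝ => ‖Z (x + y * Complex.I)‖ ^ p := by
    refine hdom.mono' ?_ (ae_of_all _ fun x => ?_)
    · exact (hZcont.norm.rpow_const fun x => Or.inr (by linarith)).aestronglyMeasurable
    · rw [Real.norm_of_nonneg (by positivity)]; exact hnormb x
  have main : ∫ x : ℝ, ‖Z (x + y * Complex.I)‖ ^ p ≤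
      a * ∫ x : ℝ, (Z (x + y * Complex.I)).re ^ p := by
    have e : (∫ x : ℝ, ((Z (x + y * Complex.I)) ^ (p : ℂ)).re) = 0 := by
      have := integral_re i2
      simp only [RCLike.re_to_complex] at this
      rw [this, hzero]; simp
    calc _ ≤ ∫ x : ℝ, (a * (Z (x + y * Complex.I)).re ^ p -
          b * ((Z (x + y * Complex.I)) ^ (p : ℂ)).re) := by
          refine integral_mono i3 ((i1.const_mul a).sub (i2.re.const_mul b)) fun x => ?_
          exact norm_rpow_le_of_re_pos hab (hZre _ (hline x))
      _ = _ := by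
          have i2' : Integrable fun x : ℝ => ((Z (x + y * Complex.I)) ^ (p : ℂ)).re := i2.re
          rw [integral_sub (i1.const_mul a) (i2'.const_mul b), integral_const_mul,
            integral_const_mul, e]
          ring
  calc ∫⁻ x : ℝ, ‖cauchyInt (fun s => (f s : ℂ)) (x + y * Complex.I)‖ₑ ^ p
      ≤ ∫⁻ x : ℝ, ENNReal.ofReal (‖Z (x + y * Complex.I)‖ ^ p) := by
        refine lintegral_mono fun x => ?_
        rw [← ENNReal.ofReal_rpow_of_nonneg (norm_nonneg _) (by linarith), ofReal_norm]
        gcongr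
        rw [hZ, enorm_mul]
        refine le_mul_of_one_le_left (by positivity) ?_
        rw [← ofReal_norm, Complex.norm_ofNat]; simp
    _ = ENNReal.ofReal (∫ x : ℝ, ‖Z (x + y * Complex.I)‖ ^ p) :=
        (ofReal_integral_eq_lintegral_ofReal i3 (ae_of_all _ fun x => by positivity)).symm
    _ ≤ ENNReal.ofReal (a * ∫ x : ℝ, (Z (x + y * Complex.I)).re ^ p) :=
        ENNReal.ofReal_le_ofReal main
    _ = ENNReal.ofReal a * ∫⁻ x : ℝ, ENNReal.ofReal ((Z (x + y * Complex.I)).re ^ p) := by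
        rw [ENNReal.ofReal_mul ha, ofReal_integral_eq_lintegral_ofReal i1
          (ae_of_all _ fun x => Real.rpow_nonneg (hZre _ (hline x)).le _)]
    _ ≤ _ := by
        refine mul_le_mul_right ?_ (ENNReal.ofReal a)
        have hfm : AEMeasurable fun s => ‖f s‖ₑ := by
          have h := hf.aesm.enorm
          have e : (fun s => ‖(f s : ℂ)‖ₑ) = fun s => ‖f s‖ₑ := by
            funext s
            rw [← ofReal_norm, ← ofReal_norm, Complex.norm_real]
          rwa [e] at h
        refine le_trans (lintegral_mono fun x => ?_)
          (lintegral_poisson_rpow_le hp hfm hy)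
        rw [← ENNReal.ofReal_rpow_of_nonneg (hZre _ (hline x)).le (by linarith)]
        gcongr
        rw [hZ]
        simp only
        rw [two_mul_re_cauchyInt hf hy]
        have hnn : ∀ s, 0 ≤ poissonKer y (x - s) * f s :=
          fun s => mul_nonneg (poissonKer_pos hy _).le (h0 s)
        refine (ENNReal.ofReal_le_ofReal (le_abs_self _)).trans ?_
        rw [← Real.norm_eq_abs, ofReal_norm]
        refine (enorm_integral_le_lintegral_enorm _).trans (le_of_eq ?_)
        refine lintegral_congr fun s => ?_
        rw [enorm_mul]
        congr 1
        rw [← ofReal_norm, Real.norm_of_nonneg (poissonKer_pos hy _).le]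

/-! ### Duality in `L^p` and density of Schwartz functions. -/

theorem eLpNorm_ofReal_exponent {E : Type*} [NormedAddCommGroup E] {p : ℝ} (hp : 0 < p) (f : ℝ → E)
    (μ : Measure ℝ) : eLpNorm f (ENNReal.ofReal p) μ = (∫⁻ x, ‖f x‖ₑ ^ p ∂μ) ^ (1 / p) := by
  rw [eLpNorm_eq_lintegral_rpow_enorm_toReal (by simpa using hp) ENNReal.ofReal_ne_top,
    ENNReal.toReal_ofReal hp.le]

theorem enorm_integral_mul_le {p q : ℝ} (hpq : p.HolderConjugate q) {f g : ℝ → ℂ}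
    (hf : AEStronglyMeasurable f volume) (hg : AEStronglyMeasurable g volume) :
    ‖∫ x, f x * g x‖ₑ ≤
      eLpNorm f (ENNReal.ofReal p) volume * eLpNorm g (ENNReal.ofReal q) volume := by
  refine (enorm_integral_le_lintegral_enorm _).trans ?_
  rw [eLpNorm_ofReal_exponent hpq.pos, eLpNorm_ofReal_exponent hpq.symm.pos]
  refine le_trans (le_of_eq ?_) (ENNReal.lintegral_mul_le_Lp_mul_Lq volume hpq hf.enorm hg.enorm)
  exact lintegral_congr fun x => by rw [enorm_mul]; rfl

theorem exists_seq_schwartz_tendsto {q : ℝ} (hq : 1 < q) {w : ℝ → ℂ}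
    (hw : MemLp w (ENNReal.ofReal q) volume) : ∃ ψ : ℕ → 𝓢(ℝ, ℂ),
    Tendsto (fun n => eLpNorm (fun x => ψ n x - w x) (ENNReal.ofReal q) volume) atTop (𝓝 0) := by
  have h1 : (1 : ℝ≥0∞) ≤ ENNReal.ofReal q := by simpa using hq.le
  have : ∀ n : ℕ, ∃ ψ : 𝓢(ℝ, ℂ), eLpNorm (fun x => ψ x - w x) (ENNReal.ofReal q) volume ≤
      ENNReal.ofReal (1 / ((n : ℝ) + 1)) := by
    intro n
    obtain ⟨g, hg1, hg2, hg3⟩ := hw.exist_eLpNorm_sub_le ENNReal.ofReal_ne_top h1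
      (by positivity : (0 : ℝ) < 1 / ((n : ℝ) + 1))
    refine ⟨hg1.toSchwartzMap hg2, ?_⟩
    rw [← eLpNorm_neg] at hg3
    refine le_trans (le_of_eq (congrArg (fun u => eLpNorm u _ _) ?_)) hg3
    funext x
    simp
  choose ψ hψ using this
  refine ⟨ψ, tendsto_of_tendsto_of_tendsto_of_le_of_le tendsto_const_nhds ?_
    (fun _ => zero_le) hψ⟩
  have := ENNReal.tendsto_ofReal (tendsto_one_div_add_atTop_nhds_zero_nat (𝕜 := ℝ))
  simpa using this

theorem tendsto_integral_mul {p q : ℝ} (hpq : p.HolderConjugate q) {h w : ℝ → ℂ}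
    (hh : MemLp h (ENNReal.ofReal p) volume) (hw : MemLp w (ENNReal.ofReal q) volume)
    {u : ℕ → ℝ → ℂ} (hu : ∀ n, MemLp (u n) (ENNReal.ofReal q) volume)
    (hlim : Tendsto (fun n => eLpNorm (fun x => u n x - w x) (ENNReal.ofReal q) volume)
      atTop (𝓝 0)) :
    Tendsto (fun n => ∫ x, h x * u n x) atTop (𝓝 (∫ x, h x * w x)) := by
  have inst : ENNReal.HolderConjugate (ENNReal.ofReal p) (ENNReal.ofReal q) := hpq.ennrealOfReal
  rw [tendsto_iff_edist_tendsto_0]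
  refine tendsto_of_tendsto_of_tendsto_of_le_of_le tendsto_const_nhds
    (h := fun n => eLpNorm h (ENNReal.ofReal p) volume *
      eLpNorm (fun x => u n x - w x) (ENNReal.ofReal q) volume) ?_ (fun _ => zero_le) ?_
  · simpa using ENNReal.Tendsto.const_mul hlim (Or.inr hh.2.ne)
  · intro n
    simp only
    have i1 : Integrable fun x => h x * u n x := hh.integrable_mul (hu n)
    have i2 : Integrable fun x => h x * w x := hh.integrable_mul hw
    rw [edist_eq_enorm_sub, ← integral_sub i1 i2]
    simp_rw [← mul_sub]
    exact enorm_integral_mul_le hpq hh.1 ((hu n).1.sub hw.1)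

/-- The `L^p` norm is at most `B` if the pairings with Schwartz functions are. -/
theorem eLpNorm_le_of_forall_schwartz {p q : ℝ} (hpq : p.HolderConjugate q) {h : ℝ → ℂ}
    (hh : MemLp h (ENNReal.ofReal p) volume) {B : ℝ≥0∞}
    (hB : ∀ ψ : 𝓢(ℝ, ℂ), ‖∫ x, h x * ψ x‖ₑ ≤ B * eLpNorm ψ (ENNReal.ofReal q) volume) :
    eLpNorm h (ENNReal.ofReal p) volume ≤ B := by
  have hp := hpq.lt
  have hq := hpq.symm.lt
  rcases eq_or_ne B ⊤ with rfl | hBtop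
  · exact le_top
  -- The extremal function: `h * w` and the `q`-th power of |w| both equal |h|^p. By density the
  -- hypothesis extends to `w`, and dividing by the norm of `w` leaves the norm of `h`.
  set w : ℝ → ℂ := fun x => ((‖h x‖ ^ (p - 2) : ℝ) : ℂ) * (starRingEnd ℂ) (h x) with hw
  have hw1 : ∀ x, ‖w x‖ₑ ^ q = ‖h x‖ₑ ^ p := by
    intro x
    have e : ‖w x‖ ^ q = ‖h x‖ ^ p := by
      rw [hw, norm_mul, Complex.norm_real, RCLike.norm_conj,
        Real.norm_of_nonneg (by positivity)]
      rcases eq_or_ne ‖h x‖ 0 with h0 | h0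
      · rw [h0, mul_zero, Real.zero_rpow (by linarith), Real.zero_rpow (by linarith)]
      · rw [← Real.rpow_add_one h0, ← Real.rpow_mul (norm_nonneg _)]
        congr 1
        have := hpq.sub_one_mul_conj
        rw [show p - 2 + 1 = p - 1 by ring]; exact this
    rw [← ofReal_norm, ← ofReal_norm, ENNReal.ofReal_rpow_of_nonneg (norm_nonneg _) (by linarith),
      ENNReal.ofReal_rpow_of_nonneg (norm_nonneg _) (by linarith), e]
  have hw2 : ∀ x, h x * w x = ((‖h x‖ ^ p : ℝ) : ℂ) := by
    intro x
    rw [hw]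
    simp only
    rw [mul_left_comm, Complex.mul_conj, Complex.normSq_eq_norm_sq, ← Complex.ofReal_mul]
    congr 1
    rcases eq_or_ne ‖h x‖ 0 with h0 | h0
    · rw [h0, Real.zero_rpow (by linarith : p ≠ 0)]; simp
    · rw [← Real.rpow_natCast, ← Real.rpow_add (by positivity)]
      congr 1; push_cast; ring
  have hwm : AEStronglyMeasurable w volume := by
    refine AEStronglyMeasurable.mul ?_ (Complex.continuous_conj.comp_aestronglyMeasurable hh.1)
    exact (Complex.measurable_ofReal.comp_aemeasurable
      (hh.1.norm.aemeasurable.pow_const _)).aestronglyMeasurable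
  have hwn : eLpNorm w (ENNReal.ofReal q) volume = (∫⁻ x, ‖h x‖ₑ ^ p) ^ (1 / q) := by
    rw [eLpNorm_ofReal_exponent (by linarith)]
    simp_rw [hw1]
  have hhn := eLpNorm_ofReal_exponent (by linarith : 0 < p) h volume
  have hIfin : ∫⁻ x, ‖h x‖ₑ ^ p ≠ ⊤ := by
    intro h1
    have := hh.2.ne
    rw [hhn, h1, ENNReal.top_rpow_of_pos (by positivity)] at this
    exact this rfl
  have hwL : MemLp w (ENNReal.ofReal q) volume := by
    refine ⟨hwm, ?_⟩
    rw [hwn]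
    exact ENNReal.rpow_lt_top_of_nonneg (by positivity) hIfin
  obtain ⟨ψ, hψ⟩ := exists_seq_schwartz_tendsto hq hwL
  have hlim := tendsto_integral_mul hpq hh hwL (fun n => (ψ n).memLp _ volume) hψ
  have hq1 : (1 : ℝ≥0∞) ≤ ENNReal.ofReal q := by simpa using hq.le
  have hbound : ‖∫ x, h x * w x‖ₑ ≤ B * eLpNorm w (ENNReal.ofReal q) volume := by
    refine le_of_tendsto_of_tendsto (continuous_enorm.continuousAt.tendsto.comp hlim)
      (g := fun n => B * (eLpNorm (fun x => ψ n x - w x) (ENNReal.ofReal q) volume +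
        eLpNorm w (ENNReal.ofReal q) volume)) ?_ (Eventually.of_forall fun n => ?_)
    · have := ENNReal.Tendsto.const_mul (hψ.add_const (eLpNorm w (ENNReal.ofReal q) volume))
        (Or.inr hBtop) (a := B)
      simpa using this
    · refine (hB (ψ n)).trans (mul_le_mul_right ?_ B)
      refine le_trans (le_of_eq (congrArg (fun u => eLpNorm u _ _) ?_))
        (eLpNorm_add_le (f := fun x => ψ n x - w x) (g := w)
          ((ψ n).continuous.aestronglyMeasurable.sub hwm) hwm hq1)
      funext x; simp
  have hI : ‖∫ x, h x * w x‖ₑ = ∫⁻ x, ‖h x‖ₑ ^ p := by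
    simp_rw [hw2]
    rw [integral_complex_ofReal, ← ofReal_norm, Complex.norm_real,
      Real.norm_of_nonneg (integral_nonneg fun x => by positivity),
      integral_eq_lintegral_of_nonneg_ae (ae_of_all _ fun x => by positivity)
        (hh.1.norm.aemeasurable.pow_const _).aestronglyMeasurable]
    have e : ∀ x, ENNReal.ofReal (‖h x‖ ^ p) = ‖h x‖ₑ ^ p := fun x => by
      rw [← ENNReal.ofReal_rpow_of_nonneg (norm_nonneg _) (by linarith), ofReal_norm]
    simp_rw [e]
    exact ENNReal.ofReal_toReal hIfin
  rw [hI, hwn] at hbound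
  rw [hhn]
  set J := ∫⁻ x, ‖h x‖ₑ ^ p
  rcases eq_or_ne J 0 with h0 | h0
  · rw [h0, ENNReal.zero_rpow_of_pos (by positivity)]; exact zero_le
  have e1 : J = J ^ (1 / p) * J ^ (1 / q) := by
    rw [← ENNReal.rpow_add _ _ h0 hIfin, one_div, one_div, hpq.inv_add_inv_eq_one,
      ENNReal.rpow_one]
  have hbound' : J ^ (1 / p) * J ^ (1 / q) ≤ B * J ^ (1 / q) := by rwa [← e1]
  refine (ENNReal.mul_le_mul_iff_left ?_ ?_).1 hbound'
  · exact (ENNReal.rpow_pos (pos_iff_ne_zero.2 h0) hIfin).ne'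
  · exact ENNReal.rpow_ne_top_of_nonneg (by positivity) hIfin

/-! ### The Cauchy integral on lines: complex functions and all exponents. -/

theorem FastDecay.add {f g : ℝ → ℂ} (hf : FastDecay f) (hg : FastDecay g) :
    FastDecay (f + g) := by
  refine ⟨hf.aesm.add hg.aesm, (hf.integrable.add hg.integrable).mono' ?_ ?_⟩
  · exact (by fun_prop : Continuous fun s : ℝ => 1 + |s|).aestronglyMeasurable.mul
      (hf.aesm.add hg.aesm).norm
  · refine ae_of_all _ fun s => ?_
    rw [Real.norm_of_nonneg (by positivity)]
    simp only [Pi.add_apply]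
    rw [← mul_add]
    gcongr
    exact norm_add_le _ _

theorem cauchyInt_add {f g : ℝ → ℂ} (hf : FastDecay f) (hg : FastDecay g) {z : ℂ}
    (hz : 0 < z.im) : cauchyInt (f + g) z = cauchyInt f z + cauchyInt g z := by
  have h1 : Integrable fun s : ℝ => f s / ((s : ℂ) - z) := by
    simpa using hf.integrable_div_pow hz 1
  have h2 : Integrable fun s : ℝ => g s / ((s : ℂ) - z) := by
    simpa using hg.integrable_div_pow hz 1
  rw [cauchyInt, cauchyInt, cauchyInt, ← mul_add, ← integral_add h1 h2]
  simp only [Pi.add_apply, add_div]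

theorem cauchyInt_const_mul (c : ℂ) (f : ℝ → ℂ) (z : ℂ) :
    cauchyInt (fun s => c * f s) z = c * cauchyInt f z := by
  simp_rw [cauchyInt, mul_div_assoc]
  rw [integral_const_mul, mul_left_comm]

theorem continuous_cauchyInt_line {f : ℝ → ℂ} (hf : FastDecay f) {y : ℝ} (hy : 0 < y) :
    Continuous fun x : ℝ => cauchyInt f (x + y * Complex.I) := by
  refine continuous_iff_continuousAt.2 fun x => ?_
  exact (hasDerivAt_horizontal (hasDerivAt_cauchyInt hf (by simpa using hy))).continuousAt

/-- The `L^p` bound on horizontal lines for `1 < p ≤ 2`. -/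
theorem eLpNorm_cauchyInt_le_of_le_two {p : ℝ} (hp : 1 < p) (hp2 : p ≤ 2) :
    ∃ C : ℝ≥0, ∀ f : ℝ → ℂ, FastDecay f → ∀ y : ℝ, 0 < y →
      eLpNorm (fun x : ℝ => cauchyInt f (x + y * Complex.I)) (ENNReal.ofReal p) volume ≤
        C * eLpNorm f (ENNReal.ofReal p) volume := by
  obtain ⟨C, hC⟩ := lintegral_cauchyInt_rpow_le_of_nonneg hp hp2
  have hp0 : 0 < p := by linarith
  have hp1 : (1 : ℝ≥0∞) ≤ ENNReal.ofReal p := by simpa using hp.le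
  refine ⟨4 * C ^ (1 / p), fun f hf y hy => ?_⟩
  -- `f` is a sum of four nonnegative functions multiplied by 1, -1, i and -i; each is dominated by
  -- |f|, whence the factor 4.
  have key : ∀ (c : ℂ) (g : ℝ → ℝ), ‖c‖ = 1 → AEStronglyMeasurable g volume → (∀ s, 0 ≤ g s) →
      (∀ s, g s ≤ ‖f s‖) → FastDecay (fun s => c * (g s : ℂ)) ∧
      eLpNorm (fun x : ℝ => cauchyInt (fun s => c * (g s : ℂ)) (x + y * Complex.I))
        (ENNReal.ofReal p) volume ≤ C ^ (1 / p) * eLpNorm f (ENNReal.ofReal p) volume := by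
    intro c g hc hgm hg0 hgf
    have hgm' : AEStronglyMeasurable (fun s => (g s : ℂ)) volume :=
      Complex.continuous_ofReal.comp_aestronglyMeasurable hgm
    have hgn : ∀ s, ‖(g s : ℂ)‖ ≤ ‖f s‖ := fun s => by
      rw [Complex.norm_real, Real.norm_of_nonneg (hg0 s)]; exact hgf s
    refine ⟨hf.mono (hgm'.const_mul c) fun s => by rw [norm_mul, hc, one_mul]; exact hgn s, ?_⟩
    simp_rw [cauchyInt_const_mul]
    have e1 : eLpNorm (fun x : ℝ => c * cauchyInt (fun s => (g s : ℂ)) (x + y * Complex.I))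
        (ENNReal.ofReal p) volume =
        eLpNorm (fun x : ℝ => cauchyInt (fun s => (g s : ℂ)) (x + y * Complex.I))
        (ENNReal.ofReal p) volume :=
      eLpNorm_congr_norm_ae (ae_of_all _ fun x => by rw [norm_mul, hc, one_mul])
    rw [e1, eLpNorm_ofReal_exponent hp0]
    calc _ ≤ (C * ∫⁻ s, ‖g s‖ₑ ^ p) ^ (1 / p) := by
          gcongr
          exact hC g (hf.mono hgm' hgn) hg0 y hy
      _ = C ^ (1 / p) * (∫⁻ s, ‖g s‖ₑ ^ p) ^ (1 / p) :=
          ENNReal.mul_rpow_of_nonneg _ _ (by positivity)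
      _ ≤ _ := by
          rw [← eLpNorm_ofReal_exponent hp0]
          gcongr
          refine eLpNorm_mono fun s => ?_
          rw [Real.norm_of_nonneg (hg0 s)]; exact hgf s
  have hre : AEStronglyMeasurable (fun s => (f s).re) volume :=
    Complex.continuous_re.comp_aestronglyMeasurable hf.aesm
  have him : AEStronglyMeasurable (fun s => (f s).im) volume :=
    Complex.continuous_im.comp_aestronglyMeasurable hf.aesm
  have hr := fun s => abs_le.1 (Complex.abs_re_le_norm (f s))
  have hi := fun s => abs_le.1 (Complex.abs_im_le_norm (f s))
  obtain ⟨d1, b1⟩ := key 1 (fun s => max (f s).re 0) (by simp)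
    (hre.sup aestronglyMeasurable_const) (fun s => le_max_right _ _)
    (fun s => max_le (hr s).2 (norm_nonneg _))
  obtain ⟨d2, b2⟩ := key (-1) (fun s => max (-(f s).re) 0) (by simp)
    (hre.neg.sup aestronglyMeasurable_const) (fun s => le_max_right _ _)
    (fun s => max_le (by linarith [(hr s).1]) (norm_nonneg _))
  obtain ⟨d3, b3⟩ := key Complex.I (fun s => max (f s).im 0) (by simp)
    (him.sup aestronglyMeasurable_const) (fun s => le_max_right _ _)
    (fun s => max_le (hi s).2 (norm_nonneg _))
  obtain ⟨d4, b4⟩ := key (-Complex.I) (fun s => max (-(f s).im) 0) (by simp)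
    (him.neg.sup aestronglyMeasurable_const) (fun s => le_max_right _ _)
    (fun s => max_le (by linarith [(hi s).1]) (norm_nonneg _))
  set f1 : ℝ → ℂ := fun s => 1 * ((max (f s).re 0 : ℝ) : ℂ)
  set f2 : ℝ → ℂ := fun s => -1 * ((max (-(f s).re) 0 : ℝ) : ℂ)
  set f3 : ℝ → ℂ := fun s => Complex.I * ((max (f s).im 0 : ℝ) : ℂ)
  set f4 : ℝ → ℂ := fun s => -Complex.I * ((max (-(f s).im) 0 : ℝ) : ℂ)
  have hpm : ∀ r : ℝ, max r 0 - max (-r) 0 = r := fun r => by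
    rcases le_total r 0 with h | h
    · rw [max_eq_right h, max_eq_left (by linarith)]; ring
    · rw [max_eq_left h, max_eq_right (by linarith)]; ring
  have hsum : f = (f1 + f2) + (f3 + f4) := by
    funext s
    simp only [f1, f2, f3, f4, Pi.add_apply]
    conv_lhs => rw [← Complex.re_add_im (f s), ← hpm (f s).re, ← hpm (f s).im]
    push_cast
    ring
  have hline : ∀ x : ℝ, 0 < ((x : ℂ) + y * Complex.I).im := fun x => by simpa using hy
  have hsum2 : (fun x : ℝ => cauchyInt f (x + y * Complex.I)) =
      ((fun x : ℝ => cauchyInt f1 (x + y * Complex.I)) +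
        fun x : ℝ => cauchyInt f2 (x + y * Complex.I)) +
      ((fun x : ℝ => cauchyInt f3 (x + y * Complex.I)) +
        fun x : ℝ => cauchyInt f4 (x + y * Complex.I)) := by
    funext x
    simp only [Pi.add_apply]
    rw [hsum, cauchyInt_add (d1.add d2) (d3.add d4) (hline x), cauchyInt_add d1 d2 (hline x),
      cauchyInt_add d3 d4 (hline x)]
  rw [hsum2]
  have m1 := (continuous_cauchyInt_line d1 hy).aestronglyMeasurable (μ := volume)
  have m2 := (continuous_cauchyInt_line d2 hy).aestronglyMeasurable (μ := volume)
  have m3 := (continuous_cauchyInt_line d3 hy).aestronglyMeasurable (μ := volume)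
  have m4 := (continuous_cauchyInt_line d4 hy).aestronglyMeasurable (μ := volume)
  refine (eLpNorm_add_le (m1.add m2) (m3.add m4) hp1).trans ?_
  refine (add_le_add (eLpNorm_add_le m1 m2 hp1) (eLpNorm_add_le m3 m4 hp1)).trans ?_
  refine (add_le_add (add_le_add b1 b2) (add_le_add b3 b4)).trans (le_of_eq ?_)
  rw [ENNReal.coe_mul, ENNReal.coe_rpow_of_nonneg _ (by positivity : 0 ≤ 1 / p)]
  push_cast
  ring

theorem memLp_cauchyInt_line {p : ℝ} (hp : 1 < p) {f : ℝ → ℂ} (hf : FastDecay f) {y : ℝ}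
    (hy : 0 < y) :
    MemLp (fun x : ℝ => cauchyInt f (x + y * Complex.I)) (ENNReal.ofReal p) volume := by
  have hm := (continuous_cauchyInt_line hf hy).aestronglyMeasurable (μ := volume)
  have h1 : MemLp (fun x : ℝ => decayConst f y * (1 + |x|)⁻¹) (ENNReal.ofReal p) volume := by
    refine MemLp.const_mul ?_ _
    have hc : Continuous fun x : ℝ => (1 + |x|)⁻¹ :=
      (by fun_prop : Continuous fun x : ℝ => 1 + |x|).inv₀ fun x => by positivity
    refine (integrable_norm_rpow_iff hc.aestronglyMeasurable (by simpa using by linarith)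
      ENNReal.ofReal_ne_top).1 ?_
    rw [ENNReal.toReal_ofReal (by linarith)]
    refine (integrable_one_add_abs_rpow hp).congr (ae_of_all _ fun x => ?_)
    simp only
    rw [Real.norm_of_nonneg (by positivity), Real.inv_rpow (by positivity),
      Real.rpow_neg (by positivity)]
  refine h1.mono hm (ae_of_all _ fun x => ?_)
  rw [Real.norm_of_nonneg (mul_nonneg (decayConst_nonneg _ hy) (by positivity))]
  simpa using norm_cauchyInt_le hf hy (z := x + y * Complex.I) (by simp)

theorem fastDecay_schwartz (ψ : 𝓢(ℝ, ℂ)) : FastDecay ψ := by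
  refine ⟨ψ.continuous.aestronglyMeasurable, ?_⟩
  have h1 := ψ.integrable_pow_mul volume 1
  have h2 := (ψ.integrable (μ := volume)).norm
  refine (h2.add h1).congr (ae_of_all _ fun s => ?_)
  simp only [Pi.add_apply, pow_one, Real.norm_eq_abs]
  ring

/-- The reflection `x ↦ -x` of a Schwartz function. -/
noncomputable def schwartzNeg (ψ : 𝓢(ℝ, ℂ)) : 𝓢(ℝ, ℂ) :=
  SchwartzMap.compCLMOfContinuousLinearEquiv ℝ (ContinuousLinearEquiv.neg ℝ) ψ

theorem schwartzNeg_apply (ψ : 𝓢(ℝ, ℂ)) (x : ℝ) : schwartzNeg ψ x = ψ (-x) := rfl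

theorem eLpNorm_comp_neg {f : ℝ → ℂ} (hf : AEStronglyMeasurable f volume) (p : ℝ≥0∞) :
    eLpNorm (fun x => f (-x)) p volume = eLpNorm f p volume :=
  eLpNorm_comp_measurePreserving hf (Measure.measurePreserving_neg volume)

/-- Transposition of the Cauchy integral on a horizontal line. -/
theorem integral_cauchyInt_mul {f : ℝ → ℂ} (hf : FastDecay f) (ψ : 𝓢(ℝ, ℂ)) {y : ℝ} (hy : 0 < y) :
    ∫ x : ℝ, cauchyInt f (x + y * Complex.I) * ψ x =
      ∫ s : ℝ, f s * cauchyInt (schwartzNeg ψ) ((-s : ℝ) + y * Complex.I) := by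
  have hψ := fastDecay_schwartz ψ
  have hne : ∀ x s : ℝ, y ≤ ‖(s : ℂ) - (x + y * Complex.I)‖ := fun x s => by
    simpa using im_le_norm_sub s (x + y * Complex.I)
  have hprod : Integrable (fun q : ℝ × ℝ => ψ q.1 * f q.2 *
      ((q.2 : ℂ) - (q.1 + y * Complex.I))⁻¹) (volume.prod volume) := by
    refine (hψ.integrable_self.mul_prod hf.integrable_self).mul_bdd (c := y⁻¹) ?_ ?_
    · exact Measurable.aestronglyMeasurable (by fun_prop)
    · refine ae_of_all _ fun q => ?_
      rw [norm_inv]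
      exact inv_anti₀ hy (hne _ _)
  have h1 : ∀ x : ℝ, cauchyInt f (x + y * Complex.I) * ψ x = (2 * Real.pi * Complex.I)⁻¹ *
      ∫ s : ℝ, ψ x * f s * ((s : ℂ) - (x + y * Complex.I))⁻¹ := by
    intro x
    rw [cauchyInt, mul_assoc, ← integral_mul_const]
    congr 2
    funext s
    rw [div_eq_mul_inv]; ring
  have h2 : ∀ s : ℝ, f s * cauchyInt (schwartzNeg ψ) ((-s : ℝ) + y * Complex.I) =
      (2 * Real.pi * Complex.I)⁻¹ * ∫ x : ℝ, ψ x * f s * ((s : ℂ) - (x + y * Complex.I))⁻¹ := by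
    intro s
    rw [cauchyInt, mul_left_comm, ← integral_const_mul, ← integral_neg_eq_self]
    congr 2
    funext x
    rw [schwartzNeg_apply, div_eq_mul_inv, neg_neg]
    have : (((-x : ℝ) : ℂ) - ((-s : ℝ) + y * Complex.I)) = (s : ℂ) - (x + y * Complex.I) := by
      push_cast; ring
    rw [this]; ring
  simp_rw [h1, h2]
  rw [integral_const_mul, integral_const_mul]
  congr 1
  exact integral_integral_swap (f := fun x s : ℝ =>
    ψ x * f s * ((s : ℂ) - (x + y * Complex.I))⁻¹) hprod

/-- The `L^p` bound on horizontal lines. -/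
theorem eLpNorm_cauchyInt_le {p : ℝ} (hp : 1 < p) :
    ∃ C : ℝ≥0, ∀ f : ℝ → ℂ, FastDecay f → ∀ y : ℝ, 0 < y →
      eLpNorm (fun x : ℝ => cauchyInt f (x + y * Complex.I)) (ENNReal.ofReal p) volume ≤
        C * eLpNorm f (ENNReal.ofReal p) volume := by
  rcases le_total p 2 with hp2 | hp2
  · exact eLpNorm_cauchyInt_le_of_le_two hp hp2
  -- On a horizontal line the Cauchy integral is its own transpose up to x ↦ -x, so the exponent `p
  -- ≥ 2` reduces to its conjugate `q ≤ 2`.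
  have hpq := Real.HolderConjugate.conjExponent hp
  set q := p.conjExponent
  have hq2 : q ≤ 2 := by
    have := hpq.sub_one_mul_conj
    nlinarith [hpq.symm.pos]
  obtain ⟨C, hC⟩ := eLpNorm_cauchyInt_le_of_le_two hpq.symm.lt hq2
  refine ⟨C, fun f hf y hy => ?_⟩
  refine eLpNorm_le_of_forall_schwartz hpq (memLp_cauchyInt_line hp hf hy) fun ψ => ?_
  rw [integral_cauchyInt_mul hf ψ hy]
  have hK := continuous_cauchyInt_line (fastDecay_schwartz (schwartzNeg ψ)) hy
  refine (enorm_integral_mul_le hpq hf.aesm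
    (hK.comp continuous_neg).aestronglyMeasurable).trans ?_
  calc _ ≤ eLpNorm f (ENNReal.ofReal p) volume *
        (C * eLpNorm (schwartzNeg ψ) (ENNReal.ofReal q) volume) := by
        gcongr
        refine le_trans (le_of_eq ?_) (hC _ (fastDecay_schwartz (schwartzNeg ψ)) y hy)
        exact eLpNorm_comp_neg hK.aestronglyMeasurable _
    _ = _ := by
        rw [show (schwartzNeg ψ : ℝ → ℂ) = fun x => ψ (-x) from rfl,
          eLpNorm_comp_neg ψ.continuous.aestronglyMeasurable]
        ring

/-! ### The multipliers `C_+` and `C_-`: boundary values, boundedness and transposition. -/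

theorem fourierInv_real_eq (f : ℝ → ℂ) (w : ℝ) :
    𝓕⁻ f w = ∫ v : ℝ, Complex.exp (2 * Real.pi * Complex.I * w * v) * f v := by
  rw [Real.fourierInv_eq']
  refine integral_congr_ae (ae_of_all _ fun v => ?_)
  simp only [smul_eq_mul]
  congr 2
  simp
  ring

theorem fourier_real_eq' (f : ℝ → ℂ) (w : ℝ) :
    𝓕 f w = ∫ v : ℝ, Complex.exp (-(2 * Real.pi * Complex.I * w * v)) * f v := by
  have := fourierInv_real_eq f (-w)
  rw [Real.fourierInv_eq_fourier_neg, neg_neg] at this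
  rw [this]
  refine integral_congr_ae (ae_of_all _ fun v => ?_)
  simp only
  congr 2
  push_cast
  ring

theorem integral_fourierInv_mul {f g : ℝ → ℂ} (hf : Integrable f) (hg : Integrable g) :
    ∫ x, 𝓕⁻ f x * g x = ∫ x, f x * 𝓕⁻ g x := by
  have h1 := VectorFourier.integral_fourierIntegral_smul_eq_flip (L := innerₗ ℝ)
    (μ := volume) (ν := volume) (f := f) (g := fun x => g (-x)) Real.continuous_fourierChar
    continuous_inner hf hg.comp_neg
  have h2 : ∫ x, 𝓕⁻ f x * g x = ∫ x, 𝓕 f x * g (-x) := by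
    rw [← integral_neg_eq_self]
    simp only [Real.fourierInv_eq_fourier_neg, neg_neg]
  have h3 : ∀ x, 𝓕⁻ g x = 𝓕 (fun x => g (-x)) x := fun x => by
    rw [Real.fourierInv_eq_fourier_comp_neg]
  rw [h2]
  simp_rw [h3]
  simpa [flip_innerₗ] using! h1

/-- The Fourier multiplier with symbol `1_{ξ > 0}` on Schwartz functions. -/
noncomputable def cauchyPlus (ψ : 𝓢(ℝ, ℂ)) : ℝ → ℂ :=
  𝓕⁻ ((Ioi (0 : ℝ)).indicator (𝓕 (ψ : ℝ → ℂ)))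

theorem integrable_fourier_schwartz (ψ : 𝓢(ℝ, ℂ)) : Integrable (𝓕 (ψ : ℝ → ℂ)) := by
  rw [← SchwartzMap.fourier_coe]
  exact SchwartzMap.integrable _

theorem continuous_fourier_schwartz (ψ : 𝓢(ℝ, ℂ)) : Continuous (𝓕 (ψ : ℝ → ℂ)) := by
  rw [← SchwartzMap.fourier_coe]
  exact SchwartzMap.continuous _

theorem cauchyPlus_eq (ψ : 𝓢(ℝ, ℂ)) (x : ℝ) : cauchyPlus ψ x =
    ∫ ξ in Ioi (0 : ℝ), Complex.exp (2 * Real.pi * Complex.I * x * ξ) * 𝓕 (ψ : ℝ → ℂ) ξ := by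
  rw [cauchyPlus, fourierInv_real_eq, ← integral_indicator measurableSet_Ioi]
  refine integral_congr_ae (ae_of_all _ fun ξ => ?_)
  by_cases h : ξ ∈ Ioi (0 : ℝ)
  · simp only [indicator_of_mem h]
  · simp only [indicator_of_notMem h, mul_zero]

/-- The Cauchy kernel is the integral over ξ > 0 of e^{2πi(z - s)ξ}, convergent since Im z > 0;
Fubini's theorem exchanges the integrations. Letting z tend to the real line identifies the boundary
values as `cauchyPlus ψ`. -/
theorem cauchyInt_eq_fourier (ψ : 𝓢(ℝ, ℂ)) {z : ℂ} (hz : 0 < z.im) : cauchyInt ψ z =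
    ∫ ξ in Ioi (0 : ℝ), Complex.exp (2 * Real.pi * Complex.I * z * ξ) * 𝓕 (ψ : ℝ → ℂ) ξ := by
  have hpi := Real.pi_pos
  have hprod : Integrable (fun q : ℝ × ℝ => ψ q.1 * Complex.exp (2 * Real.pi * Complex.I *
      (z - q.1) * q.2)) (volume.prod (volume.restrict (Ioi 0))) := by
    have h1 : Integrable (fun ξ : ℝ => (Real.exp (-(2 * Real.pi * z.im) * ξ)))
        (volume.restrict (Ioi 0)) := integrableOn_exp_mul_Ioi (by nlinarith) 0
    refine ((ψ.integrable (μ := volume)).norm.mul_prod h1).mono' ?_ (ae_of_all _ fun q => ?_)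
    · have : Continuous fun q : ℝ × ℝ => ψ q.1 * Complex.exp (2 * Real.pi * Complex.I *
        (z - q.1) * q.2) := by
        have := ψ.continuous
        fun_prop
      exact this.aestronglyMeasurable
    · rw [norm_mul, Complex.norm_exp]
      refine le_of_eq ?_
      congr 2
      simp
  have hin : ∀ s : ℝ, ∫ ξ in Ioi (0 : ℝ), ψ s * Complex.exp (2 * Real.pi * Complex.I *
      (z - s) * ξ) = (2 * Real.pi * Complex.I)⁻¹ * (ψ s / ((s : ℂ) - z)) := by
    intro s
    rw [integral_const_mul, integral_exp_mul_complex_Ioi]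
    · have h1 : (s : ℂ) - z ≠ 0 := norm_pos_iff.1 (hz.trans_le (im_le_norm_sub s z))
      have h2 : z - (s : ℂ) ≠ 0 := by rw [← neg_sub]; exact neg_ne_zero.2 h1
      have h3 : (Real.pi : ℂ) ≠ 0 := by exact_mod_cast hpi.ne'
      simp only [Complex.ofReal_zero, mul_zero, Complex.exp_zero]
      rw [← neg_sub (s : ℂ) z]
      field_simp
    · simp
      nlinarith
  rw [cauchyInt, ← integral_const_mul]
  simp_rw [← hin]
  rw [integral_integral_swap (f := fun (s : ℝ) (ξ : ℝ) => ψ s * Complex.exp (2 * Real.pi *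
    Complex.I * (z - s) * ξ)) hprod]
  refine setIntegral_congr_fun measurableSet_Ioi fun ξ _ => ?_
  rw [fourier_real_eq', ← integral_const_mul]
  refine integral_congr_ae (ae_of_all _ fun s => ?_)
  simp only
  rw [← mul_assoc, ← Complex.exp_add, mul_comm]
  congr 2
  ring

theorem tendsto_cauchyInt (ψ : 𝓢(ℝ, ℂ)) (x : ℝ) :
    Tendsto (fun y : ℝ => cauchyInt ψ (x + y * Complex.I)) (𝓝[>] 0) (𝓝 (cauchyPlus ψ x)) := by
  have hpi := Real.pi_pos
  rw [cauchyPlus_eq]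
  have hF := integrable_fourier_schwartz ψ
  have hFc := continuous_fourier_schwartz ψ
  refine (tendsto_integral_filter_of_dominated_convergence (μ := volume.restrict (Ioi (0 : ℝ)))
    (l := 𝓝[>] (0 : ℝ))
    (F := fun y ξ : ℝ => Complex.exp (2 * Real.pi * Complex.I * (x + y * Complex.I) * ξ) *
      𝓕 (ψ : ℝ → ℂ) ξ)
    (fun ξ => ‖𝓕 (ψ : ℝ → ℂ) ξ‖) ?_ ?_ hF.norm.integrableOn ?_).congr' ?_
  · refine Eventually.of_forall fun y => Continuous.aestronglyMeasurable ?_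
    fun_prop
  · filter_upwards [self_mem_nhdsWithin] with y hy
    filter_upwards [ae_restrict_mem measurableSet_Ioi] with ξ hξ
    rw [norm_mul, Complex.norm_exp]
    refine mul_le_of_le_one_left (norm_nonneg _) ?_
    rw [Real.exp_le_one_iff]
    simp
    have h1 : (0 : ℝ) < y := hy
    have h2 : (0 : ℝ) < ξ := hξ
    positivity
  · refine ae_of_all _ fun ξ => ?_
    have hc : Continuous fun y : ℝ =>
        Complex.exp (2 * Real.pi * Complex.I * (x + y * Complex.I) * ξ) * 𝓕 (ψ : ℝ → ℂ) ξ := by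
      fun_prop
    have := (hc.tendsto 0).mono_left (nhdsWithin_le_nhds (s := Ioi (0 : ℝ)))
    simpa using this
  · filter_upwards [self_mem_nhdsWithin] with y hy
    have h1 : (0 : ℝ) < y := hy
    exact (cauchyInt_eq_fourier ψ (by simpa using h1)).symm

theorem tendsto_inv_nat_nhdsGT :
    Tendsto (fun n : ℕ => 1 / ((n : ℝ) + 1)) atTop (𝓝[>] 0) :=
  tendsto_nhdsWithin_iff.2 ⟨tendsto_one_div_add_atTop_nhds_zero_nat,
    Eventually.of_forall fun n => by simp only [mem_Ioi]; positivity⟩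

theorem aestronglyMeasurable_cauchyPlus (ψ : 𝓢(ℝ, ℂ)) :
    AEStronglyMeasurable (cauchyPlus ψ) volume :=
  aestronglyMeasurable_of_tendsto_ae atTop
    (f := fun (n : ℕ) (x : ℝ) => cauchyInt ψ (x + (1 / ((n : ℝ) + 1) : ℝ) * Complex.I))
    (fun n => (continuous_cauchyInt_line (fastDecay_schwartz ψ)
      (by positivity)).aestronglyMeasurable)
    (ae_of_all _ fun x => (tendsto_cauchyInt ψ x).comp tendsto_inv_nat_nhdsGT)

/-- The bounds on horizontal lines do not depend on the height, so Fatou's lemma carries them to the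
boundary. -/
theorem eLpNorm_cauchyPlus_le {p : ℝ} (hp : 1 < p) : ∃ C : ℝ≥0, ∀ ψ : 𝓢(ℝ, ℂ),
    eLpNorm (cauchyPlus ψ) (ENNReal.ofReal p) volume ≤
      C * eLpNorm ψ (ENNReal.ofReal p) volume := by
  obtain ⟨C, hC⟩ := eLpNorm_cauchyInt_le hp
  refine ⟨C, fun ψ => ?_⟩
  have hb : ∀ n : ℕ, eLpNorm (fun x : ℝ => cauchyInt ψ
      (x + (1 / ((n : ℝ) + 1) : ℝ) * Complex.I)) (ENNReal.ofReal p) volume ≤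
      C * eLpNorm ψ (ENNReal.ofReal p) volume := fun n =>
    hC ψ (fastDecay_schwartz ψ) _ (by positivity)
  refine (Lp.eLpNorm_lim_le_liminf_eLpNorm
    (f := fun (n : ℕ) (x : ℝ) => cauchyInt ψ (x + (1 / ((n : ℝ) + 1) : ℝ) * Complex.I))
    (fun n => (continuous_cauchyInt_line (fastDecay_schwartz ψ)
      (by positivity)).aestronglyMeasurable) (cauchyPlus ψ)
    (ae_of_all _ fun x => (tendsto_cauchyInt ψ x).comp tendsto_inv_nat_nhdsGT)).trans ?_
  refine (liminf_le_liminf (Eventually.of_forall hb)).trans (le_of_eq ?_)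
  exact liminf_const _

theorem memLp_cauchyPlus {p : ℝ} (hp : 1 < p) (ψ : 𝓢(ℝ, ℂ)) :
    MemLp (cauchyPlus ψ) (ENNReal.ofReal p) volume := by
  obtain ⟨C, hC⟩ := eLpNorm_cauchyPlus_le hp
  exact ⟨aestronglyMeasurable_cauchyPlus ψ,
    (hC ψ).trans_lt (ENNReal.mul_lt_top ENNReal.coe_lt_top (ψ.memLp _ volume).2)⟩

theorem fourier_schwartzNeg (ψ : 𝓢(ℝ, ℂ)) (ξ : ℝ) :
    𝓕 (schwartzNeg ψ : ℝ → ℂ) ξ = 𝓕 (ψ : ℝ → ℂ) (-ξ) := by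
  have := congrFun (Real.fourierInv_eq_fourier_comp_neg (ψ : ℝ → ℂ)) ξ
  rw [Real.fourierInv_eq_fourier_neg] at this
  exact this.symm

theorem cauchyMinusSchwartz_eq (ψ : 𝓢(ℝ, ℂ)) (x : ℝ) :
    cauchyMinusSchwartz ψ x = cauchyPlus (schwartzNeg ψ) (-x) := by
  rw [cauchyMinusSchwartz, cauchyPlus, fourierInv_real_eq, fourierInv_real_eq,
    ← integral_neg_eq_self]
  refine integral_congr_ae (ae_of_all _ fun ξ => ?_)
  simp only
  have e : (Iio (0 : ℝ)).indicator (𝓕 (ψ : ℝ → ℂ)) (-ξ) =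
      (Ioi (0 : ℝ)).indicator (𝓕 (schwartzNeg ψ : ℝ → ℂ)) ξ := by
    by_cases h : 0 < ξ
    · rw [indicator_of_mem (by simpa using h), indicator_of_mem (by exact h), fourier_schwartzNeg]
    · rw [indicator_of_notMem (by simpa using h), indicator_of_notMem (by exact h)]
  rw [e]
  congr 2
  push_cast
  ring

theorem aestronglyMeasurable_cauchyMinusSchwartz (ψ : 𝓢(ℝ, ℂ)) :
    AEStronglyMeasurable (cauchyMinusSchwartz ψ) volume := by
  rw [funext (cauchyMinusSchwartz_eq ψ)]
  exact (aestronglyMeasurable_cauchyPlus _).comp_quasiMeasurePreserving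
    (Measure.measurePreserving_neg volume).quasiMeasurePreserving

theorem eLpNorm_cauchyMinusSchwartz_le {p : ℝ} (hp : 1 < p) : ∃ C : ℝ≥0, ∀ ψ : 𝓢(ℝ, ℂ),
    eLpNorm (cauchyMinusSchwartz ψ) (ENNReal.ofReal p) volume ≤
      C * eLpNorm ψ (ENNReal.ofReal p) volume := by
  obtain ⟨C, hC⟩ := eLpNorm_cauchyPlus_le hp
  refine ⟨C, fun ψ => ?_⟩
  rw [funext (cauchyMinusSchwartz_eq ψ), eLpNorm_comp_neg (aestronglyMeasurable_cauchyPlus _)]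
  refine (hC _).trans (le_of_eq ?_)
  rw [show (schwartzNeg ψ : ℝ → ℂ) = fun x => ψ (-x) from rfl,
    eLpNorm_comp_neg ψ.continuous.aestronglyMeasurable]

theorem memLp_cauchyMinusSchwartz {p : ℝ} (hp : 1 < p) (ψ : 𝓢(ℝ, ℂ)) :
    MemLp (cauchyMinusSchwartz ψ) (ENNReal.ofReal p) volume := by
  obtain ⟨C, hC⟩ := eLpNorm_cauchyMinusSchwartz_le hp
  exact ⟨aestronglyMeasurable_cauchyMinusSchwartz ψ,
    (hC ψ).trans_lt (ENNReal.mul_lt_top ENNReal.coe_lt_top (ψ.memLp _ volume).2)⟩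

/-- The inverse Fourier transform is moved across each pairing; the substitution ξ ↦ -ξ then
exchanges the two half-lines. -/
theorem integral_cauchyMinusSchwartz_mul (ψ χ : 𝓢(ℝ, ℂ)) :
    ∫ x, χ x * cauchyMinusSchwartz ψ x = ∫ x, cauchyPlus χ x * ψ x := by
  have h1 : ∫ x, χ x * cauchyMinusSchwartz ψ x = ∫ x, cauchyMinusSchwartz ψ x * χ x := by
    simp only [mul_comm]
  rw [h1, cauchyMinusSchwartz, cauchyPlus, integral_fourierInv_mul
    ((integrable_fourier_schwartz ψ).indicator measurableSet_Iio) χ.integrable,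
    integral_fourierInv_mul
    ((integrable_fourier_schwartz χ).indicator measurableSet_Ioi) ψ.integrable,
    ← integral_neg_eq_self]
  refine integral_congr_ae (ae_of_all _ fun ξ => ?_)
  simp only [Real.fourierInv_eq_fourier_neg, neg_neg]
  by_cases h : 0 < ξ
  · rw [indicator_of_mem (by simpa using h), indicator_of_mem (by exact h), mul_comm]
  · rw [indicator_of_notMem (by simpa using h), indicator_of_notMem (by exact h), zero_mul,
      zero_mul]

theorem cauchyMinusSchwartz_sub (ψ χ : 𝓢(ℝ, ℂ)) (x : ℝ) :
    cauchyMinusSchwartz (ψ - χ) x = cauchyMinusSchwartz ψ x - cauchyMinusSchwartz χ x := by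
  have hF : 𝓕 ((ψ - χ : 𝓢(ℝ, ℂ)) : ℝ → ℂ) = 𝓕 (ψ : ℝ → ℂ) - 𝓕 (χ : ℝ → ℂ) := by
    have := map_sub (FourierTransform.fourierCLM ℂ 𝓢(ℝ, ℂ)) ψ χ
    simp only [FourierTransform.fourierCLM_apply] at this
    rw [← SchwartzMap.fourier_coe, ← SchwartzMap.fourier_coe, ← SchwartzMap.fourier_coe, this]
    rfl
  have hi : ∀ φ : 𝓢(ℝ, ℂ), Integrable fun v : ℝ =>
      Complex.exp (2 * Real.pi * Complex.I * x * v) *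
        (Iio (0 : ℝ)).indicator (𝓕 (φ : ℝ → ℂ)) v := by
    intro φ
    refine ((integrable_fourier_schwartz φ).indicator measurableSet_Iio).bdd_mul (c := 1)
      (Continuous.aestronglyMeasurable (by fun_prop)) (ae_of_all _ fun v => ?_)
    rw [Complex.norm_exp]
    simp
  simp only [cauchyMinusSchwartz, fourierInv_real_eq]
  rw [← integral_sub (hi ψ) (hi χ)]
  refine integral_congr_ae (ae_of_all _ fun ξ => ?_)
  simp only [hF]
  by_cases h : ξ ∈ Iio (0 : ℝ)
  · simp only [indicator_of_mem h, Pi.sub_apply]; ring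
  · simp only [indicator_of_notMem h]; ring

/-- `C_-` is well defined on `L^p`. -/
theorem exists_isCauchyMinus {p : ℝ} (hp : 1 < p) {g : ℝ → ℂ}
    (hg : MemLp g (ENNReal.ofReal p) volume) : ∃ h, IsCauchyMinus (ENNReal.ofReal p) g h := by
  have hp1 : (1 : ℝ≥0∞) ≤ ENNReal.ofReal p := by simpa using hp.le
  have inst : Fact (1 ≤ ENNReal.ofReal p) := ⟨hp1⟩
  obtain ⟨C, hC⟩ := eLpNorm_cauchyMinusSchwartz_le hp
  obtain ⟨ψ, hψ⟩ := exists_seq_schwartz_tendsto hp hg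
  have hmem := fun n => memLp_cauchyMinusSchwartz hp (ψ n)
  have hcauchy : CauchySeq fun n => (hmem n).toLp (cauchyMinusSchwartz (ψ n)) := by
    rw [EMetric.cauchySeq_iff]
    intro ε hε
    have hlim : Tendsto (fun n => (C : ℝ≥0∞) *
        eLpNorm (fun x => ψ n x - g x) (ENNReal.ofReal p) volume) atTop (𝓝 0) := by
      simpa using ENNReal.Tendsto.const_mul hψ (Or.inr ENNReal.coe_ne_top) (a := (C : ℝ≥0∞))
    obtain ⟨N, hN⟩ := eventually_atTop.1 (hlim.eventually_lt_const (ENNReal.half_pos hε.ne'))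
    refine ⟨N, fun m hm n hn => ?_⟩
    rw [Lp.edist_toLp_toLp]
    have e1 : (cauchyMinusSchwartz (ψ m) - cauchyMinusSchwartz (ψ n)) =
        cauchyMinusSchwartz (ψ m - ψ n) := by
      funext x; rw [cauchyMinusSchwartz_sub]; rfl
    rw [e1]
    have e2 : ((ψ m - ψ n : 𝓢(ℝ, ℂ)) : ℝ → ℂ) =
        (fun x => ψ m x - g x) - fun x => ψ n x - g x := by
      funext x; simp
    calc _ ≤ C * eLpNorm (ψ m - ψ n : 𝓢(ℝ, ℂ)) (ENNReal.ofReal p) volume := hC _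
      _ ≤ C * (eLpNorm (fun x => ψ m x - g x) (ENNReal.ofReal p) volume +
          eLpNorm (fun x => ψ n x - g x) (ENNReal.ofReal p) volume) := by
          rw [e2]
          refine mul_le_mul_right (eLpNorm_sub_le ?_ ?_ hp1) _
          · exact (ψ m).continuous.aestronglyMeasurable.sub hg.1
          · exact (ψ n).continuous.aestronglyMeasurable.sub hg.1
      _ < ε / 2 + ε / 2 := by
          rw [mul_add]
          exact ENNReal.add_lt_add (hN m hm) (hN n hn)
      _ = ε := ENNReal.add_halves ε
  obtain ⟨H, hH⟩ := cauchySeq_tendsto_of_complete hcauchy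
  refine ⟨H, hg, Lp.memLp H, ψ, hψ, ?_⟩
  rw [tendsto_iff_edist_tendsto_0] at hH
  refine hH.congr fun n => ?_
  rw [Lp.edist_def]
  refine eLpNorm_congr_ae ?_
  filter_upwards [(hmem n).coeFn_toLp] with x hx
  simp [hx]

/-- The transpose of `C_-` is `C_+`. -/
theorem IsCauchyMinus.integral_mul_schwartz {p q : ℝ} (hpq : p.HolderConjugate q) {g h : ℝ → ℂ}
    (hgh : IsCauchyMinus (ENNReal.ofReal p) g h) (χ : 𝓢(ℝ, ℂ)) :
    ∫ x, h x * χ x = ∫ x, g x * cauchyPlus χ x := by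
  obtain ⟨hg, hh, ψ, h1, h2⟩ := hgh
  have l1 := tendsto_integral_mul hpq.symm (χ.memLp _ volume) hh
    (fun n => memLp_cauchyMinusSchwartz hpq.lt (ψ n)) h2
  have l2 := tendsto_integral_mul hpq.symm (memLp_cauchyPlus hpq.symm.lt χ) hg
    (fun n => (ψ n).memLp _ volume) h1
  simp_rw [integral_cauchyMinusSchwartz_mul] at l1
  have := tendsto_nhds_unique l1 l2
  simpa only [mul_comm] using this

/-- By transposition, boundedness of `C_-` on `L^p` follows from that of `C_+` on `L^q`. This serves
for `γ = 0`. -/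
theorem IsCauchyMinus.eLpNorm_le {p : ℝ} (hp : 1 < p) : ∃ C : ℝ≥0, ∀ g h : ℝ → ℂ,
    IsCauchyMinus (ENNReal.ofReal p) g h →
      eLpNorm h (ENNReal.ofReal p) volume ≤ C * eLpNorm g (ENNReal.ofReal p) volume := by
  have hpq := Real.HolderConjugate.conjExponent hp
  obtain ⟨C, hC⟩ := eLpNorm_cauchyPlus_le hpq.symm.lt
  refine ⟨C, fun g h hgh => eLpNorm_le_of_forall_schwartz hpq hgh.2.1 fun χ => ?_⟩
  rw [hgh.integral_mul_schwartz hpq]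
  refine (enorm_integral_mul_le hpq hgh.1.1 (aestronglyMeasurable_cauchyPlus χ)).trans ?_
  calc _ ≤ eLpNorm g (ENNReal.ofReal p) volume * (C * eLpNorm χ (ENNReal.ofReal _) volume) := by
        gcongr; exact hC χ
    _ = _ := by ring

/-! ### Maximal function bounds for the Cauchy integral. -/

/-- Take `k` least. The kernel decays like 4^{-k} over intervals whose lengths grow like 2^k, so
summing over `k` bounds Poisson integrals by a convergent geometric series of maximal averages. -/
theorem exists_poissonKer_le {y : ℝ} (hy : 0 < y) (u : ℝ) : ∃ k : ℕ, |u| ≤ 2 ^ k * y ∧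
    poissonKer y u ≤ 2 / y * (1 / 4) ^ k := by
  have hpi := Real.pi_gt_three
  obtain ⟨k₀, hk₀⟩ := pow_unbounded_of_one_lt (|u| / y) (one_lt_two : (1 : ℝ) < 2)
  have hex : ∃ k : ℕ, |u| ≤ 2 ^ k * y := ⟨k₀, by rw [div_lt_iff₀ hy] at hk₀; exact hk₀.le⟩
  classical
  refine ⟨Nat.find hex, Nat.find_spec hex, ?_⟩
  rcases Nat.eq_zero_or_pos (Nat.find hex) with h | h
  · rw [h, pow_zero, mul_one, poissonKer, div_le_div_iff₀ (by positivity) hy]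
    nlinarith [sq_nonneg u, sq_nonneg y, mul_nonneg (sub_nonneg.2 hpi.le) (sq_nonneg y),
      mul_nonneg Real.pi_pos.le (sq_nonneg u)]
  · obtain ⟨j, hj⟩ := Nat.exists_eq_succ_of_ne_zero h.ne'
    have h1 : ¬ |u| ≤ 2 ^ j * y := Nat.find_min hex (by omega)
    rw [not_le] at h1
    rw [hj, poissonKer]
    have h2 : (2 ^ j * y) ^ 2 < u ^ 2 := by
      rw [← sq_abs u]
      exact pow_lt_pow_left₀ h1 (by positivity) two_ne_zero
    have h3 : (0 : ℝ) < (2 ^ j) ^ 2 := by positivity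
    have e : (1 / 4 : ℝ) ^ (j.succ) = 1 / (4 * (2 ^ j) ^ 2) := by
      rw [pow_succ, ← pow_mul, mul_comm j 2, pow_mul, one_div, inv_pow]
      norm_num
    rw [e, div_mul_div_comm, div_le_div_iff₀ (by positivity) (by positivity)]
    nlinarith [mul_pos h3 hy, mul_nonneg (sub_nonneg.2 hpi.le) (sq_nonneg u),
      mul_nonneg Real.pi_pos.le (sq_nonneg y)]

theorem lintegral_poissonKer_mul_le {f : ℝ → ℝ≥0∞} (hf : Measurable f) {y : ℝ} (hy : 0 < y)
    (x : ℝ) : ∫⁻ s, ENNReal.ofReal (poissonKer y (x - s)) * f s ≤ 8 * maxFn f x := by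
  have h1 : ∀ s, ENNReal.ofReal (poissonKer y (x - s)) * f s ≤
      ∑' k : ℕ, ENNReal.ofReal (2 / y * (1 / 4) ^ k) *
        (Metric.closedBall x (2 ^ k * y)).indicator f s := by
    intro s
    obtain ⟨k, hk1, hk2⟩ := exists_poissonKer_le hy (x - s)
    refine le_trans ?_ (ENNReal.le_tsum k)
    rw [indicator_of_mem (by rwa [Metric.mem_closedBall, dist_comm, Real.dist_eq])]
    gcongr
  refine (lintegral_mono h1).trans ?_
  rw [lintegral_tsum (fun k => ((hf.indicator
    Metric.isClosed_closedBall.measurableSet).const_mul _).aemeasurable)]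
  calc _ ≤ ∑' k : ℕ, ENNReal.ofReal (4 * (1 / 2) ^ k) * maxFn f x := by
        refine ENNReal.tsum_le_tsum fun k => ?_
        rw [lintegral_const_mul' _ _ ENNReal.ofReal_ne_top,
          lintegral_indicator Metric.isClosed_closedBall.measurableSet]
        refine (mul_le_mul_right (lintegral_closedBall_le_maxFn f x
          (by positivity : 0 < 2 ^ k * y)) _).trans (le_of_eq ?_)
        rw [← mul_assoc, ← ENNReal.ofReal_mul (by positivity)]
        congr 2
        have : (1 / 4 : ℝ) ^ k * 2 ^ k = (1 / 2) ^ k := by rw [← mul_pow]; norm_num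
        field_simp
        rw [← this]
        ring
    _ = _ := by
        rw [ENNReal.tsum_mul_right]
        congr 1
        rw [← ENNReal.ofReal_tsum_of_nonneg (fun k => by positivity)
          (summable_geometric_two.mul_left 4), tsum_mul_left, tsum_geometric_two]
        norm_num

theorem integrable_exp_neg_abs {a : ℝ} (ha : 0 < a) :
    Integrable fun ξ : ℝ => Real.exp (-a * |ξ|) := by
  have h1 : IntegrableOn (fun ξ : ℝ => Real.exp (-a * |ξ|)) (Ioi 0) :=
    (integrableOn_exp_mul_Ioi (by linarith : -a < 0) 0).congr_fun
      (fun ξ hξ => by simp only [abs_of_pos (show (0 : ℝ) < ξ from hξ)]) measurableSet_Ioi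
  have h2 : IntegrableOn (fun ξ : ℝ => Real.exp (-a * |ξ|)) (Iic 0) :=
    (integrableOn_exp_mul_Iic ha 0).congr_fun
      (fun ξ hξ => by simp only [abs_of_nonpos (show ξ ≤ 0 from hξ), neg_mul_neg])
      measurableSet_Iic
  rw [← integrableOn_univ, ← Iic_union_Ioi (a := (0 : ℝ))]
  exact h2.union h1

theorem fourierInv_exp_neg_abs {y : ℝ} (hy : 0 < y) (s : ℝ) :
    𝓕⁻ (fun ξ : ℝ => (Real.exp (-(2 * Real.pi * y) * |ξ|) : ℂ)) s = (poissonKer y s : ℂ) := by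
  have hpi := Real.pi_pos
  have hint : Integrable fun ξ : ℝ => Complex.exp (2 * Real.pi * Complex.I * s * ξ) *
      (Real.exp (-(2 * Real.pi * y) * |ξ|) : ℂ) := by
    refine (integrable_exp_neg_abs (a := 2 * Real.pi * y)
      (by positivity)).ofReal.bdd_mul (c := 1)
      (Continuous.aestronglyMeasurable (by fun_prop)) (ae_of_all _ fun v => ?_)
    rw [Complex.norm_exp]
    simp
  rw [fourierInv_real_eq, ← intervalIntegral.integral_Iic_add_Ioi (b := 0) hint.integrableOn
    hint.integrableOn]
  have e1 : ∫ ξ in Iic (0 : ℝ), Complex.exp (2 * Real.pi * Complex.I * s * ξ) *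
      (Real.exp (-(2 * Real.pi * y) * |ξ|) : ℂ) =
      ∫ ξ in Iic (0 : ℝ), Complex.exp ((2 * Real.pi * (y + Complex.I * s)) * ξ) := by
    refine setIntegral_congr_fun measurableSet_Iic fun ξ hξ => ?_
    rw [Complex.ofReal_exp, ← Complex.exp_add, abs_of_nonpos hξ]
    congr 1; push_cast; ring
  have e2 : ∫ ξ in Ioi (0 : ℝ), Complex.exp (2 * Real.pi * Complex.I * s * ξ) *
      (Real.exp (-(2 * Real.pi * y) * |ξ|) : ℂ) =
      ∫ ξ in Ioi (0 : ℝ), Complex.exp ((2 * Real.pi * (-y + Complex.I * s)) * ξ) := by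
    refine setIntegral_congr_fun measurableSet_Ioi fun ξ hξ => ?_
    rw [Complex.ofReal_exp, ← Complex.exp_add, abs_of_pos hξ]
    congr 1; push_cast; ring
  rw [e1, e2, integral_exp_mul_complex_Iic (by simp; positivity),
    integral_exp_mul_complex_Ioi (by simp; positivity)]
  simp only [Complex.ofReal_zero, mul_zero, Complex.exp_zero, poissonKer]
  push_cast
  have h1 : (y : ℂ) + Complex.I * s ≠ 0 := fun h => by
    have := congrArg Complex.re h; simp at this; exact hy.ne' this
  have h2 : -(y : ℂ) + Complex.I * s ≠ 0 := fun h => by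
    have := congrArg Complex.re h; simp at this; exact hy.ne' this
  have h3 : (Real.pi : ℂ) ≠ 0 := by exact_mod_cast hpi.ne'
  have h4 : (s : ℂ) ^ 2 + (y : ℂ) ^ 2 ≠ 0 := by
    have : (0 : ℝ) < s ^ 2 + y ^ 2 := by positivity
    exact_mod_cast this.ne'
  field_simp
  ring_nf
  simp only [Complex.I_sq]
  ring

theorem fourier_poissonKer {y : ℝ} (hy : 0 < y) (ξ : ℝ) :
    𝓕 (fun s : ℝ => (poissonKer y s : ℂ)) ξ = (Real.exp (-(2 * Real.pi * y) * |ξ|) : ℂ) := by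
  have hpi := Real.pi_pos
  set e : ℝ → ℂ := fun ξ : ℝ => (Real.exp (-(2 * Real.pi * y) * |ξ|) : ℂ) with he
  have h1 : (fun s : ℝ => (poissonKer y s : ℂ)) = 𝓕⁻ e :=
    funext fun s => (fourierInv_exp_neg_abs hy s).symm
  have h2 : Integrable (𝓕 e) := by
    have h3 : Integrable (𝓕⁻ e) := by rw [← h1]; exact (integrable_poissonKer hy).ofReal
    have h4 : (𝓕 e) = fun x => 𝓕⁻ e (-x) := by
      funext x; rw [Real.fourierInv_eq_fourier_neg, neg_neg]
    rw [h4]; exact h3.comp_neg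
  rw [h1, Continuous.fourier_fourierInv_eq (by fun_prop)
    (integrable_exp_neg_abs (a := 2 * Real.pi * y) (by positivity)).ofReal h2]

/-- Poisson representation of the Cauchy integral. -/
theorem cauchyInt_eq_poisson (ψ : 𝓢(ℝ, ℂ)) (x : ℝ) {y : ℝ} (hy : 0 < y) :
    cauchyInt ψ (x + y * Complex.I) = ∫ s, (poissonKer y (x - s) : ℂ) * cauchyPlus ψ s := by
  have h1 : Integrable fun s => (poissonKer y (x - s) : ℂ) :=
    (((integrable_poissonKer hy).comp_sub_left x)).ofReal
  have h2 : ∫ s, (poissonKer y (x - s) : ℂ) * cauchyPlus ψ s =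
      ∫ s, cauchyPlus ψ s * (poissonKer y (x - s) : ℂ) := by simp only [mul_comm]
  rw [h2, cauchyPlus, integral_fourierInv_mul
    ((integrable_fourier_schwartz ψ).indicator measurableSet_Ioi) h1,
    cauchyInt_eq_fourier ψ (by simpa using hy), ← integral_indicator measurableSet_Ioi]
  refine integral_congr_ae (ae_of_all _ fun ξ => ?_)
  simp only
  by_cases h : 0 < ξ
  · rw [indicator_of_mem (by exact h), indicator_of_mem (by exact h), mul_comm]
    congr 1
    rw [fourierInv_real_eq, ← integral_sub_left_eq_self _ volume x]
    have e : ∀ u : ℝ, Complex.exp (2 * Real.pi * Complex.I * ξ * (x - u : ℝ)) *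
        (poissonKer y (x - (x - u)) : ℂ) = Complex.exp (2 * Real.pi * Complex.I * ξ * x) *
        (Complex.exp (-(2 * Real.pi * Complex.I * ξ * u)) * (poissonKer y u : ℂ)) := by
      intro u
      rw [← mul_assoc, ← Complex.exp_add, sub_sub_cancel]
      congr 2; push_cast; ring
    simp_rw [e]
    rw [integral_const_mul, ← fourier_real_eq' (fun u => (poissonKer y u : ℂ)),
      fourier_poissonKer hy, abs_of_pos h, Complex.ofReal_exp, ← Complex.exp_add]
    congr 1
    push_cast
    linear_combination (2 * Real.pi * y * ξ : ℂ) * Complex.I_sq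
  · rw [indicator_of_notMem (by exact h), indicator_of_notMem (by exact h), zero_mul]

theorem maxFn_enorm_ae {f : ℝ → ℂ} (hf : AEStronglyMeasurable f volume) :
    maxFn (fun s => ‖f s‖ₑ) = maxFn (fun s => ‖hf.mk f s‖ₑ) :=
  maxFn_congr_ae (by filter_upwards [hf.ae_eq_mk] with s hs; rw [hs])

theorem measurable_maxFn_enorm {f : ℝ → ℂ} (hf : AEStronglyMeasurable f volume) :
    Measurable (maxFn fun s => ‖f s‖ₑ) := by
  rw [maxFn_enorm_ae hf]
  exact measurable_maxFn hf.stronglyMeasurable_mk.measurable.enorm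

theorem lintegral_poissonKer_mul_enorm_le {f : ℝ → ℂ} (hf : AEStronglyMeasurable f volume)
    {y : ℝ} (hy : 0 < y) (x : ℝ) :
    ∫⁻ s, ENNReal.ofReal (poissonKer y (x - s)) * ‖f s‖ₑ ≤ 8 * maxFn (fun s => ‖f s‖ₑ) x := by
  rw [maxFn_enorm_ae hf]
  refine le_trans (le_of_eq ?_) (lintegral_poissonKer_mul_le
    hf.stronglyMeasurable_mk.measurable.enorm hy x)
  refine lintegral_congr_ae ?_
  filter_upwards [hf.ae_eq_mk] with s hs
  rw [hs]

/-- The nontangential bound for the Cauchy integral. -/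
theorem enorm_cauchyInt_le (ψ : 𝓢(ℝ, ℂ)) (x : ℝ) {y : ℝ} (hy : 0 < y) :
    ‖cauchyInt ψ (x + y * Complex.I)‖ₑ ≤ 8 * maxFn (fun s => ‖cauchyPlus ψ s‖ₑ) x := by
  rw [cauchyInt_eq_poisson ψ x hy]
  refine (enorm_integral_le_lintegral_enorm _).trans ?_
  refine le_trans (le_of_eq ?_)
    (lintegral_poissonKer_mul_enorm_le (aestronglyMeasurable_cauchyPlus ψ) hy x)
  refine lintegral_congr fun s => ?_
  rw [enorm_mul]
  congr 1
  rw [← ofReal_norm, Complex.norm_real, Real.norm_of_nonneg (poissonKer_pos hy _).le]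

/-- |s - z|^{-2} is π/y times the Poisson kernel, and π ≤ 4. The bound involves ψ and not `C_+ ψ`;
it is used only to justify integrations by parts, so it does not enter the final estimate. -/
theorem enorm_cauchyIntDeriv_le (ψ : 𝓢(ℝ, ℂ)) (x : ℝ) {y : ℝ} (hy : 0 < y) :
    ‖cauchyIntDeriv ψ (x + y * Complex.I)‖ₑ ≤
      ENNReal.ofReal (4 / y) * (8 * maxFn (fun s => ‖ψ s‖ₑ) x) := by
  have hpi := Real.pi_pos
  rw [cauchyIntDeriv, enorm_mul]
  have h1 : ‖(2 * Real.pi * Complex.I : ℂ)⁻¹‖ₑ ≤ 1 := by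
    rw [← ofReal_norm]
    exact ENNReal.ofReal_le_one.2 norm_two_pi_I_inv_le
  refine (mul_le_of_le_one_left (by positivity) h1).trans ?_
  refine (enorm_integral_le_lintegral_enorm _).trans ?_
  refine le_trans ?_ (mul_le_mul_right (lintegral_poissonKer_mul_enorm_le
    ψ.continuous.aestronglyMeasurable hy x) _)
  rw [← lintegral_const_mul' _ _ ENNReal.ofReal_ne_top]
  refine lintegral_mono fun s => ?_
  rw [← mul_assoc, ← ENNReal.ofReal_mul (by positivity), div_eq_mul_inv, enorm_mul, mul_comm]
  gcongr
  rw [← ofReal_norm]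
  apply ENNReal.ofReal_le_ofReal
  rw [norm_inv, norm_pow, Complex.sq_norm, Complex.normSq_apply, poissonKer]
  simp only [Complex.sub_re, Complex.add_re, Complex.ofReal_re, Complex.mul_re, Complex.I_re,
    mul_zero, Complex.ofReal_im, Complex.I_im, mul_one, sub_self, add_zero, Complex.sub_im,
    Complex.add_im, Complex.mul_im, zero_sub, zero_add]
  rw [inv_eq_one_div, div_mul_div_comm, div_le_div_iff₀ (by nlinarith [sq_nonneg (s - x)])
    (by positivity)]
  have h4 : Real.pi ≤ 4 := Real.pi_le_four
  have h5 : 0 ≤ (x - s) ^ 2 + y ^ 2 := by positivity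
  have h6 := mul_nonneg (sub_nonneg.2 h4) (mul_nonneg hy.le h5)
  nlinarith

/-! ### Green's formula in the upper half-plane. -/

theorem ae_norm_le_toReal {U : ℝ → ℝ≥0∞} (hU : ∀ᵐ x, U x < ⊤) {f : ℝ → ℂ} {c : ℝ} (hc : 0 ≤ c)
    (h : ∀ x, ‖f x‖ₑ ≤ ENNReal.ofReal c * U x) : ∀ᵐ x, ‖f x‖ ≤ c * (U x).toReal := by
  filter_upwards [hU] with x hx
  have h1 := ENNReal.toReal_mono (ENNReal.mul_ne_top ENNReal.ofReal_ne_top hx.ne) (h x)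
  rwa [ENNReal.toReal_mul, ENNReal.toReal_ofReal hc, toReal_enorm] at h1

theorem aestronglyMeasurable_of_hasDerivAt_param {G Gy : ℝ → ℝ → ℂ} {y : ℝ} (hy : 0 < y)
    (hm : ∀ w > 0, AEStronglyMeasurable (fun x => G x w) volume)
    (hd : ∀ x, HasDerivAt (fun w => G x w) (Gy x y) y) :
    AEStronglyMeasurable (fun x => Gy x y) volume := by
  refine aestronglyMeasurable_of_tendsto_ae atTop
    (f := fun (n : ℕ) (x : ℝ) => (1 / ((n : ℝ) + 1))⁻¹ • (G x (y + 1 / ((n : ℝ) + 1)) - G x y))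
    (fun n => AEStronglyMeasurable.fun_const_smul
      ((hm (y + 1 / ((n : ℝ) + 1)) (by positivity)).sub (hm y hy)) _) (ae_of_all _ fun x => ?_)
  have h1 := (hasDerivAt_iff_tendsto_slope_zero.1 (hd x))
  refine h1.comp ((tendsto_inv_nat_nhdsGT).mono_right ?_)
  exact nhdsWithin_mono _ fun w hw => (ne_of_gt hw : w ≠ 0)

/-- Green's formula for an extension `G` of `g` to the upper half-plane and an analytic function:
the pairing of `g` with `C_+ ψ` is controlled by `∂̄ G`. -/
theorem enorm_integral_mul_cauchyPlus_le {p q : ℝ} (hpq : p.HolderConjugate q)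
    {G Gx Gy : ℝ → ℝ → ℂ} {g : ℝ → ℂ} {B : ℝ → ℝ≥0∞} {k : ℝ → ℝ → ℝ≥0∞}
    (hGx : ∀ x y, 0 < y → HasDerivAt (fun x => G x y) (Gx x y) x)
    (hGy : ∀ x y, 0 < y → HasDerivAt (fun y => G x y) (Gy x y) y)
    (hBm : Measurable B) (hBp : ∫⁻ x, B x ^ p ≠ ⊤)
    (bG : ∀ x y, 0 < y → ‖G x y‖ₑ ≤ B x)
    (bGx : ∀ x y, 0 < y → ‖Gx x y‖ₑ ≤ ENNReal.ofReal (1 / y) * B x)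
    (bD : ∀ x y, 0 < y → ‖Gx x y + Complex.I * Gy x y‖ₑ ≤ ENNReal.ofReal (1 / y) * B x)
    (hkm : Measurable (Function.uncurry k))
    (hk : ∀ x y, 0 < y → ‖Gx x y + Complex.I * Gy x y‖ₑ ≤ k x y)
    (hlim : ∀ᵐ x, Tendsto (fun y => G x y) (𝓝[>] 0) (𝓝 (g x)))
    (hzero : ∀ x, ∀ᶠ y in atTop, G x y = 0) (ψ : 𝓢(ℝ, ℂ)) :
    ‖∫ x, g x * cauchyPlus ψ x‖ₑ ≤
      ∫⁻ x, (∫⁻ y in Ioi (0 : ℝ), k x y) * (8 * maxFn (fun s => ‖cauchyPlus ψ s‖ₑ) x) := by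
  have hp := hpq.lt
  have hq := hpq.symm.lt
  set N : ℝ → ℝ≥0∞ := fun x => 8 * maxFn (fun s => ‖cauchyPlus ψ s‖ₑ) x with hN
  set N' : ℝ → ℝ≥0∞ := fun x => 8 * maxFn (fun s => ‖ψ s‖ₑ) x with hN'
  have hNm : Measurable N :=
    (measurable_maxFn_enorm (aestronglyMeasurable_cauchyPlus ψ)).const_mul _
  have hNm' : Measurable N' :=
    (measurable_maxFn_enorm ψ.continuous.aestronglyMeasurable).const_mul _
  have hmaxfin : ∀ f : ℝ → ℂ, MemLp f (ENNReal.ofReal q) volume →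
      ∫⁻ x, (8 * maxFn (fun s => ‖f s‖ₑ) x) ^ q ≠ ⊤ := by
    intro f hf
    obtain ⟨C, hC⟩ := lintegral_maxFn_rpow_le hq
    have h1 : ∫⁻ s, ‖f s‖ₑ ^ q ≠ ⊤ := by
      intro h
      have := hf.2.ne
      rw [eLpNorm_ofReal_exponent (by linarith), h, ENNReal.top_rpow_of_pos (by positivity)] at this
      exact this rfl
    have h2 : ∫⁻ s, ‖hf.1.mk f s‖ₑ ^ q = ∫⁻ s, ‖f s‖ₑ ^ q := by
      refine lintegral_congr_ae ?_
      filter_upwards [hf.1.ae_eq_mk] with s hs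
      rw [hs]
    rw [maxFn_enorm_ae hf.1]
    simp_rw [ENNReal.mul_rpow_of_nonneg _ _ (by linarith : (0 : ℝ) ≤ q)]
    rw [lintegral_const_mul' _ _ (ENNReal.rpow_ne_top_of_nonneg (by linarith) (by simp))]
    refine ENNReal.mul_ne_top (ENNReal.rpow_ne_top_of_nonneg (by linarith) (by simp)) ?_
    refine ne_top_of_le_ne_top ?_ (hC _ hf.1.stronglyMeasurable_mk.measurable.enorm)
    rw [h2]
    exact ENNReal.mul_ne_top ENNReal.coe_ne_top h1
  -- An integrable majorant, by Hölder's inequality and the maximal theorem: all products of `G`,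
  -- `h` and their first derivatives that occur are at most a constant times `U` or `U / y`.
  set U : ℝ → ℝ≥0∞ := fun x => B x * (N x + N' x) with hU
  have hUm : Measurable U := hBm.mul (hNm.add hNm')
  have hUint : ∫⁻ x, U x ≠ ⊤ := by
    have h1 : ∀ R : ℝ → ℝ≥0∞, Measurable R → ∫⁻ x, R x ^ q ≠ ⊤ → ∫⁻ x, B x * R x ≠ ⊤ := by
      intro R hR hRq
      refine ne_top_of_le_ne_top ?_ (ENNReal.lintegral_mul_le_Lp_mul_Lq volume hpq
        hBm.aemeasurable hR.aemeasurable)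
      exact ENNReal.mul_ne_top (ENNReal.rpow_ne_top_of_nonneg (by positivity) hBp)
        (ENNReal.rpow_ne_top_of_nonneg (by positivity) hRq)
    simp only [hU, mul_add]
    have hBN : Measurable fun x => B x * N x := hBm.mul hNm
    rw [lintegral_add_left hBN]
    exact ENNReal.add_ne_top.2 ⟨h1 N hNm (hmaxfin _ (memLp_cauchyPlus hq ψ)),
      h1 N' hNm' (hmaxfin _ (ψ.memLp _ volume))⟩
  have hUae : ∀ᵐ x, U x < ⊤ := ae_lt_top hUm hUint
  have hUi : Integrable fun x => (U x).toReal :=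
    integrable_toReal_of_lintegral_ne_top hUm.aemeasurable hUint
  set h : ℝ → ℝ → ℂ := fun x y => cauchyInt ψ (x + y * Complex.I) with hh
  set h' : ℝ → ℝ → ℂ := fun x y => cauchyIntDeriv ψ (x + y * Complex.I) with hh'
  have hψ := fastDecay_schwartz ψ
  have hhx : ∀ x y, 0 < y → HasDerivAt (fun x => h x y) (h' x y) x := fun x y hy =>
    hasDerivAt_horizontal (hasDerivAt_cauchyInt hψ (by simpa using hy))
  have hhy : ∀ x y, 0 < y → HasDerivAt (fun y => h x y) (h' x y * Complex.I) y := fun x y hy =>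
    hasDerivAt_vertical (hasDerivAt_cauchyInt hψ (by simpa using hy))
  have bh : ∀ x y, 0 < y → ‖h x y‖ₑ ≤ N x := fun x y hy => enorm_cauchyInt_le ψ x hy
  have bh' : ∀ x y, 0 < y → ‖h' x y‖ₑ ≤ ENNReal.ofReal (4 / y) * N' x := fun x y hy =>
    enorm_cauchyIntDeriv_le ψ x hy
  have mG : ∀ y > 0, AEStronglyMeasurable (fun x => G x y) volume := fun y hy =>
    (continuous_iff_continuousAt.2 fun x => (hGx x y hy).continuousAt).aestronglyMeasurable
  have mh : ∀ y > 0, AEStronglyMeasurable (fun x => h x y) volume := fun y hy =>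
    (continuous_iff_continuousAt.2 fun x => (hhx x y hy).continuousAt).aestronglyMeasurable
  have mGx : ∀ y > 0, AEStronglyMeasurable (fun x => Gx x y) volume := fun y hy => by
    rw [show (fun x => Gx x y) = deriv fun x => G x y from
      funext fun x => (hGx x y hy).deriv.symm]
    exact (measurable_deriv _).aestronglyMeasurable
  have mh' : ∀ y > 0, AEStronglyMeasurable (fun x => h' x y) volume := fun y hy => by
    rw [show (fun x => h' x y) = deriv fun x => h x y from
      funext fun x => (hhx x y hy).deriv.symm]
    exact (measurable_deriv _).aestronglyMeasurable
  have mGy : ∀ y > 0, AEStronglyMeasurable (fun x => Gy x y) volume := fun y hy =>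
    aestronglyMeasurable_of_hasDerivAt_param hy mG fun x => hGy x y hy
  have bGy : ∀ x y, 0 < y → ‖Gy x y‖ₑ ≤ ENNReal.ofReal (2 / y) * B x := by
    intro x y hy
    have e : Gy x y = -Complex.I * ((Gx x y + Complex.I * Gy x y) - Gx x y) := by
      linear_combination (Gy x y) * Complex.I_sq
    rw [e, enorm_mul]
    have : ‖-Complex.I‖ₑ = 1 := by rw [← ofReal_norm]; simp
    rw [this, one_mul]
    refine (enorm_sub_le).trans ((add_le_add (bD x y hy) (bGx x y hy)).trans (le_of_eq ?_))
    rw [← add_mul, ← ENNReal.ofReal_add (by positivity) (by positivity)]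
    congr 2; ring
  have uGh : ∀ y > 0, ∀ x, ‖G x y * h x y‖ₑ ≤ ENNReal.ofReal 1 * U x := by
    intro y hy x
    rw [enorm_mul, ENNReal.ofReal_one, one_mul]
    exact mul_le_mul' (bG x y hy) ((bh x y hy).trans le_self_add)
  have uGxh : ∀ y > 0, ∀ x, ‖Gx x y * h x y‖ₑ ≤ ENNReal.ofReal (1 / y) * U x := by
    intro y hy x
    rw [enorm_mul, ← mul_assoc]
    exact mul_le_mul' (bGx x y hy) ((bh x y hy).trans le_self_add)
  have uGyh : ∀ y > 0, ∀ x, ‖Gy x y * h x y‖ₑ ≤ ENNReal.ofReal (2 / y) * U x := by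
    intro y hy x
    rw [enorm_mul, ← mul_assoc]
    exact mul_le_mul' (bGy x y hy) ((bh x y hy).trans le_self_add)
  have uGh' : ∀ y > 0, ∀ x, ‖G x y * h' x y‖ₑ ≤ ENNReal.ofReal (4 / y) * U x := by
    intro y hy x
    rw [enorm_mul, hU]
    simp only
    rw [mul_left_comm]
    refine mul_le_mul' (bG x y hy) ((bh' x y hy).trans ?_)
    gcongr
    exact le_add_self
  have int_of : ∀ {f : ℝ → ℂ} {c : ℝ}, 0 ≤ c → AEStronglyMeasurable f volume →
      (∀ x, ‖f x‖ₑ ≤ ENNReal.ofReal c * U x) → Integrable f := fun hc hm hb =>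
    (hUi.const_mul _).mono' hm (ae_norm_le_toReal hUae hc hb)
  have iGh : ∀ y > 0, Integrable fun x => G x y * h x y := fun y hy =>
    int_of zero_le_one ((mG y hy).mul (mh y hy)) (uGh y hy)
  have iGxh : ∀ y > 0, Integrable fun x => Gx x y * h x y := fun y hy =>
    int_of (by positivity) ((mGx y hy).mul (mh y hy)) (uGxh y hy)
  have iGyh : ∀ y > 0, Integrable fun x => Gy x y * h x y := fun y hy =>
    int_of (by positivity) ((mGy y hy).mul (mh y hy)) (uGyh y hy)
  have iGh' : ∀ y > 0, Integrable fun x => G x y * h' x y := fun y hy =>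
    int_of (by positivity) ((mG y hy).mul (mh' y hy)) (uGh' y hy)
  set J : ℝ → ℂ := fun y => ∫ x, G x y * h x y with hJ
  -- Since h is holomorphic, ∂y(Gh) = -i((∂x + i∂y)G)h + i∂x(Gh), and the last term integrates to
  -- zero over the line.
  set J' : ℝ → ℂ := fun y => -Complex.I * ∫ x, (Gx x y + Complex.I * Gy x y) * h x y with hJ'
  have hJd : ∀ y > 0, HasDerivAt J (J' y) y := by
    intro y hy
    have hball : ∀ w ∈ Metric.ball y (y / 2), y / 2 ≤ w := by
      intro w hw
      have := abs_lt.1 (Real.dist_eq w y ▸ Metric.mem_ball.1 hw)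
      linarith
    have key := (hasDerivAt_integral_of_dominated_loc_of_deriv_le
      (F := fun y x : ℝ => G x y * h x y)
      (F' := fun y x : ℝ => Gy x y * h x y + G x y * (h' x y * Complex.I))
      (bound := fun x => (6 / (y / 2)) * (U x).toReal) (μ := volume) (x₀ := y)
      (Metric.ball_mem_nhds y (by positivity : 0 < y / 2)) ?_ (iGh y hy) ?_ ?_
      (hUi.const_mul _) ?_).2
    · have hibp : ∫ x, (Gx x y * h x y + G x y * h' x y) = 0 :=
        integral_eq_zero_of_hasDerivAt_of_integrable
          (fun x => (hGx x y hy).mul (hhx x y hy)) ((iGxh y hy).add (iGh' y hy)) (iGh y hy)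
      have e : J' y = ∫ x, (Gy x y * h x y + G x y * (h' x y * Complex.I)) := by
        rw [hJ']
        simp only
        have e1 : ∀ x, Gy x y * h x y + G x y * (h' x y * Complex.I) =
            -Complex.I * ((Gx x y + Complex.I * Gy x y) * h x y) +
              Complex.I * (Gx x y * h x y + G x y * h' x y) := by
          intro x
          linear_combination (Gy x y * h x y) * Complex.I_sq
        simp_rw [e1]
        have i1 : Integrable fun x => (Gx x y + Complex.I * Gy x y) * h x y := by
          refine ((iGxh y hy).add ((iGyh y hy).const_mul Complex.I)).congr
            (ae_of_all _ fun x => ?_)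
          simp only [Pi.add_apply]
          ring
        have i2 : Integrable fun x => Gx x y * h x y + G x y * h' x y :=
          (iGxh y hy).add (iGh' y hy)
        rw [integral_add (i1.const_mul _) (i2.const_mul _), integral_const_mul,
          integral_const_mul, hibp, mul_zero, add_zero]
      rw [e]
      exact key
    · filter_upwards [lt_mem_nhds hy] with w hw using (mG w hw).mul (mh w hw)
    · exact ((mGy y hy).mul (mh y hy)).add ((mG y hy).mul ((mh' y hy).mul_const _))
    · have hy2 : 0 < y / 2 := by positivity
      filter_upwards [hUae] with x hx w hw
      have hw0 : 0 < w := hy2.trans_le (hball w hw)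
      have b1 := ENNReal.toReal_mono (ENNReal.mul_ne_top ENNReal.ofReal_ne_top hx.ne)
        (uGyh w hw0 x)
      have b2 := ENNReal.toReal_mono (ENNReal.mul_ne_top ENNReal.ofReal_ne_top hx.ne)
        (uGh' w hw0 x)
      rw [ENNReal.toReal_mul, ENNReal.toReal_ofReal (by positivity), toReal_enorm] at b1 b2
      calc _ ≤ ‖Gy x w * h x w‖ + ‖G x w * (h' x w * Complex.I)‖ := norm_add_le _ _
        _ ≤ 2 / w * (U x).toReal + 4 / w * (U x).toReal := by
            refine add_le_add b1 (le_trans (le_of_eq ?_) b2)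
            rw [← mul_assoc, norm_mul _ Complex.I, Complex.norm_I, mul_one]
        _ = 6 / w * (U x).toReal := by ring
        _ ≤ _ := by
            gcongr
            exact hball w hw
    · exact ae_of_all _ fun x w hw => (hGy x w (by linarith [hball w hw])).mul
        (hhy x w (by linarith [hball w hw]))
  have bJ' : ∀ y > 0, ‖J' y‖ₑ ≤ ∫⁻ x, k x y * N x := by
    intro y hy
    rw [hJ', enorm_mul]
    have : ‖-Complex.I‖ₑ = 1 := by rw [← ofReal_norm]; simp
    rw [this, one_mul]
    refine (enorm_integral_le_lintegral_enorm _).trans (lintegral_mono fun x => ?_)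
    rw [enorm_mul]
    exact mul_le_mul' (hk x y hy) (bh x y hy)
  -- A crude bound, only to make `J'` integrable on compact subintervals of (0, ∞), where `k` need
  -- not be known to be integrable.
  have bJ2 : ∀ y > 0, ‖J' y‖ ≤ (3 / y) * ∫ x, (U x).toReal := by
    intro y hy
    rw [hJ', norm_mul, norm_neg, Complex.norm_I, one_mul, ← integral_const_mul]
    refine norm_integral_le_of_norm_le (hUi.const_mul _) (ae_norm_le_toReal hUae (by positivity)
      fun x => ?_)
    rw [add_mul, mul_assoc]
    refine (enorm_add_le _ _).trans ?_
    have : ‖Complex.I * (Gy x y * h x y)‖ₑ = ‖Gy x y * h x y‖ₑ := by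
      rw [enorm_mul, ← ofReal_norm Complex.I]; simp
    rw [this]
    refine (add_le_add (uGxh y hy x) (uGyh y hy x)).trans (le_of_eq ?_)
    rw [← add_mul, ← ENNReal.ofReal_add (by positivity) (by positivity)]
    congr 2; ring
  have hdiff : ∀ a b : ℝ, 0 < a → a ≤ b → ‖J b - J a‖ₑ ≤
      ∫⁻ x, (∫⁻ y in Ioi (0 : ℝ), k x y) * N x := by
    intro a b ha hab
    have hFTC : ∫ y in a..b, J' y = J b - J a := by
      refine intervalIntegral.integral_eq_sub_of_hasDerivAt (fun y hy => ?_) ?_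
      · rw [uIcc_of_le hab] at hy
        exact hJd y (ha.trans_le hy.1)
      · rw [intervalIntegrable_iff_integrableOn_Ioc_of_le hab]
        refine Integrable.mono' (g := fun _ => (3 / a) * ∫ x, (U x).toReal)
          (integrable_const _) ?_ ?_
        · refine (measurable_deriv J).aestronglyMeasurable.congr ?_
          filter_upwards [ae_restrict_mem measurableSet_Ioc] with y hy
          exact (hJd y (ha.trans hy.1)).deriv
        · filter_upwards [ae_restrict_mem measurableSet_Ioc] with y hy
          refine (bJ2 y (ha.trans hy.1)).trans ?_
          have : 0 ≤ ∫ x, (U x).toReal := integral_nonneg fun x => ENNReal.toReal_nonneg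
          gcongr
          exact hy.1.le
    rw [← hFTC, intervalIntegral.integral_of_le hab]
    refine (enorm_integral_le_lintegral_enorm _).trans ?_
    calc _ ≤ ∫⁻ y in Ioc a b, ∫⁻ x, k x y * N x :=
          setLIntegral_mono' measurableSet_Ioc fun y hy => bJ' y (ha.trans hy.1)
      _ ≤ ∫⁻ y in Ioi (0 : ℝ), ∫⁻ x, k x y * N x :=
          lintegral_mono_set fun y hy => ha.trans hy.1
      _ = ∫⁻ x, ∫⁻ y in Ioi (0 : ℝ), k x y * N x := by
          rw [lintegral_lintegral_swap]
          refine Measurable.aemeasurable ?_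
          exact ((hkm.comp measurable_swap).mul (hNm.comp measurable_snd))
      _ = _ := by
          refine lintegral_congr fun x => ?_
          rw [lintegral_mul_const]
          exact hkm.comp measurable_prodMk_left
  have hdom : ∀ y > 0, ∀ᵐ x, ‖G x y * h x y‖ ≤ (U x).toReal := fun y hy => by
    simpa using ae_norm_le_toReal hUae zero_le_one (uGh y hy)
  have lim_top : Tendsto J atTop (𝓝 0) := by
    have := tendsto_integral_filter_of_dominated_convergence (μ := volume) (l := atTop)
      (F := fun y x : ℝ => G x y * h x y) (f := fun _ => 0) (fun x => (U x).toReal) ?_ ?_ hUi ?_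
    · simpa using this
    · filter_upwards [eventually_gt_atTop 0] with y hy using (iGh y hy).aestronglyMeasurable
    · filter_upwards [eventually_gt_atTop 0] with y hy using hdom y hy
    · refine ae_of_all _ fun x => tendsto_const_nhds.congr' ?_
      filter_upwards [hzero x] with y hy
      rw [hy, zero_mul]
  have lim_zero : Tendsto J (𝓝[>] 0) (𝓝 (∫ x, g x * cauchyPlus ψ x)) := by
    refine tendsto_integral_filter_of_dominated_convergence (μ := volume) (l := 𝓝[>] 0)
      (F := fun y x : ℝ => G x y * h x y) (fun x => (U x).toReal) ?_ ?_ hUi ?_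
    · filter_upwards [self_mem_nhdsWithin] with y hy using (iGh y hy).aestronglyMeasurable
    · filter_upwards [self_mem_nhdsWithin] with y hy using hdom y hy
    · filter_upwards [hlim] with x hx
      exact hx.mul (tendsto_cauchyInt ψ x)
  have step : ∀ a > 0, ‖J a‖ₑ ≤ ∫⁻ x, (∫⁻ y in Ioi (0 : ℝ), k x y) * N x := by
    intro a ha
    have h1 : Tendsto (fun b => ‖J b - J a‖ₑ) atTop (𝓝 ‖0 - J a‖ₑ) :=
      (continuous_enorm.tendsto _).comp (lim_top.sub_const (J a))
    rw [zero_sub, enorm_neg] at h1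
    refine le_of_tendsto h1 ?_
    filter_upwards [eventually_ge_atTop a] with b hb using hdiff a b ha hb
  refine le_of_tendsto ((continuous_enorm.tendsto _).comp lim_zero) ?_
  filter_upwards [self_mem_nhdsWithin] with a ha using step a ha

/-! ### Averages against smooth compactly supported kernels. -/

/-- Smooth kernels supported in `[-1, 1]`. -/
structure IsKer (k : ℝ → ℂ) : Prop where
  contDiff : ContDiff ℝ ∞ k
  eq_zero : ∀ u, 1 < |u| → k u = 0

namespace IsKer

variable {k : ℝ → ℂ}

theorem continuous (hk : IsKer k) : Continuous k := hk.contDiff.continuous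

theorem hasDerivAt (hk : IsKer k) (u : ℝ) : HasDerivAt k (deriv k u) u :=
  (hk.contDiff.differentiable (by simp) u).hasDerivAt

theorem deriv (hk : IsKer k) : IsKer (deriv k) := by
  refine ⟨(contDiff_infty_iff_deriv.1 hk.contDiff).2, fun u hu => ?_⟩
  have : k =ᶠ[𝓝 u] fun _ => 0 := by
    filter_upwards [(isOpen_lt continuous_const continuous_abs).mem_nhds hu] with v hv
      using hk.eq_zero v hv
  rw [this.deriv_eq]
  simp

theorem ofReal_mul (hk : IsKer k) : IsKer fun u => (u : ℂ) * k u :=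
  ⟨Complex.ofRealCLM.contDiff.mul hk.contDiff, fun u hu => by rw [hk.eq_zero u hu, mul_zero]⟩

theorem hasCompactSupport (hk : IsKer k) : HasCompactSupport k :=
  HasCompactSupport.intro (isCompact_closedBall (0 : ℝ) 1) fun u hu => hk.eq_zero u (by
    simpa [Real.dist_eq] using hu)

theorem integrable (hk : IsKer k) : Integrable k :=
  hk.continuous.integrable_of_hasCompactSupport hk.hasCompactSupport

theorem exists_bound (hk : IsKer k) : ∃ C : ℝ, 0 < C ∧ ∀ u, ‖k u‖ ≤ C := by
  obtain ⟨C, hC⟩ := hk.continuous.bounded_above_of_compact_support hk.hasCompactSupport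
  exact ⟨max C 1, by positivity, fun u => (hC u).trans (le_max_left _ _)⟩

theorem integral_deriv (hk : IsKer k) : ∫ u, _root_.deriv k u = 0 :=
  integral_eq_zero_of_hasDerivAt_of_integrable hk.hasDerivAt hk.deriv.integrable hk.integrable

end IsKer

/-- The average of `F` at the point `x` and the scale `y` against the kernel `k`. -/
noncomputable def kerAvg (k F : ℝ → ℂ) (x y : ℝ) : ℂ :=
  (y : ℂ)⁻¹ * ∫ s, k ((s - x) / y) * F s

theorem IsKer.eq_zero_of_notMem {k : ℝ → ℂ} (hk : IsKer k) {x y s : ℝ} (hy : 0 < y)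
    (hs : s ∉ Metric.closedBall x y) : k ((s - x) / y) = 0 := by
  apply hk.eq_zero
  rw [abs_div, abs_of_pos hy, lt_div_iff₀ hy, one_mul]
  simpa [Real.dist_eq] using hs

theorem kerAvg_eq_setIntegral {k : ℝ → ℂ} (hk : IsKer k) (F : ℝ → ℂ) {x y : ℝ} (hy : 0 < y)
    {S : Set ℝ} (hS : Metric.closedBall x y ⊆ S) :
    kerAvg k F x y = (y : ℂ)⁻¹ * ∫ s in S, k ((s - x) / y) * F s := by
  rw [kerAvg, setIntegral_eq_integral_of_forall_compl_eq_zero]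
  intro s hs
  rw [hk.eq_zero_of_notMem hy (fun h => hs (hS h)), zero_mul]

theorem IsKer.integrableOn_mul {k : ℝ → ℂ} (hk : IsKer k) {F : ℝ → ℂ} {S : Set ℝ}
    (hF : IntegrableOn F S) (x y : ℝ) : IntegrableOn (fun s => k ((s - x) / y) * F s) S := by
  obtain ⟨C, -, hC⟩ := hk.exists_bound
  refine Integrable.bdd_mul (c := C) hF ?_ (ae_of_all _ fun s => hC _)
  exact (hk.continuous.comp (by fun_prop)).aestronglyMeasurable

theorem IsKer.integrable_mul {k : ℝ → ℂ} (hk : IsKer k) {F : ℝ → ℂ} {x y : ℝ} (hy : 0 < y)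
    (hF : IntegrableOn F (Metric.closedBall x y)) :
    Integrable fun s => k ((s - x) / y) * F s :=
  (hk.integrableOn_mul hF x y).integrable_of_forall_notMem_eq_zero fun s hs => by
    rw [hk.eq_zero_of_notMem hy hs, zero_mul]

theorem closedBall_subset_of_dist {x x₀ y r : ℝ} (h : |x - x₀| + y ≤ r) :
    Metric.closedBall x y ⊆ Metric.closedBall x₀ r :=
  Metric.closedBall_subset_closedBall' (by rw [Real.dist_eq]; linarith)

/-- All derivatives fall on the kernel. The margin `y < r` lets one fixed ball contain the supports
for all nearby centres, so integrability of `F` on that ball is enough. -/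
theorem hasDerivAt_kerAvg_left {k : ℝ → ℂ} (hk : IsKer k) {F : ℝ → ℂ} {x y r : ℝ} (hy : 0 < y)
    (hr : y < r) (hF : IntegrableOn F (Metric.closedBall x r)) :
    HasDerivAt (fun x => kerAvg k F x y) (-(y : ℂ)⁻¹ * kerAvg (deriv k) F x y) x := by
  set S := Metric.closedBall x r
  obtain ⟨C, hC0, hC⟩ := hk.deriv.exists_bound
  have hsub : ∀ w ∈ Metric.ball x (r - y), Metric.closedBall w y ⊆ S := fun w hw =>
    closedBall_subset_of_dist (by
      have := Real.dist_eq w x ▸ Metric.mem_ball.1 hw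
      linarith)
  have key := (hasDerivAt_integral_of_dominated_loc_of_deriv_le
    (F := fun w s : ℝ => k ((s - w) / y) * F s)
    (F' := fun w s : ℝ => (-(y : ℂ)⁻¹) * (deriv k ((s - w) / y) * F s))
    (bound := fun s => y⁻¹ * (C * ‖F s‖)) (μ := volume.restrict S) (x₀ := x)
    (Metric.ball_mem_nhds x (by linarith : 0 < r - y)) ?_ (hk.integrableOn_mul hF x y) ?_ ?_
    ((hF.norm.const_mul C).const_mul _) ?_).2
  · rw [integral_const_mul] at key
    have h2 := key.const_mul ((y : ℂ)⁻¹)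
    have e : (y : ℂ)⁻¹ * (-(y : ℂ)⁻¹ * ∫ s in S, deriv k ((s - x) / y) * F s) =
        -(y : ℂ)⁻¹ * kerAvg (deriv k) F x y := by
      rw [kerAvg_eq_setIntegral hk.deriv F hy (hsub x (Metric.mem_ball_self (by linarith)))]
      ring
    rw [e] at h2
    refine h2.congr_of_eventuallyEq ?_
    filter_upwards [Metric.ball_mem_nhds x (by linarith : 0 < r - y)] with w hw
    exact kerAvg_eq_setIntegral hk F hy (hsub w hw)
  · exact Eventually.of_forall fun w => (hk.integrableOn_mul hF w y).aestronglyMeasurable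
  · exact ((hk.deriv.integrableOn_mul hF x y).const_mul _).aestronglyMeasurable
  · refine ae_of_all _ fun s w _ => ?_
    rw [norm_mul, norm_mul, norm_neg, norm_inv, Complex.norm_real, Real.norm_of_nonneg hy.le]
    gcongr
    exact hC _
  · refine ae_of_all _ fun s w _ => ?_
    have h1 : HasDerivAt (fun w : ℝ => (s - w) / y) (-1 / y) w :=
      ((hasDerivAt_id w).const_sub s).div_const y
    have h2 := ((hk.hasDerivAt ((s - w) / y)).scomp w h1).mul_const (F s)
    refine HasDerivAt.congr_deriv h2 ?_
    rw [Complex.real_smul]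
    push_cast
    ring

theorem deriv_ofReal_mul {k : ℝ → ℂ} (hk : IsKer k) (u : ℝ) :
    deriv (fun u : ℝ => (u : ℂ) * k u) u = k u + u * deriv k u := by
  have h1 : HasDerivAt (fun u : ℝ => (u : ℂ)) 1 u := Complex.ofRealCLM.hasDerivAt
  have h2 : HasDerivAt (fun u : ℝ => (u : ℂ) * k u) (1 * k u + u * deriv k u) u :=
    h1.mul (hk.hasDerivAt u)
  rw [h2.deriv, one_mul]

/-- With u = (s - x)/y, the derivative of y^{-1} k(u) in the scale y is -y^{-2} (u k(u))'. -/
theorem hasDerivAt_kerAvg_right {k : ℝ → ℂ} (hk : IsKer k) {F : ℝ → ℂ} {x y r : ℝ} (hy : 0 < y)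
    (hr : y < r) (hF : IntegrableOn F (Metric.closedBall x r)) :
    HasDerivAt (fun y => kerAvg k F x y)
      (-(y : ℂ)⁻¹ * kerAvg (deriv fun u : ℝ => (u : ℂ) * k u) F x y) y := by
  set S := Metric.closedBall x r
  set d : ℝ := min (r - y) (y / 2) with hd
  have hd0 : 0 < d := lt_min (by linarith) (by positivity)
  obtain ⟨C, hC0, hC⟩ := hk.deriv.ofReal_mul.exists_bound
  have hball : ∀ w ∈ Metric.ball y d, y / 2 ≤ w ∧ w ≤ r := fun w hw => by
    have h1 := abs_lt.1 (Real.dist_eq w y ▸ Metric.mem_ball.1 hw)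
    have h2 : d ≤ r - y := min_le_left _ _
    have h3 : d ≤ y / 2 := min_le_right _ _
    constructor <;> linarith
  have hsub : ∀ w ∈ Metric.ball y d, Metric.closedBall x w ⊆ S := fun w hw =>
    Metric.closedBall_subset_closedBall (hball w hw).2
  have key := (hasDerivAt_integral_of_dominated_loc_of_deriv_le
    (F := fun w s : ℝ => k ((s - x) / w) * F s)
    (F' := fun w s : ℝ => (-(w : ℂ)⁻¹) *
      ((((s - x) / w : ℝ) : ℂ) * deriv k ((s - x) / w) * F s))
    (bound := fun s => (y / 2)⁻¹ * (C * ‖F s‖)) (μ := volume.restrict S) (x₀ := y)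
    (Metric.ball_mem_nhds y hd0) ?_ (hk.integrableOn_mul hF x y) ?_ ?_
    ((hF.norm.const_mul C).const_mul _) ?_).2
  · rw [integral_const_mul] at key
    have hinv : HasDerivAt (fun w : ℝ => ((w : ℂ))⁻¹) (-((y : ℂ) ^ 2)⁻¹) y := by
      have h0 : HasDerivAt (fun w : ℝ => (w : ℂ)) 1 y := Complex.ofRealCLM.hasDerivAt
      have := h0.inv (by exact_mod_cast hy.ne')
      rwa [neg_div, one_div] at this
    have h2 := hinv.mul key
    have hyS := hsub y (Metric.mem_ball_self hd0)
    have e : -((y : ℂ) ^ 2)⁻¹ * (∫ s in S, k ((s - x) / y) * F s) +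
        (y : ℂ)⁻¹ * (-(y : ℂ)⁻¹ * ∫ s in S, (((s - x) / y : ℝ) : ℂ) *
          deriv k ((s - x) / y) * F s) =
        -(y : ℂ)⁻¹ * kerAvg (deriv fun u : ℝ => (u : ℂ) * k u) F x y := by
      rw [kerAvg_eq_setIntegral hk.ofReal_mul.deriv F hy hyS]
      simp_rw [deriv_ofReal_mul hk, add_mul]
      rw [integral_add (hk.integrableOn_mul hF x y) (hk.deriv.ofReal_mul.integrableOn_mul hF x y)]
      have hyc : (y : ℂ) ≠ 0 := by exact_mod_cast hy.ne'
      field_simp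
      ring
    rw [e] at h2
    refine h2.congr_of_eventuallyEq ?_
    filter_upwards [Metric.ball_mem_nhds y hd0] with w hw
    exact kerAvg_eq_setIntegral hk F (by linarith [(hball w hw).1]) (hsub w hw)
  · exact Eventually.of_forall fun w => (hk.integrableOn_mul hF x w).aestronglyMeasurable
  · exact ((hk.deriv.ofReal_mul.integrableOn_mul hF x y).const_mul _).aestronglyMeasurable
  · refine ae_of_all _ fun s w hw => ?_
    have hw1 := (hball w hw).1
    have hw0 : 0 < w := by linarith
    rw [norm_mul, norm_mul, norm_neg, norm_inv, Complex.norm_real, Real.norm_of_nonneg hw0.le]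
    gcongr
    exact hC _
  · refine ae_of_all _ fun s w hw => ?_
    have hw1 := (hball w hw).1
    have hw0 : w ≠ 0 := by linarith
    have h1 : HasDerivAt (fun w : ℝ => (s - x) / w) ((s - x) * (-(w ^ 2)⁻¹)) w := by
      simp_rw [div_eq_mul_inv]
      exact (hasDerivAt_inv hw0).const_mul (s - x)
    have h2 := ((hk.hasDerivAt ((s - x) / w)).scomp w h1).mul_const (F s)
    refine HasDerivAt.congr_deriv h2 ?_
    rw [Complex.real_smul]
    push_cast
    have hwc : (w : ℂ) ≠ 0 := by exact_mod_cast hw0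
    field_simp

theorem enorm_kerAvg_le {k : ℝ → ℂ} (hk : IsKer k) {C : ℝ} (hC : ∀ u, ‖k u‖ ≤ C) (F : ℝ → ℂ)
    (x : ℝ) {y : ℝ} (hy : 0 < y) : ‖kerAvg k F x y‖ₑ ≤
      ENNReal.ofReal (C / y) * ∫⁻ s in Metric.closedBall x y, ‖F s‖ₑ := by
  have hC0 : 0 ≤ C := (norm_nonneg _).trans (hC 0)
  rw [kerAvg_eq_setIntegral hk F hy Subset.rfl, enorm_mul]
  have h1 : ‖(y : ℂ)⁻¹‖ₑ = ENNReal.ofReal (1 / y) := by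
    rw [← ofReal_norm, norm_inv, Complex.norm_real, Real.norm_of_nonneg hy.le, one_div]
  have h2 : ENNReal.ofReal (C / y) = ENNReal.ofReal (1 / y) * ENNReal.ofReal C := by
    rw [← ENNReal.ofReal_mul (by positivity)]; congr 1; ring
  rw [h1, h2, mul_assoc, ← lintegral_const_mul' _ _ ENNReal.ofReal_ne_top]
  refine mul_le_mul_right ((enorm_integral_le_lintegral_enorm _).trans
    (lintegral_mono fun s => ?_)) _
  rw [enorm_mul]
  gcongr
  rw [← ofReal_norm]
  exact ENNReal.ofReal_le_ofReal (hC _)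

/-- A pointwise bound for averages of bounded functions. -/
theorem norm_kerAvg_le {k : ℝ → ℂ} (hk : IsKer k) {C : ℝ} (hC : ∀ u, ‖k u‖ ≤ C) {F : ℝ → ℂ}
    {x y M : ℝ} (hy : 0 < y) (hM : ∀ s ∈ Metric.closedBall x y, ‖F s‖ ≤ M) :
    ‖kerAvg k F x y‖ ≤ 2 * C * M := by
  have hC0 : 0 ≤ C := (norm_nonneg _).trans (hC 0)
  have hM0 : 0 ≤ M := (norm_nonneg _).trans (hM x (Metric.mem_closedBall_self hy.le))
  rw [kerAvg_eq_setIntegral hk F hy Subset.rfl, norm_mul, norm_inv, Complex.norm_real,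
    Real.norm_of_nonneg hy.le]
  have h1 : ‖∫ s in Metric.closedBall x y, k ((s - x) / y) * F s‖ ≤
      C * M * volume.real (Metric.closedBall x y) := by
    refine norm_setIntegral_le_of_norm_le_const measure_closedBall_lt_top fun s hs => ?_
    rw [norm_mul]
    exact mul_le_mul (hC _) (hM s hs) (norm_nonneg _) hC0
  rw [Real.volume_real_closedBall hy.le] at h1
  calc _ ≤ y⁻¹ * (C * M * (2 * y)) := by gcongr
    _ = _ := by field_simp

theorem kerAvg_const (k : ℝ → ℂ) (c : ℂ) (x : ℝ) {y : ℝ} (hy : 0 < y) :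
    kerAvg k (fun _ => c) x y = (∫ u, k u) * c := by
  have hyc : (y : ℂ) ≠ 0 := by exact_mod_cast hy.ne'
  have h1 : ∫ s, k ((s - x) / y) = y * ∫ u, k u := by
    rw [integral_sub_right_eq_self (fun s => k (s / y)) x, Measure.integral_comp_div k y,
      abs_of_pos hy, Complex.real_smul]
  rw [kerAvg, integral_mul_const, h1]
  field_simp

theorem kerAvg_sub {k : ℝ → ℂ} (hk : IsKer k) {F G : ℝ → ℂ} {x y : ℝ} (hy : 0 < y)
    (hF : IntegrableOn F (Metric.closedBall x y)) (hG : IntegrableOn G (Metric.closedBall x y)) :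
    kerAvg k (fun s => F s - G s) x y = kerAvg k F x y - kerAvg k G x y := by
  simp only [kerAvg, mul_sub]
  rw [integral_sub (hk.integrable_mul hy hF) (hk.integrable_mul hy hG), mul_sub]

theorem integrableOn_const_closedBall (c : ℂ) (x y : ℝ) :
    IntegrableOn (fun _ => c) (Metric.closedBall x y) :=
  integrableOn_const measure_closedBall_lt_top.ne

theorem kerAvg_sub_const {k : ℝ → ℂ} (hk : IsKer k) {F : ℝ → ℂ} (c : ℂ) {x y : ℝ} (hy : 0 < y)
    (hF : IntegrableOn F (Metric.closedBall x y)) :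
    kerAvg k (fun s => F s - c) x y = kerAvg k F x y - (∫ u, k u) * c := by
  rw [kerAvg_sub hk hy hF (integrableOn_const_closedBall c x y), kerAvg_const k c x hy]

theorem kerAvg_sub_self (k : ℝ → ℂ) (x : ℝ) {y : ℝ} (hy : 0 < y) :
    kerAvg k (fun s => ((s - x : ℝ) : ℂ)) x y = y * ∫ u : ℝ, (u : ℂ) * k u := by
  have hyc : (y : ℂ) ≠ 0 := by exact_mod_cast hy.ne'
  have h1 := kerAvg_const (fun u : ℝ => (u : ℂ) * k u) (y : ℂ) x hy
  rw [mul_comm (y : ℂ), ← h1, kerAvg, kerAvg]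
  congr 2
  funext s
  push_cast
  field_simp

theorem kerAvg_const_mul_left (a : ℂ) (k F : ℝ → ℂ) (x y : ℝ) :
    kerAvg (fun u => a * k u) F x y = a * kerAvg k F x y := by
  simp only [kerAvg, mul_assoc]
  rw [integral_const_mul]
  ring

theorem kerAvg_add_left {k l : ℝ → ℂ} (hk : IsKer k) (hl : IsKer l) {F : ℝ → ℂ} {x y : ℝ}
    (hy : 0 < y) (hF : IntegrableOn F (Metric.closedBall x y)) :
    kerAvg (fun u => k u + l u) F x y = kerAvg k F x y + kerAvg l F x y := by
  simp only [kerAvg, add_mul]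
  rw [integral_add (hk.integrable_mul hy hF) (hl.integrable_mul hy hF), mul_add]

/-- Integration by parts in an average. -/
theorem kerAvg_deriv {k : ℝ → ℂ} (hk : IsKer k) {F F' : ℝ → ℂ} {x y : ℝ} (hy : 0 < y)
    (hF : ∀ s ∈ Metric.closedBall x y, HasDerivAt F (F' s) s)
    (hF' : ContinuousOn F' (Metric.closedBall x y)) :
    kerAvg (deriv k) F x y = -(y : ℂ) * kerAvg k F' x y := by
  have hyc : (y : ℂ) ≠ 0 := by exact_mod_cast hy.ne'
  have hFc : ContinuousOn F (Metric.closedBall x y) := fun s hs =>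
    (hF s hs).continuousAt.continuousWithinAt
  have iF := hFc.integrableOn_compact (μ := volume) (isCompact_closedBall x y)
  have iF' := hF'.integrableOn_compact (μ := volume) (isCompact_closedBall x y)
  set v : ℝ → ℂ := fun s => k ((s - x) / y) with hv
  have hvd : ∀ s, HasDerivAt v ((y : ℂ)⁻¹ * deriv k ((s - x) / y)) s := by
    intro s
    have h1 : HasDerivAt (fun s : ℝ => (s - x) / y) (1 / y) s :=
      ((hasDerivAt_id s).sub_const x).div_const y
    have h2 := (hk.hasDerivAt ((s - x) / y)).scomp s h1
    rw [Complex.real_smul] at h2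
    refine HasDerivAt.congr_deriv h2 ?_
    push_cast
    rw [one_div]
  have hsupp : tsupport v ⊆ Metric.closedBall x y :=
    closure_minimal (fun s hs => by
      by_contra h
      exact hs (hk.eq_zero_of_notMem hy h)) Metric.isClosed_closedBall
  have h1 := integral_mul_deriv_eq_deriv_mul_of_integrable (u := F) (v := v) (u' := F')
    (v' := fun s => (y : ℂ)⁻¹ * deriv k ((s - x) / y))
    (fun s hs => hF s (hsupp hs)) (fun s _ => hvd s) ?_ ?_ ?_
  · have e1 : kerAvg (deriv k) F x y = ∫ s, F s * ((y : ℂ)⁻¹ * deriv k ((s - x) / y)) := by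
      rw [kerAvg, ← integral_const_mul]
      congr 1; funext s; ring
    rw [e1, h1, kerAvg]
    have e2 : ∫ s, F' s * v s = ∫ s, k ((s - x) / y) * F' s := by
      congr 1; funext s; rw [hv, mul_comm]
    rw [e2]
    field_simp
  · refine ((hk.deriv.integrable_mul hy iF).const_mul (y : ℂ)⁻¹).congr (ae_of_all _ fun s => ?_)
    simp only [Pi.mul_apply]; ring
  · refine (hk.integrable_mul hy iF').congr (ae_of_all _ fun s => ?_)
    simp only [Pi.mul_apply, hv]; ring
  · refine (hk.integrable_mul hy iF).congr (ae_of_all _ fun s => ?_)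
    simp only [Pi.mul_apply, hv]; ring

/-! ### Kernels for almost analytic extension. -/

/-- The `n`-th derivative of a real kernel, as a complex kernel. -/
noncomputable def derivKer (ζ : ℝ → ℝ) (n : ℕ) (u : ℝ) : ℂ := (iteratedDeriv n ζ u : ℝ)

theorem isKer_ofReal_contDiff {ζ : ℝ → ℝ} (hζ : ContDiff ℝ ∞ ζ) (h0 : ∀ u, 1 < |u| → ζ u = 0) :
    IsKer fun u => (ζ u : ℂ) :=
  ⟨Complex.ofRealCLM.contDiff.comp hζ, fun u hu => by rw [h0 u hu, Complex.ofReal_zero]⟩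

theorem hasDerivAt_derivKer {ζ : ℝ → ℝ} (hζ : ContDiff ℝ ∞ ζ) (n : ℕ) (u : ℝ) :
    HasDerivAt (derivKer ζ n) (derivKer ζ (n + 1) u) u := by
  have h1 : HasDerivAt (iteratedDeriv n ζ) (iteratedDeriv (n + 1) ζ u) u := by
    rw [iteratedDeriv_succ]
    exact ((hζ.differentiable_iteratedDeriv n (by exact_mod_cast WithTop.coe_lt_top _)) u).hasDerivAt
  exact h1.ofReal_comp

theorem deriv_derivKer {ζ : ℝ → ℝ} (hζ : ContDiff ℝ ∞ ζ) (n : ℕ) :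
    deriv (derivKer ζ n) = derivKer ζ (n + 1) :=
  funext fun u => (hasDerivAt_derivKer hζ n u).deriv

theorem isKer_derivKer {ζ : ℝ → ℝ} (hζ : ContDiff ℝ ∞ ζ) (h0 : ∀ u, 1 < |u| → ζ u = 0) (n : ℕ) :
    IsKer (derivKer ζ n) := by
  induction n with
  | zero =>
    have : derivKer ζ 0 = fun u => (ζ u : ℂ) := by funext u; simp [derivKer]
    rw [this]
    exact isKer_ofReal_contDiff hζ h0
  | succ n ih => rw [← deriv_derivKer hζ]; exact ih.deriv

theorem integral_derivKer_succ {ζ : ℝ → ℝ} (hζ : ContDiff ℝ ∞ ζ)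
    (h0 : ∀ u, 1 < |u| → ζ u = 0) (n : ℕ) : ∫ u, derivKer ζ (n + 1) u = 0 := by
  rw [← deriv_derivKer hζ]
  exact (isKer_derivKer hζ h0 n).integral_deriv

theorem one_add_ofReal_mul_I_ne_zero (u : ℝ) : (1 : ℂ) + u * Complex.I ≠ 0 := fun h => by
  simpa using congrArg Complex.re h

theorem contDiff_inv_one_add_pow (m : ℕ) :
    ContDiff ℝ ∞ fun u : ℝ => ((1 + (u : ℂ) * Complex.I) ^ m)⁻¹ := by
  refine ContDiff.inv ?_ fun u => pow_ne_zero _ (one_add_ofReal_mul_I_ne_zero u)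
  exact (contDiff_const.add (Complex.ofRealCLM.contDiff.mul contDiff_const)).pow m

theorem IsKer.mul_inv_pow {k : ℝ → ℂ} (hk : IsKer k) (m : ℕ) :
    IsKer fun u => k u * ((1 + (u : ℂ) * Complex.I) ^ m)⁻¹ :=
  ⟨hk.contDiff.mul (contDiff_inv_one_add_pow m), fun u hu => by rw [hk.eq_zero u hu, zero_mul]⟩

theorem hasDerivAt_inv_one_add_pow (m : ℕ) (u : ℝ) :
    HasDerivAt (fun u : ℝ => ((1 + (u : ℂ) * Complex.I) ^ m)⁻¹)
      (-(m * Complex.I) * ((1 + (u : ℂ) * Complex.I) ^ (m + 1))⁻¹) u := by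
  have h0 := one_add_ofReal_mul_I_ne_zero u
  have h1 : HasDerivAt (fun u : ℝ => 1 + (u : ℂ) * Complex.I) Complex.I u := by
    have : HasDerivAt (fun u : ℝ => (u : ℂ)) 1 u := Complex.ofRealCLM.hasDerivAt
    simpa using (this.mul_const Complex.I).const_add 1
  refine ((h1.pow m).inv (pow_ne_zero _ h0)).congr_deriv ?_
  rcases m with _ | m
  · simp
  · simp only [Nat.add_sub_cancel, Pi.pow_apply]
    field_simp
    ring

theorem integral_deriv_mul_inv_pow {k : ℝ → ℂ} (hk : IsKer k) (m : ℕ) :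
    ∫ u, deriv k u * ((1 + (u : ℂ) * Complex.I) ^ m)⁻¹ =
      m * Complex.I * ∫ u, k u * ((1 + (u : ℂ) * Complex.I) ^ (m + 1))⁻¹ := by
  have h1 := integral_eq_zero_of_hasDerivAt_of_integrable
    (f := fun u => k u * ((1 + (u : ℂ) * Complex.I) ^ m)⁻¹)
    (fun u => (hk.hasDerivAt u).mul (hasDerivAt_inv_one_add_pow m u)) ?_
    (hk.mul_inv_pow m).integrable
  · rw [integral_add (hk.deriv.mul_inv_pow m).integrable] at h1
    · rw [eq_neg_of_add_eq_zero_left h1, ← integral_const_mul, ← integral_neg]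
      congr 1; funext u; ring
    · refine ((hk.mul_inv_pow (m + 1)).integrable.const_mul (-(m * Complex.I))).congr
        (ae_of_all _ fun u => ?_)
      simp only; ring
  · refine (hk.deriv.mul_inv_pow m).integrable.add
      (((hk.mul_inv_pow (m + 1)).integrable.const_mul (-(m * Complex.I))).congr
        (ae_of_all _ fun u => ?_))
    simp only; ring

/-- Each integration by parts raises the power of (1 + iu)^{-1} by one and produces a nonzero
factor. So the normalising integral of an extension kernel is nonzero as soon as ζ itself has
nonzero integral against a power of (1 + iu)^{-1}. -/
theorem integral_derivKer_mul_inv_pow {ζ : ℝ → ℝ} (hζ : ContDiff ℝ ∞ ζ)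
    (h0 : ∀ u, 1 < |u| → ζ u = 0) (K m : ℕ) :
    ∃ c : ℂ, c ≠ 0 ∧ ∫ u, derivKer ζ K u * ((1 + (u : ℂ) * Complex.I) ^ (m + 1))⁻¹ =
      c * ∫ u, (ζ u : ℂ) * ((1 + (u : ℂ) * Complex.I) ^ (m + 1 + K))⁻¹ := by
  induction K generalizing m with
  | zero => exact ⟨1, one_ne_zero, by simp [derivKer]⟩
  | succ K ih =>
    obtain ⟨c, hc, h⟩ := ih (m + 1)
    refine ⟨((m + 1 : ℕ) : ℂ) * Complex.I * c, ?_, ?_⟩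
    · exact mul_ne_zero (mul_ne_zero (by exact_mod_cast m.succ_ne_zero) Complex.I_ne_zero) hc
    · rw [← deriv_derivKer hζ, integral_deriv_mul_inv_pow (isKer_derivKer hζ h0 K), h,
        show m + 1 + (K + 1) = m + 1 + 1 + K by ring]
      ring

/-- Near u = 0 the power is close to 1, so its real part is positive; a bump supported there has an
integral of positive real part. -/
theorem exists_bump_integral_ne_zero (n : ℕ) : ∃ ζ : ℝ → ℝ, ContDiff ℝ ∞ ζ ∧
    (∀ u, 1 < |u| → ζ u = 0) ∧ ∫ u, (ζ u : ℂ) * ((1 + (u : ℂ) * Complex.I) ^ n)⁻¹ ≠ 0 := by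
  have hcont : Continuous fun u : ℝ => (((1 + (u : ℂ) * Complex.I) ^ n)⁻¹).re :=
    Complex.continuous_re.comp (contDiff_inv_one_add_pow n).continuous
  have hpos : ∀ᶠ u : ℝ in 𝓝 0, 0 < (((1 + (u : ℂ) * Complex.I) ^ n)⁻¹).re :=
    hcont.continuousAt.eventually (lt_mem_nhds (by simp))
  obtain ⟨ε, hε, hball⟩ := Metric.eventually_nhds_iff.1 hpos
  let b : ContDiffBump (0 : ℝ) := ⟨min ε 1 / 2, min ε 1, by positivity, by
    have : 0 < min ε 1 := by positivity
    linarith⟩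
  have hsm : ContDiff ℝ ∞ b := b.contDiff
  have hz : ∀ u, min ε 1 ≤ |u| → b u = 0 := fun u hu => b.zero_of_le_dist (by
    change min ε 1 ≤ dist u 0
    rwa [Real.dist_eq, sub_zero])
  have h0 : ∀ u, 1 < |u| → b u = 0 := fun u hu => hz u ((min_le_right _ _).trans hu.le)
  refine ⟨b, hsm, h0, fun h => ?_⟩
  have hk := (isKer_ofReal_contDiff hsm h0).mul_inv_pow n
  have hre := congrArg Complex.re h
  have h2 : (∫ u, (b u : ℂ) * ((1 + (u : ℂ) * Complex.I) ^ n)⁻¹).re =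
      ∫ u, b u * (((1 + (u : ℂ) * Complex.I) ^ n)⁻¹).re := by
    have := integral_re hk.integrable
    simp only [RCLike.re_eq_complex_re, Complex.re_ofReal_mul] at this
    exact this.symm
  rw [h2, Complex.zero_re] at hre
  refine absurd hre (ne_of_gt ?_)
  refine Continuous.integral_pos_of_hasCompactSupport_nonneg_nonzero (x := 0)
    (hsm.continuous.mul hcont) ?_ ?_ ?_
  · exact b.hasCompactSupport.mul_right
  · intro u
    by_cases hu : min ε 1 ≤ |u|
    · simp [hz u hu]
    · refine mul_nonneg b.nonneg (hball ?_).le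
      rw [Real.dist_eq, sub_zero]
      exact (not_le.1 hu).trans_le (min_le_left _ _)
  · have : b (0 : ℝ) = 1 := b.one_of_mem_closedBall (by
      simpa using b.rIn_pos.le)
    simp [this]

/-- Averaging kernels `η` for almost analytic extensions of order `K`. -/
structure IsExtensionKer (K : ℕ) (η : ℝ → ℂ) (ζ : ℝ → ℝ) (a : ℂ) : Prop where
  contDiff : ContDiff ℝ ∞ ζ
  eq_zero : ∀ u, 1 < |u| → ζ u = 0
  isKer : IsKer η
  integral_eq : ∫ u, η u = 1
  integral_mul_eq : ∫ u : ℝ, (u : ℂ) * η u = Complex.I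
  deriv_add : ∀ u, deriv η u + Complex.I * deriv (fun u : ℝ => (u : ℂ) * η u) u =
    a * derivKer ζ (K + 1) u

/-- The kernel η solves (1 + iu)η = J⁻¹ ζ^{(K)}, with J chosen to give η mass one. For K ≥ 1 the
right-hand side has integral zero, which forces the first moment of η to be i; differentiating the
equation gives the identity for ∂x + i∂y. Mass one and first moment i mean that an average of an
affine function is its value at x + iy. -/
theorem exists_isExtensionKer {K : ℕ} (hK : 1 ≤ K) : ∃ η ζ a, IsExtensionKer K η ζ a := by
  obtain ⟨ζ, hζ, h0, hne⟩ := exists_bump_integral_ne_zero (0 + 1 + K)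
  obtain ⟨c, hc, hcK⟩ := integral_derivKer_mul_inv_pow hζ h0 K 0
  set J := ∫ u, derivKer ζ K u * ((1 + (u : ℂ) * Complex.I) ^ (0 + 1))⁻¹ with hJ
  have hJ0 : J ≠ 0 := by rw [hcK]; exact mul_ne_zero hc hne
  have hkK := isKer_derivKer hζ h0 K
  set η : ℝ → ℂ := fun u => J⁻¹ * (derivKer ζ K u * ((1 + (u : ℂ) * Complex.I) ^ (0 + 1))⁻¹)
    with hη
  have hker : IsKer η := ⟨contDiff_const.mul (hkK.mul_inv_pow _).contDiff, fun u hu => by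
    rw [hη]; simp only; rw [hkK.eq_zero u hu]; simp⟩
  have hid : ∀ u : ℝ, η u + Complex.I * ((u : ℂ) * η u) = J⁻¹ * derivKer ζ K u := by
    intro u
    have := one_add_ofReal_mul_I_ne_zero u
    simp only [hη, zero_add, pow_one]
    field_simp
  have hint1 : ∫ u, η u = 1 := by
    rw [hη, integral_const_mul, ← hJ, inv_mul_cancel₀ hJ0]
  refine ⟨η, ζ, J⁻¹, hζ, h0, hker, hint1, ?_, ?_⟩
  · have h1 : ∫ u : ℝ, (η u + Complex.I * ((u : ℂ) * η u)) = 0 := by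
      simp_rw [hid]
      rw [integral_const_mul]
      obtain ⟨K', rfl⟩ := Nat.exists_eq_add_of_le' hK
      rw [integral_derivKer_succ hζ h0, mul_zero]
    rw [integral_add hker.integrable (hker.ofReal_mul.integrable.const_mul _), hint1,
      integral_const_mul] at h1
    linear_combination (-Complex.I) * h1 +
      (∫ u : ℝ, (u : ℂ) * η u) * Complex.I_mul_I
  · intro u
    have h1 := (hker.hasDerivAt u).add ((hker.ofReal_mul.hasDerivAt u).const_mul Complex.I)
    have h2 := (hasDerivAt_derivKer hζ K u).const_mul J⁻¹
    refine HasDerivAt.unique h1 (h2.congr_of_eventuallyEq (Eventually.of_forall fun v => ?_))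
    exact hid v

section

variable {K : ℕ} {η : ℝ → ℂ} {ζ : ℝ → ℝ} {a : ℂ}

/-- The `∂x + i ∂y` derivative of an average against an extension kernel. -/
theorem IsExtensionKer.dbar_eq (h : IsExtensionKer K η ζ a) {F : ℝ → ℂ} {x y : ℝ} (hy : 0 < y)
    (hF : IntegrableOn F (Metric.closedBall x y)) :
    -(y : ℂ)⁻¹ * kerAvg (deriv η) F x y +
      Complex.I * (-(y : ℂ)⁻¹ * kerAvg (deriv fun u : ℝ => (u : ℂ) * η u) F x y) =
      -(y : ℂ)⁻¹ * (a * kerAvg (derivKer ζ (K + 1)) F x y) := by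
  have hI : IsKer fun u => Complex.I * deriv (fun u : ℝ => (u : ℂ) * η u) u :=
    ⟨contDiff_const.mul h.isKer.ofReal_mul.deriv.contDiff, fun u hu => by
      rw [h.isKer.ofReal_mul.deriv.eq_zero u hu, mul_zero]⟩
  rw [← kerAvg_const_mul_left a, ← funext h.deriv_add, kerAvg_add_left h.isKer.deriv hI hy hF,
    kerAvg_const_mul_left]
  ring

end

/-! ### Moving derivatives from the kernel to the averaged function. -/

/-- Iterated integration by parts in an average. -/
theorem kerAvg_derivKer_add {ζ : ℝ → ℝ} (hζ : ContDiff ℝ ∞ ζ) (h0 : ∀ u, 1 < |u| → ζ u = 0)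
    (m n : ℕ) {Φ : ℕ → ℝ → ℂ} {x y : ℝ} (hy : 0 < y)
    (hΦ : ∀ l < n, ∀ s ∈ Metric.closedBall x y, HasDerivAt (Φ l) (Φ (l + 1) s) s)
    (hΦc : ∀ l < n, ContinuousOn (Φ (l + 1)) (Metric.closedBall x y)) :
    kerAvg (derivKer ζ (m + n)) (Φ 0) x y = (-(y : ℂ)) ^ n * kerAvg (derivKer ζ m) (Φ n) x y := by
  induction n generalizing m with
  | zero => simp
  | succ n ih =>
    have h1 := ih (m + 1) (fun l hl => hΦ l (by omega)) (fun l hl => hΦc l (by omega))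
    rw [show m + (n + 1) = m + 1 + n by ring, h1, ← deriv_derivKer hζ m,
      kerAvg_deriv (isKer_derivKer hζ h0 m) hy (hΦ n (by omega)) (hΦc n (by omega))]
    ring

theorem iteratedDeriv_comp_sub_div (ψ : ℝ → ℝ) (hψ : ContDiff ℝ ∞ ψ) (j : ℕ) (x y : ℝ) :
    iteratedDeriv j (fun s => ψ ((s - x) / y)) = fun s => y⁻¹ ^ j * iteratedDeriv j ψ ((s - x) / y) := by
  induction j with
  | zero => simp
  | succ j ih =>
    funext s
    rw [iteratedDeriv_succ, ih]
    have h1 : HasDerivAt (fun s : ℝ => (s - x) / y) (1 / y) s :=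
      ((hasDerivAt_id s).sub_const x).div_const y
    have h2 : HasDerivAt (iteratedDeriv j ψ) (iteratedDeriv (j + 1) ψ ((s - x) / y))
        ((s - x) / y) := by
      rw [iteratedDeriv_succ]
      exact ((hψ.differentiable_iteratedDeriv j (by exact_mod_cast WithTop.coe_lt_top _)) _).hasDerivAt
    refine (((h2.comp s h1).const_mul (y⁻¹ ^ j)).congr_deriv ?_).deriv
    rw [one_div]; ring

/-- Integration by parts in an average, for weak derivatives. -/
theorem IsWeakDeriv.kerAvg_derivKer_add {Ω : Set ℝ} {j : ℕ} {F g : ℝ → ℂ}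
    (hFg : IsWeakDeriv Ω j F g) {ζ : ℝ → ℝ} (hζ : ContDiff ℝ ∞ ζ)
    (h0 : ∀ u, 1 < |u| → ζ u = 0) (m : ℕ) {x y : ℝ} (hy : 0 < y)
    (hΩ : Metric.closedBall x y ⊆ Ω) :
    kerAvg (derivKer ζ (m + j)) F x y = (-(y : ℂ)) ^ j * kerAvg (derivKer ζ m) g x y := by
  have hyc : (y : ℂ) ≠ 0 := by exact_mod_cast hy.ne'
  have hm : ContDiff ℝ ∞ (iteratedDeriv m ζ) := by
    rw [iteratedDeriv_eq_iterate]
    exact hζ.iterate_deriv m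
  have hz : ∀ s ∉ Metric.closedBall x y, iteratedDeriv m ζ ((s - x) / y) = 0 := fun s hs => by
    have := (isKer_derivKer hζ h0 m).eq_zero_of_notMem hy hs
    exact Complex.ofReal_eq_zero.1 this
  have key := hFg.integral_eq (fun s => iteratedDeriv m ζ ((s - x) / y))
    (hm.comp (by fun_prop)) (HasCompactSupport.intro (isCompact_closedBall x y) hz)
    ((closure_minimal (fun s hs => by
      by_contra h
      exact hs (hz s h)) Metric.isClosed_closedBall).trans hΩ)
  rw [iteratedDeriv_comp_sub_div _ hm] at key
  have e1 : ∀ s, iteratedDeriv j (iteratedDeriv m ζ) s = iteratedDeriv (m + j) ζ s := fun s => by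
    rw [iteratedDeriv_eq_iterate, iteratedDeriv_eq_iterate, iteratedDeriv_eq_iterate,
      ← Function.iterate_add_apply, add_comm]
  simp only [e1, Complex.real_smul, Complex.ofReal_mul, mul_assoc] at key
  rw [integral_const_mul] at key
  simp only [kerAvg, derivKer]
  push_cast at key
  have e2 : ∫ s, ((iteratedDeriv (m + j) ζ ((s - x) / y) : ℝ) : ℂ) * F s =
      (y : ℂ) ^ j * ((-1) ^ j * ∫ s, ((iteratedDeriv m ζ ((s - x) / y) : ℝ) : ℂ) * g s) := by
    rw [← key, ← mul_assoc, ← mul_pow, mul_inv_cancel₀ hyc, one_pow, one_mul]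
  rw [e2, neg_pow (y : ℂ) j]
  ring

/-! ### Consequences of admissibility. -/

theorem IsOpen.exists_mem_frontier_uIcc {Ω : Set ℝ} (hΩ : IsOpen Ω) {x y : ℝ} (hx : x ∈ Ω)
    (hy : y ∉ Ω) : ∃ z ∈ frontier Ω, |z - x| ≤ |y - x| := by
  by_contra! H
  have hdis : ∀ z ∈ uIcc x y, z ∉ frontier Ω := fun z hz hf =>
    (abs_sub_left_of_mem_uIcc hz).not_gt (H z hf)
  rw [hΩ.frontier_eq] at hdis
  have hy' : y ∈ (closure Ω)ᶜ := fun h => hdis y right_mem_uIcc ⟨h, hy⟩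
  obtain ⟨z, -, hz1, hz2⟩ := isPreconnected_uIcc Ω (closure Ω)ᶜ hΩ isClosed_closure.isOpen_compl
    (fun z hz => by
      by_cases hzc : z ∈ closure Ω
      · by_cases hzΩ : z ∈ Ω
        · exact Or.inl hzΩ
        · exact absurd ⟨hzc, hzΩ⟩ (hdis z hz)
      · exact Or.inr hzc) ⟨x, left_mem_uIcc, hx⟩ ⟨y, right_mem_uIcc, hy'⟩
  exact hz2 (subset_closure hz1)

namespace IsAdmissible

variable {κ : ℕ} {α A c : ℝ} {Ω : Set ℝ} {φ ℓ : ℝ → ℝ}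

theorem indicator_nonneg (h : IsAdmissible κ α A c Ω φ ℓ) (x : ℝ) : 0 ≤ Ω.indicator ℓ x :=
  Set.indicator_nonneg h.nonneg x

/-- A frontier point lies between `x` and `y`; there ℓ vanishes, and ℓ is 1-Lipschitz. Hence ℓ is at
most the distance to the complement of `Ω`: averages at scales below ℓ stay inside `Ω`, and the
extension of ℓ by zero is 1-Lipschitz on the whole line. -/
theorem indicator_le_of_notMem (h : IsAdmissible κ α A c Ω φ ℓ) (hΩ : IsOpen Ω) (x : ℝ) {y : ℝ}
    (hy : y ∉ Ω) : Ω.indicator ℓ x ≤ |y - x| := by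
  by_cases hx : x ∈ Ω
  · obtain ⟨z, hz, hzx⟩ := hΩ.exists_mem_frontier_uIcc hx hy
    have h1 := h.lipschitz x (subset_closure hx) z (frontier_subset_closure hz)
    rw [h.eq_zero_of_frontier z hz, sub_zero, abs_sub_comm] at h1
    rw [indicator_of_mem hx]
    exact (le_abs_self _).trans (h1.trans hzx)
  · rw [indicator_of_notMem hx]; positivity

theorem indicator_le_add (h : IsAdmissible κ α A c Ω φ ℓ) (hΩ : IsOpen Ω) (x y : ℝ) :
    Ω.indicator ℓ x ≤ Ω.indicator ℓ y + |y - x| := by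
  by_cases hy : y ∈ Ω
  · by_cases hx : x ∈ Ω
    · have h1 := h.lipschitz x (subset_closure hx) y (subset_closure hy)
      rw [indicator_of_mem hx, indicator_of_mem hy, abs_sub_comm y x]
      linarith [le_abs_self (ℓ x - ℓ y)]
    · rw [indicator_of_notMem hx]
      have := h.indicator_nonneg y
      positivity
  · have := h.indicator_nonneg y
    linarith [h.indicator_le_of_notMem hΩ x hy]

theorem abs_indicator_sub_le (h : IsAdmissible κ α A c Ω φ ℓ) (hΩ : IsOpen Ω) (x y : ℝ) :
    |Ω.indicator ℓ x - Ω.indicator ℓ y| ≤ |x - y| := by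
  rw [abs_le]
  have h1 := h.indicator_le_add hΩ x y
  have h2 := h.indicator_le_add hΩ y x
  rw [abs_sub_comm] at h1
  constructor <;> linarith

theorem closedBall_subset (h : IsAdmissible κ α A c Ω φ ℓ) (hΩ : IsOpen Ω) {x y : ℝ}
    (hy : y < Ω.indicator ℓ x) : Metric.closedBall x y ⊆ Ω := fun s hs => by
  by_contra hsΩ
  have h1 := h.indicator_le_of_notMem hΩ x hsΩ
  rw [Metric.mem_closedBall, Real.dist_eq] at hs
  linarith

/-- This allows `A`, which is an arbitrary real number, to be replaced by a positive one. -/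
theorem mono (h : IsAdmissible κ α A c Ω φ ℓ) (hφ : ∀ x ∈ Ω, 0 < deriv φ x) {A' : ℝ}
    (hA : A ≤ A') : IsAdmissible κ α A' c Ω φ ℓ where
  nonneg := h.nonneg
  eq_zero_of_frontier := h.eq_zero_of_frontier
  lipschitz := h.lipschitz
  deriv_bound x hx j h1 h2 := (h.deriv_bound x hx j h1 h2).trans
    (mul_le_mul_of_nonneg_right hA (hφ x hx).le)
  holder_bound x hx y hy hxy := (h.holder_bound x hx y hy hxy).trans
    (mul_le_mul_of_nonneg_right (mul_le_mul_of_nonneg_right hA (hφ x hx).le) (by positivity))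

end IsAdmissible

namespace IsPhase

variable {κ : ℕ} {α : ℝ} {Ω : Set ℝ} {φ : ℝ → ℝ}

theorem hasDerivAt_iteratedDeriv (h : IsPhase κ α Ω φ) (hΩ : IsOpen Ω) {l : ℕ} (hl : l < κ + 1)
    {s : ℝ} (hs : s ∈ Ω) : HasDerivAt (iteratedDeriv l φ) (iteratedDeriv (l + 1) φ s) s := by
  have h1 := (h.contDiffOn.differentiableOn_iteratedDerivWithin (m := l) (by exact_mod_cast hl)
    hΩ.uniqueDiffOn).congr (fun x hx => (iteratedDerivWithin_of_isOpen hΩ hx).symm)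
  rw [iteratedDeriv_succ]
  exact (h1.differentiableAt (hΩ.mem_nhds hs)).hasDerivAt

theorem continuousOn_iteratedDeriv (h : IsPhase κ α Ω φ) (hΩ : IsOpen Ω) {l : ℕ}
    (hl : l ≤ κ + 1) : ContinuousOn (iteratedDeriv l φ) Ω :=
  (h.contDiffOn.continuousOn_iteratedDerivWithin (m := l) (by exact_mod_cast hl)
    hΩ.uniqueDiffOn).congr (fun _ hx => (iteratedDerivWithin_of_isOpen hΩ hx).symm)

theorem hasDerivAt (h : IsPhase κ α Ω φ) (hΩ : IsOpen Ω) {s : ℝ} (hs : s ∈ Ω) :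
    HasDerivAt φ (deriv φ s) s := by
  have := h.hasDerivAt_iteratedDeriv hΩ (l := 0) (by omega) hs
  simpa [iteratedDeriv_one] using this

theorem continuousOn_deriv (h : IsPhase κ α Ω φ) (hΩ : IsOpen Ω) : ContinuousOn (deriv φ) Ω := by
  rw [← iteratedDeriv_one]
  exact h.continuousOn_iteratedDeriv hΩ (by omega)

theorem continuousOn (h : IsPhase κ α Ω φ) : ContinuousOn φ Ω := h.contDiffOn.continuousOn

/-- At scales which are small compared to `ℓ`, the derivative of the phase is nearly constant. -/
theorem exists_oscillation (κ : ℕ) {α A c ε : ℝ} (hα : 0 ≤ α) (hγ : 0 < κ + α) (hA : 0 < A)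
    (hc : 0 < c) (hε : 0 < ε) : ∃ M : ℝ, 1 < M ∧ ∀ (Ω : Set ℝ) (φ ℓ : ℝ → ℝ), IsOpen Ω →
      IsPhase κ α Ω φ → IsAdmissible κ α A c Ω φ ℓ → ∀ x y : ℝ, 0 < y →
      M * y ≤ Ω.indicator ℓ x → ∀ s ∈ Metric.closedBall x y,
        |deriv φ s - deriv φ x| ≤ ε * deriv φ x := by
  -- For `κ = 0` the Hölder condition is itself a bound for the oscillation of φ'; for `κ ≥ 1` the
  -- bound on φ'' is integrated.
  rcases Nat.eq_zero_or_pos κ with rfl | hκ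
  · have hα' : 0 < α := by simpa using hγ
    obtain ⟨M, hM1, hMc, hMA⟩ : ∃ M : ℝ, 1 < M ∧ 1 ≤ c * M ∧ A ≤ ε * M ^ α := by
      have h1 : ∀ᶠ M : ℝ in atTop, 1 < M := eventually_gt_atTop 1
      have h2 : ∀ᶠ M : ℝ in atTop, 1 ≤ c * M :=
        (tendsto_id.const_mul_atTop hc).eventually_ge_atTop 1
      have h3 : ∀ᶠ M : ℝ in atTop, A ≤ ε * M ^ α :=
        ((tendsto_rpow_atTop hα').const_mul_atTop hε).eventually_ge_atTop A
      exact (h1.and (h2.and h3)).exists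
    refine ⟨M, hM1, fun Ω φ ℓ hΩ hφ hℓ x y hy hyL s hs => ?_⟩
    have hyL' : y < Ω.indicator ℓ x := by nlinarith
    have hsub := hℓ.closedBall_subset hΩ hyL'
    have hx : x ∈ Ω := hsub (Metric.mem_closedBall_self hy.le)
    have hsΩ := hsub hs
    have hL : 0 < Ω.indicator ℓ x := by linarith
    rw [indicator_of_mem hx] at hyL hyL' hL
    rw [Metric.mem_closedBall, Real.dist_eq] at hs
    have hyc : y ≤ c * ℓ x := by nlinarith
    have h1 := hℓ.holder_bound x hx s hsΩ (hs.trans hyc)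
    simp only [zero_add, Nat.cast_zero, iteratedDeriv_one] at h1
    rw [abs_sub_comm (deriv φ s)]
    have hP := hφ.deriv_pos x hx
    have hMy : (M * y) ^ α ≤ ℓ x ^ α := Real.rpow_le_rpow (by positivity) hyL hα
    rw [Real.mul_rpow (by linarith) hy.le] at hMy
    have h2 : |x - s| ^ α ≤ y ^ α := by
      rw [abs_sub_comm]
      exact Real.rpow_le_rpow (abs_nonneg _) hs hα
    have hya : 0 < y ^ α := by positivity
    have hMa : 0 < M ^ α := by positivity
    refine le_of_mul_le_mul_right ?_ (mul_pos hMa hya)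
    calc |deriv φ x - deriv φ s| * (M ^ α * y ^ α) ≤ |deriv φ x - deriv φ s| * ℓ x ^ α := by gcongr
      _ ≤ A * deriv φ x * |x - s| ^ α := h1
      _ ≤ ε * M ^ α * deriv φ x * y ^ α := by gcongr
      _ = _ := by ring
  · set M : ℝ := max 2 (max (4 * A) (4 * A / ε)) with hMdef
    have hM2 : 2 ≤ M := le_max_left _ _
    have hM4 : 4 * A ≤ M := (le_max_left _ _).trans (le_max_right _ _)
    have hMε : 4 * A ≤ ε * M := by
      have : 4 * A / ε ≤ M := (le_max_right _ _).trans (le_max_right _ _)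
      rw [div_le_iff₀ hε] at this
      linarith
    refine ⟨M, by linarith, fun Ω φ ℓ hΩ hφ hℓ x y hy hyL => ?_⟩
    have hyL' : y < Ω.indicator ℓ x := by nlinarith
    have hsub := hℓ.closedBall_subset hΩ hyL'
    have hx : x ∈ Ω := hsub (Metric.mem_closedBall_self hy.le)
    set L := Ω.indicator ℓ x with hL
    have hL0 : 0 < L := by linarith
    have hP := hφ.deriv_pos x hx
    set S := Metric.closedBall x y with hS
    -- The bound on φ''(s) involves φ'(s) and not φ'(x). With `Q` the maximum of φ' on the ball, the
    -- mean value inequality gives Q - φ'(x) ≤ qQ with q ≤ 1/2, and the right-hand side is absorbed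
    -- to get Q ≤ 2φ'(x).
    obtain ⟨m, hm, hmax⟩ := (isCompact_closedBall x y).exists_isMaxOn
      ⟨x, Metric.mem_closedBall_self hy.le⟩ ((hφ.continuousOn_deriv hΩ).mono hsub)
    set Q := deriv φ m with hQ
    have hQ0 : 0 < Q := hφ.deriv_pos m (hsub hm)
    have hd : ∀ s ∈ S, |iteratedDeriv 2 φ s| ≤ 2 * A / L * Q := by
      intro s hs
      have h1 := hℓ.deriv_bound s (hsub hs) 1 le_rfl hκ
      have h2 := hℓ.indicator_le_add hΩ x s
      rw [indicator_of_mem (hsub hs), ← hL] at h2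
      have hs' := hs
      rw [hS, Metric.mem_closedBall, Real.dist_eq] at hs'
      have h3 : L / 2 ≤ ℓ s := by nlinarith
      have h4 : deriv φ s ≤ Q := hmax hs
      rw [pow_one] at h1
      have h5 : |iteratedDeriv 2 φ s| * (L / 2) ≤ A * Q := calc
        _ ≤ |iteratedDeriv 2 φ s| * ℓ s := by gcongr
        _ ≤ A * deriv φ s := h1
        _ ≤ A * Q := by gcongr
      rw [div_mul_eq_mul_div, le_div_iff₀ hL0]
      linarith
    have hmv : ∀ s ∈ S, |deriv φ s - deriv φ x| ≤ 2 * A / L * Q * y := by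
      intro s hs
      have h1 := (convex_closedBall x y).norm_image_sub_le_of_norm_hasDerivWithin_le
        (f := deriv φ) (f' := iteratedDeriv 2 φ) (C := 2 * A / L * Q)
        (fun s hs => by
          have := hφ.hasDerivAt_iteratedDeriv hΩ (l := 1) (by omega) (hsub hs)
          rw [iteratedDeriv_one] at this
          exact this.hasDerivWithinAt) hd (Metric.mem_closedBall_self hy.le) hs
      rw [Real.norm_eq_abs, Real.norm_eq_abs] at h1
      refine h1.trans ?_
      have hs' := hs
      rw [hS, Metric.mem_closedBall, Real.dist_eq] at hs'
      gcongr
    have hyL2 : 2 * A / L * y * M ≤ 2 * A := by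
      rw [div_mul_eq_mul_div, div_mul_eq_mul_div, div_le_iff₀ hL0]
      nlinarith
    have hM0 : 0 < M := by linarith
    set q := 2 * A / L * y with hq
    have hq0 : 0 < q := by positivity
    have hq1 : q ≤ 1 / 2 := by nlinarith
    have hq2 : q ≤ ε / 2 := by
      refine le_of_mul_le_mul_right ?_ hM0
      linarith
    have hmm := (le_abs_self _).trans (hmv m hm)
    have hmm' : Q - deriv φ x ≤ q * Q := by rw [hq, mul_right_comm]; exact hmm
    have hQ2 : Q ≤ 2 * deriv φ x := by nlinarith
    intro s hs
    have h1 := hmv s hs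
    rw [mul_right_comm, ← hq] at h1
    nlinarith

end IsPhase

theorem norm_kerAvg_sub_const_le {k : ℝ → ℂ} (hk : IsKer k) {C : ℝ} (hC : ∀ u, ‖k u‖ ≤ C)
    {F : ℝ → ℂ} (w : ℂ) {x y M : ℝ} (hy : 0 < y) (hF : IntegrableOn F (Metric.closedBall x y))
    (hM : ∀ s ∈ Metric.closedBall x y, ‖F s - w‖ ≤ M) :
    ‖kerAvg k F x y - (∫ u, k u) * w‖ ≤ 2 * C * M := by
  rw [← kerAvg_sub_const hk w hy hF]
  exact norm_kerAvg_le hk hC hy hM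

namespace IsPhase

variable {κ : ℕ} {α A c : ℝ} {Ω : Set ℝ} {φ ℓ : ℝ → ℝ}

/-- Move `n` derivatives from the kernel to reach φ^{(κ+1)}. At least one derivative remains on the
kernel, which therefore has mean zero; the value of φ^{(κ+1)} at `x` may be subtracted, and the
Hölder condition applies to the difference. -/
theorem norm_kerAvg_derivKer_le (hφ : IsPhase κ α Ω φ) (hℓ : IsAdmissible κ α A c Ω φ ℓ)
    (hα : 0 ≤ α) (hA : 0 < A) (hΩ : IsOpen Ω) {ζ : ℝ → ℝ} (hζ : ContDiff ℝ ∞ ζ)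
    (h0 : ∀ u, 1 < |u| → ζ u = 0) {m n : ℕ} (hn : n ≤ κ + 1) {C : ℝ}
    (hC : ∀ u, ‖derivKer ζ (m + 1) u‖ ≤ C) {x y : ℝ} (hy : 0 < y) (hyL : y < Ω.indicator ℓ x)
    (hyc : y ≤ c * Ω.indicator ℓ x) :
    ‖kerAvg (derivKer ζ (m + 1 + n)) (fun s => ((iteratedDeriv (κ + 1 - n) φ s : ℝ) : ℂ)) x y‖ ≤
      y ^ n * (2 * C * (A * deriv φ x * y ^ α / Ω.indicator ℓ x ^ ((κ : ℝ) + α))) := by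
  have hsub := hℓ.closedBall_subset hΩ hyL
  have hx : x ∈ Ω := hsub (Metric.mem_closedBall_self hy.le)
  have key := kerAvg_derivKer_add hζ h0 (m + 1) n
    (Φ := fun l s => ((iteratedDeriv (κ + 1 - n + l) φ s : ℝ) : ℂ)) hy
    (fun l hl s hs => (hφ.hasDerivAt_iteratedDeriv hΩ (by omega) (hsub hs)).ofReal_comp)
    (fun l hl => (Complex.continuous_ofReal.comp_continuousOn
      (hφ.continuousOn_iteratedDeriv hΩ (by omega))).mono hsub)
  simp only [add_zero, show κ + 1 - n + n = κ + 1 by omega] at key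
  have hc1 : ContinuousOn (fun s => ((iteratedDeriv (κ + 1) φ s : ℝ) : ℂ)) (Metric.closedBall x y) :=
    (Complex.continuous_ofReal.comp_continuousOn
      (hφ.continuousOn_iteratedDeriv hΩ le_rfl)).mono hsub
  have h1 := norm_kerAvg_sub_const_le (isKer_derivKer hζ h0 (m + 1)) hC
    ((iteratedDeriv (κ + 1) φ x : ℝ) : ℂ) hy (hc1.integrableOn_compact (isCompact_closedBall x y))
    (M := A * deriv φ x * y ^ α / Ω.indicator ℓ x ^ ((κ : ℝ) + α)) (fun s hs => by
      rw [← Complex.ofReal_sub, Complex.norm_real, Real.norm_eq_abs]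
      have hs' := hs
      rw [Metric.mem_closedBall, Real.dist_eq] at hs'
      rw [indicator_of_mem hx] at hyc hyL ⊢
      have hL0 : 0 < ℓ x := by linarith
      rw [le_div_iff₀ (by positivity), abs_sub_comm]
      refine (hℓ.holder_bound x hx s (hsub hs) (hs'.trans hyc)).trans ?_
      rw [abs_sub_comm]
      have := hφ.deriv_pos x hx
      gcongr)
  rw [integral_derivKer_succ hζ h0, zero_mul, sub_zero] at h1
  rw [key, norm_mul, norm_pow, norm_neg, Complex.norm_real, Real.norm_of_nonneg hy.le]
  gcongr

end IsPhase

/-! ### Averages of the phase and of its derivative. -/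

/-- Bounds for the averages of a phase and of its derivative at the point `x` and the scale `y`. -/
structure PhaseBounds (κ : ℕ) (γ C : ℝ) (η : ℝ → ℂ) (ζ : ℝ → ℝ) (φ : ℝ → ℝ) (L x y : ℝ) :
    Prop where
  oscillation : ∀ s ∈ Metric.closedBall x y, |deriv φ s - deriv φ x| ≤ deriv φ x / 2
  im_ge : y * deriv φ x / 2 ≤ (kerAvg η (fun s => (φ s : ℂ)) x y).im
  norm_sub_le : ‖kerAvg η (fun s => ((deriv φ s : ℝ) : ℂ)) x y - deriv φ x‖ ≤ deriv φ x / 2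
  norm_deriv_le : ‖kerAvg (deriv η) (fun s => (φ s : ℂ)) x y‖ ≤ C * (y * deriv φ x)
  norm_deriv_deriv_le : ‖kerAvg (deriv η) (fun s => ((deriv φ s : ℝ) : ℂ)) x y‖ ≤ C * deriv φ x
  norm_dbar_le : ‖kerAvg (derivKer ζ (κ + 1 + 1)) (fun s => (φ s : ℂ)) x y‖ ≤
    C * (y * deriv φ x) * (y ^ γ / L ^ γ)
  norm_dbar_deriv_le : ‖kerAvg (derivKer ζ (κ + 1 + 1)) (fun s => ((deriv φ s : ℝ) : ℂ)) x y‖ ≤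
    C * deriv φ x * (y ^ γ / L ^ γ)

theorem exists_phaseBounds (κ : ℕ) {α A c : ℝ} (hα : 0 ≤ α) (hγ : 0 < κ + α) (hA : 0 < A)
    (hc : 0 < c) {η : ℝ → ℂ} {ζ : ℝ → ℝ} {a : ℂ} (hη : IsExtensionKer (κ + 1) η ζ a) :
    ∃ M C : ℝ, 1 < M ∧ 0 < C ∧ ∀ (Ω : Set ℝ) (φ ℓ : ℝ → ℝ), IsOpen Ω → IsPhase κ α Ω φ →
      IsAdmissible κ α A c Ω φ ℓ → ∀ x y : ℝ, 0 < y → M * y ≤ Ω.indicator ℓ x →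
        PhaseBounds κ (κ + α) C η ζ φ (Ω.indicator ℓ x) x y := by
  obtain ⟨C₀, hC₀, hη₀⟩ := hη.isKer.exists_bound
  obtain ⟨C₁, hC₁, hη₁⟩ := hη.isKer.deriv.exists_bound
  obtain ⟨C₂, hC₂, hζ₁⟩ := (isKer_derivKer hη.contDiff hη.eq_zero 1).exists_bound
  obtain ⟨C₃, hC₃, hζ₂⟩ := (isKer_derivKer hη.contDiff hη.eq_zero 2).exists_bound
  -- Averaging against η can enlarge an error by `2 * C₀`; this choice keeps the result at most one
  -- half.
  set ε : ℝ := min (1 / 2) (1 / (4 * C₀)) with hε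
  have hε0 : 0 < ε := by positivity
  have hε1 : ε ≤ 1 / 2 := min_le_left _ _
  have hε2 : 2 * C₀ * ε ≤ 1 / 2 := by
    have : ε ≤ 1 / (4 * C₀) := min_le_right _ _
    rw [le_div_iff₀ (by positivity)] at this
    linarith
  obtain ⟨M₀, hM₀, hosc⟩ := IsPhase.exists_oscillation κ hα hγ hA hc hε0
  have hD : 0 < 2 * C₀ * 2 + 2 * C₁ * 2 + 2 * C₂ * A + 2 * C₃ * A := by positivity
  -- The entry `1 / c` ensures `y ≤ c * L`, the range in which the Hölder condition is assumed.
  refine ⟨max M₀ (1 / c), 2 * C₀ * 2 + 2 * C₁ * 2 + 2 * C₂ * A + 2 * C₃ * A, lt_max_of_lt_left hM₀,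
    hD, fun Ω φ ℓ hΩ hφ hℓ x y hy hyL => ?_⟩
  set L := Ω.indicator ℓ x with hL
  have hyL0 : M₀ * y ≤ L := (mul_le_mul_of_nonneg_right (le_max_left _ _) hy.le).trans hyL
  have hyc : y ≤ c * L := by
    have : 1 / c * y ≤ L := (mul_le_mul_of_nonneg_right (le_max_right _ _) hy.le).trans hyL
    rw [one_div, inv_mul_le_iff₀ hc] at this
    exact this
  have hyL' : y < L := by nlinarith
  have hL0 : 0 < L := hy.trans hyL'
  have hsub := hℓ.closedBall_subset hΩ hyL'
  have hx : x ∈ Ω := hsub (Metric.mem_closedBall_self hy.le)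
  have hP := hφ.deriv_pos x hx
  set P := deriv φ x with hPdef
  have ho := hosc Ω φ ℓ hΩ hφ hℓ x y hy hyL0
  have hcφ : ContinuousOn (fun s => (φ s : ℂ)) (Metric.closedBall x y) :=
    (Complex.continuous_ofReal.comp_continuousOn hφ.continuousOn).mono hsub
  have hcφ' : ContinuousOn (fun s => ((deriv φ s : ℝ) : ℂ)) (Metric.closedBall x y) :=
    (Complex.continuous_ofReal.comp_continuousOn (hφ.continuousOn_deriv hΩ)).mono hsub
  have iφ := hcφ.integrableOn_compact (μ := volume) (isCompact_closedBall x y)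
  have iφ' := hcφ'.integrableOn_compact (μ := volume) (isCompact_closedBall x y)
  have hW : ∀ s ∈ Metric.closedBall x y, ‖((deriv φ s : ℝ) : ℂ)‖ ≤ 2 * P := fun s hs => by
    rw [Complex.norm_real, Real.norm_of_nonneg (hφ.deriv_pos s (hsub hs)).le]
    have := (le_abs_self _).trans (ho s hs)
    nlinarith
  have hyγ : 0 < y ^ ((κ : ℝ) + α) / L ^ ((κ : ℝ) + α) := by positivity
  have hyκ : y ^ ((κ : ℝ) + α) = y ^ κ * y ^ α := by
    rw [Real.rpow_add hy, Real.rpow_natCast]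
  refine ⟨fun s hs => (ho s hs).trans (by nlinarith), ?_, ?_, ?_, ?_, ?_, ?_⟩
  -- Subtract the tangent line at `x`. Its slope part averages to iyφ'(x) and its constant part is
  -- real, while the remainder varies by at most `ε * P * y`, so the imaginary part keeps half of
  -- yφ'(x).
  · have hR : ∀ s ∈ Metric.closedBall x y,
        ‖((φ s : ℂ) - (P : ℂ) * ((s - x : ℝ) : ℂ)) - (φ x : ℂ)‖ ≤ ε * P * y := by
      intro s hs
      have h1 := (convex_closedBall x y).norm_image_sub_le_of_norm_hasDerivWithin_le
        (f := fun s => φ s - P * (s - x)) (f' := fun s => deriv φ s - P) (C := ε * P)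
        (fun s hs => by
          have := (hφ.hasDerivAt hΩ (hsub hs)).sub
            (((hasDerivAt_id s).sub_const x).const_mul P)
          rw [mul_one] at this
          exact this.hasDerivWithinAt) (fun s hs => ho s hs) (Metric.mem_closedBall_self hy.le) hs
      have hs' := hs
      rw [Metric.mem_closedBall, Real.dist_eq] at hs'
      have e : ((φ s : ℂ) - (P : ℂ) * ((s - x : ℝ) : ℂ)) - (φ x : ℂ) =
          ((φ s - P * (s - x) - (φ x - P * (x - x)) : ℝ) : ℂ) := by push_cast; ring
      rw [e, Complex.norm_real]
      refine h1.trans ?_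
      rw [Real.norm_eq_abs]
      gcongr
    have ilin : IntegrableOn (fun s : ℝ => (P : ℂ) * ((s - x : ℝ) : ℂ)) (Metric.closedBall x y) :=
      (by fun_prop : Continuous fun s : ℝ => (P : ℂ) * ((s - x : ℝ) : ℂ)).continuousOn.integrableOn_compact
        (isCompact_closedBall x y)
    have h2 := norm_kerAvg_sub_const_le hη.isKer hη₀ (φ x : ℂ) hy (iφ.sub ilin) hR
    have e1 : kerAvg η (fun s : ℝ => (P : ℂ) * ((s - x : ℝ) : ℂ)) x y = P * (y * Complex.I) := by
      rw [← hη.integral_mul_eq, ← kerAvg_sub_self η x hy, kerAvg, kerAvg]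
      simp_rw [mul_left_comm _ (P : ℂ)]
      rw [integral_const_mul]
      ring
    have e2 := kerAvg_sub hη.isKer hy iφ ilin
    rw [show (fun s => (φ s : ℂ)) - (fun s : ℝ => (P : ℂ) * ((s - x : ℝ) : ℂ)) =
      fun s : ℝ => (φ s : ℂ) - (P : ℂ) * ((s - x : ℝ) : ℂ) from rfl, e2, e1, hη.integral_eq,
      one_mul] at h2
    have h3 := (Complex.abs_im_le_norm _).trans h2
    simp only [Complex.sub_im, Complex.mul_im, Complex.ofReal_re, Complex.ofReal_im, Complex.I_im,
      Complex.I_re, Complex.mul_re, sub_zero, mul_one, mul_zero, add_zero] at h3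
    have h4 := (abs_le.1 h3).1
    have hPy : 0 < P * y := by positivity
    nlinarith
  · have h1 := norm_kerAvg_sub_const_le hη.isKer hη₀ (P : ℂ) hy iφ' (M := ε * P) (fun s hs => by
      rw [← Complex.ofReal_sub, Complex.norm_real]
      exact ho s hs)
    rw [hη.integral_eq, one_mul] at h1
    refine h1.trans ?_
    nlinarith
  · rw [kerAvg_deriv hη.isKer hy (fun s hs => (hφ.hasDerivAt hΩ (hsub hs)).ofReal_comp) hcφ',
      norm_mul, norm_neg, Complex.norm_real, Real.norm_of_nonneg hy.le]
    have h1 := norm_kerAvg_le hη.isKer hη₀ hy hW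
    calc _ ≤ y * (2 * C₀ * (2 * P)) := by gcongr
      _ = 2 * C₀ * 2 * (y * P) := by ring
      _ ≤ _ := by
        gcongr
        have : 0 < 2 * C₁ * 2 + 2 * C₂ * A + 2 * C₃ * A := by positivity
        linarith
  · have h1 := norm_kerAvg_le hη.isKer.deriv hη₁ hy hW
    calc _ ≤ 2 * C₁ * 2 * P := by linarith
      _ ≤ _ := by
        gcongr
        have : 0 < 2 * C₀ * 2 + 2 * C₂ * A + 2 * C₃ * A := by positivity
        linarith
  -- Of the κ + 2 derivatives on the kernel, κ + 1 go to φ and one remains; for φ', treated next, κ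
  -- are moved and two remain.
  · have h1 := hφ.norm_kerAvg_derivKer_le hℓ hα hA hΩ hη.contDiff hη.eq_zero (m := 0)
      (n := κ + 1) le_rfl hζ₁ hy hyL' hyc
    rw [show 0 + 1 + (κ + 1) = κ + 1 + 1 by ring] at h1
    simp only [Nat.sub_self, iteratedDeriv_zero] at h1
    calc _ ≤ _ := h1
      _ = 2 * C₂ * A * (y * P) * (y ^ ((κ : ℝ) + α) / L ^ ((κ : ℝ) + α)) := by
        rw [hyκ]; ring
      _ ≤ _ := by
        gcongr
        have : 0 < 2 * C₀ * 2 + 2 * C₁ * 2 + 2 * C₃ * A := by positivity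
        linarith
  · have h1 := hφ.norm_kerAvg_derivKer_le hℓ hα hA hΩ hη.contDiff hη.eq_zero (m := 1)
      (n := κ) (by omega) hζ₂ hy hyL' hyc
    rw [show 1 + 1 + κ = κ + 1 + 1 by ring] at h1
    simp only [show κ + 1 - κ = 1 by omega, iteratedDeriv_one] at h1
    calc _ ≤ _ := h1
      _ = 2 * C₃ * A * P * (y ^ ((κ : ℝ) + α) / L ^ ((κ : ℝ) + α)) := by
        rw [hyκ]; ring
      _ ≤ _ := by
        gcongr
        have : 0 < 2 * C₀ * 2 + 2 * C₁ * 2 + 2 * C₂ * A := by positivity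
        linarith

/-! ### Smooth cutoffs adapted to a Lipschitz function. -/

theorem deriv_smoothTransition_eq_zero {u : ℝ} (hu : u ≤ 0 ∨ 1 ≤ u) :
    deriv Real.smoothTransition u = 0 := by
  rcases hu with hu | hu
  · refine IsLocalMin.deriv_eq_zero (Eventually.of_forall fun v => ?_)
    rw [Real.smoothTransition.zero_of_nonpos hu]
    exact Real.smoothTransition.nonneg v
  · refine IsLocalMax.deriv_eq_zero (Eventually.of_forall fun v => ?_)
    rw [Real.smoothTransition.one_of_one_le hu]
    exact Real.smoothTransition.le_one v

theorem exists_deriv_smoothTransition_bound :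
    ∃ T : ℝ, 0 < T ∧ ∀ u, |deriv Real.smoothTransition u| ≤ T := by
  have h1 : Continuous (deriv Real.smoothTransition) :=
    (Real.smoothTransition.contDiff (n := 1)).continuous_deriv le_rfl
  obtain ⟨T, hT⟩ := isCompact_Icc.exists_bound_of_continuousOn (s := Icc (0 : ℝ) 1)
    h1.continuousOn
  refine ⟨max T 1, by positivity, fun u => ?_⟩
  by_cases hu : u ∈ Icc (0 : ℝ) 1
  · exact (hT u hu).trans (le_max_left _ _)
  · rw [deriv_smoothTransition_eq_zero, abs_zero]
    · positivity
    · by_contra! h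
      exact hu ⟨h.1.le, h.2.le⟩

theorem HasDerivAt.complex_re {f : ℝ → ℂ} {f' : ℂ} {x : ℝ} (h : HasDerivAt f f' x) :
    HasDerivAt (fun x => (f x).re) f'.re x :=
  Complex.reCLM.hasFDerivAt.comp_hasDerivAt x h

/-- Smooth cutoffs to scales which are small compared to a `1`-Lipschitz function. -/
theorem exists_cutoff (M : ℝ) (hM : 0 < M) : ∃ C : ℝ, 0 < C ∧ ∀ L : ℝ → ℝ, (∀ x, 0 ≤ L x) →
    (∀ x y, |L x - L y| ≤ |x - y|) → ∃ χ χx χy : ℝ → ℝ → ℝ,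
      (∀ x y, 0 < y → HasDerivAt (fun x => χ x y) (χx x y) x) ∧
      (∀ x y, 0 < y → HasDerivAt (fun y => χ x y) (χy x y) y) ∧
      (∀ x y, |χ x y| ≤ 1) ∧
      (∀ x y, 0 < y → L x ≤ M * y → χ x y = 0 ∧ χx x y = 0 ∧ χy x y = 0) ∧
      (∀ x y, 0 < y → C * y ≤ L x → χ x y = 1 ∧ χx x y = 0 ∧ χy x y = 0) ∧
      ∀ x y, 0 < y → |χx x y| ≤ C / y ∧ |χy x y| ≤ C / y := by
  -- Here η serves only as a smooth kernel of mass one that regularises `L` at scale `y`; its first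
  -- moment plays no role.
  obtain ⟨η, ζ, a, hη⟩ := exists_isExtensionKer (K := 1) le_rfl
  obtain ⟨C₀, hC₀, hη₀⟩ := hη.isKer.exists_bound
  obtain ⟨C₁, hC₁, hη₁⟩ := hη.isKer.deriv.exists_bound
  obtain ⟨C₂, hC₂, hη₂⟩ := hη.isKer.ofReal_mul.deriv.exists_bound
  obtain ⟨T, hT, hθT⟩ := exists_deriv_smoothTransition_bound
  -- The regularisation `q` differs from `L` by at most `2 * C₀ * y`. So `q / y - N` is nonpositive
  -- when `L ≤ M * y`, and at least 1 when `L ≥ (M + 4 * C₀ + 1) * y`.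
  set N := M + 2 * C₀ with hN
  set C := (M + 4 * C₀ + 1) + T * (2 * C₁) + T * (2 * C₂ + (N + 1)) with hC
  have hC0 : 0 < C := by positivity
  refine ⟨C, hC0, fun L hL0 hL => ?_⟩
  have hLc : Continuous L := by
    have : LipschitzWith 1 L := LipschitzWith.of_dist_le_mul fun x y => by
      simpa [Real.dist_eq] using hL x y
    exact this.continuous
  have hLi : ∀ x r, IntegrableOn (fun s => (L s : ℂ)) (Metric.closedBall x r) := fun x r =>
    (Complex.continuous_ofReal.comp hLc).continuousOn.integrableOn_compact
      (isCompact_closedBall x r)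
  have hLb : ∀ x y, ∀ s ∈ Metric.closedBall x y, ‖(L s : ℂ) - (L x : ℂ)‖ ≤ y := fun x y s hs => by
    rw [← Complex.ofReal_sub, Complex.norm_real]
    exact (hL s x).trans (by simpa [Real.dist_eq] using hs)
  set q : ℝ → ℝ → ℝ := fun x y => (kerAvg η (fun s => (L s : ℂ)) x y).re with hq
  set qx : ℝ → ℝ → ℝ := fun x y =>
    (-(y : ℂ)⁻¹ * kerAvg (deriv η) (fun s => (L s : ℂ)) x y).re with hqx
  set qy : ℝ → ℝ → ℝ := fun x y =>
    (-(y : ℂ)⁻¹ * kerAvg (deriv fun u : ℝ => (u : ℂ) * η u) (fun s => (L s : ℂ)) x y).re with hqy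
  have dqx : ∀ x y, 0 < y → HasDerivAt (fun x => q x y) (qx x y) x := fun x y hy =>
    (HasDerivAt.complex_re (hasDerivAt_kerAvg_left hη.isKer hy (lt_add_one y) (hLi x _)))
  have dqy : ∀ x y, 0 < y → HasDerivAt (fun y => q x y) (qy x y) y := fun x y hy =>
    (HasDerivAt.complex_re (hasDerivAt_kerAvg_right hη.isKer hy (lt_add_one y) (hLi x _)))
  have bq : ∀ x y, 0 < y → |q x y - L x| ≤ 2 * C₀ * y := fun x y hy => by
    have h1 := norm_kerAvg_sub_const_le hη.isKer hη₀ (L x : ℂ) hy (hLi x y) (hLb x y)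
    rw [hη.integral_eq, one_mul] at h1
    have h2 := (Complex.abs_re_le_norm _).trans h1
    simpa using h2
  have bk : ∀ {k : ℝ → ℂ} {D : ℝ}, IsKer k → (∀ u, ‖deriv k u‖ ≤ D) → ∀ x y : ℝ, 0 < y →
      |(-(y : ℂ)⁻¹ * kerAvg (deriv k) (fun s => (L s : ℂ)) x y).re| ≤ 2 * D := by
    intro k D hk hD x y hy
    have h1 := norm_kerAvg_sub_const_le hk.deriv hD (L x : ℂ) hy (hLi x y) (hLb x y)
    rw [hk.integral_deriv, zero_mul, sub_zero] at h1
    refine (Complex.abs_re_le_norm _).trans ?_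
    rw [norm_mul, norm_neg, norm_inv, Complex.norm_real, Real.norm_of_nonneg hy.le]
    rw [inv_mul_le_iff₀ hy]
    linarith
  have bqx : ∀ x y, 0 < y → |qx x y| ≤ 2 * C₁ := bk hη.isKer hη₁
  have bqy : ∀ x y, 0 < y → |qy x y| ≤ 2 * C₂ := bk hη.isKer.ofReal_mul hη₂
  set v : ℝ → ℝ → ℝ := fun x y => q x y / y - N with hv
  have dθ : ∀ u, HasDerivAt Real.smoothTransition (deriv Real.smoothTransition u) u := fun u =>
    ((Real.smoothTransition.contDiff (n := 1)).differentiable one_ne_zero u).hasDerivAt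
  have hlow : ∀ x y, 0 < y → L x ≤ M * y → v x y ≤ 0 := by
    intro x y hy h
    have h1 := (le_abs_self _).trans (bq x y hy)
    rw [hv, sub_nonpos, div_le_iff₀ hy]
    linarith
  have hhigh : ∀ x y, 0 < y → C * y ≤ L x → 1 ≤ v x y := by
    intro x y hy h
    have h1 := (abs_le.1 (bq x y hy)).1
    have h2 : (M + 4 * C₀ + 1) * y ≤ C * y := by
      refine mul_le_mul_of_nonneg_right ?_ hy.le
      have : 0 < T * (2 * C₁) + T * (2 * C₂ + (N + 1)) := by positivity
      linarith
    rw [hv, le_sub_iff_add_le, le_div_iff₀ hy]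
    linarith
  refine ⟨fun x y => Real.smoothTransition (v x y),
    fun x y => deriv Real.smoothTransition (v x y) * (qx x y / y),
    fun x y => deriv Real.smoothTransition (v x y) * ((qy x y * y - q x y * 1) / y ^ 2),
    fun x y hy => ?_, fun x y hy => ?_, fun x y => ?_, fun x y hy h => ?_, fun x y hy h => ?_,
    fun x y hy => ⟨?_, ?_⟩⟩
  · exact (dθ _).comp x (((dqx x y hy).div_const y).sub_const N)
  · exact (dθ _).comp y (((dqy x y hy).div (hasDerivAt_id y) hy.ne').sub_const N)
  · rw [abs_of_nonneg (Real.smoothTransition.nonneg _)]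
    exact Real.smoothTransition.le_one _
  · have h1 := hlow x y hy h
    simp [deriv_smoothTransition_eq_zero (Or.inl h1), Real.smoothTransition.zero_of_nonpos h1]
  · have h1 := hhigh x y hy h
    simp [deriv_smoothTransition_eq_zero (Or.inr h1), Real.smoothTransition.one_of_one_le h1]
  · rw [abs_mul, abs_div, abs_of_pos hy, ← mul_div_assoc]
    refine div_le_div_of_nonneg_right ?_ hy.le
    calc _ ≤ T * (2 * C₁) := mul_le_mul (hθT _) (bqx x y hy) (abs_nonneg _) hT.le
      _ ≤ C := by
        have : 0 < (M + 4 * C₀ + 1) + T * (2 * C₂ + (N + 1)) := by positivity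
        linarith
  · beta_reduce
    -- `q / y` is bounded only in the transition region, but elsewhere the derivative of the
    -- transition function vanishes.
    by_cases hu : v x y ≤ 0 ∨ 1 ≤ v x y
    · rw [deriv_smoothTransition_eq_zero hu, zero_mul, abs_zero]
      positivity
    · push Not at hu
      have hN0 : 0 < N := by positivity
      have h1 : |q x y| ≤ (N + 1) * y := by
        have h2 := hu.1
        have h3 := hu.2
        rw [hv] at h2 h3
        simp only at h2 h3
        rw [sub_pos, lt_div_iff₀ hy] at h2
        rw [sub_lt_iff_lt_add, div_lt_iff₀ hy] at h3
        rw [abs_le]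
        constructor <;> nlinarith
      have h2 : |(qy x y * y - q x y * 1) / y ^ 2| ≤ (2 * C₂ + (N + 1)) / y := by
        rw [abs_div, abs_of_pos (by positivity : 0 < y ^ 2), div_le_div_iff₀ (by positivity) hy]
        have h3 : |qy x y * y - q x y * 1| ≤ 2 * C₂ * y + (N + 1) * y := by
          refine (abs_sub _ _).trans ?_
          rw [mul_one, abs_mul, abs_of_pos hy]
          exact add_le_add (mul_le_mul_of_nonneg_right (bqy x y hy) hy.le) h1
        nlinarith
      rw [abs_mul]
      calc _ ≤ T * ((2 * C₂ + (N + 1)) / y) := mul_le_mul (hθT _) h2 (abs_nonneg _) hT.le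
        _ = T * (2 * C₂ + (N + 1)) / y := by ring
        _ ≤ C / y := by
          refine div_le_div_of_nonneg_right ?_ hy.le
          have : 0 < (M + 4 * C₀ + 1) + T * (2 * C₁) := by positivity
          linarith

/-! ### The fractional maximal function and averages of weak derivatives. -/

/-- The fractional maximal function with the supremum restricted to dyadic scales. -/
noncomputable def dyadicMax (L : ℝ → ℝ) (β : ℝ) (g : ℝ → ℂ) (x : ℝ) : ℝ≥0∞ :=
  ⨆ n : ℤ, {x | (2 : ℝ) ^ n < L x}.indicator (fun x => ENNReal.ofReal (1 / ((2 : ℝ) ^ n) ^ (1 + β)) *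
    ∫⁻ u in Icc (-((2 : ℝ) ^ n / 2)) ((2 : ℝ) ^ n / 2), ‖g (x + u) - g x‖ₑ) x

/-- This is the reason for dyadic scales: the supremum becomes countable, at the cost of a constant
when it is used to bound averages. -/
theorem measurable_dyadicMax {L : ℝ → ℝ} (hL : Measurable L) (β : ℝ) {g : ℝ → ℂ}
    (hg : Measurable g) : Measurable (dyadicMax L β g) := by
  refine Measurable.iSup fun n => Measurable.indicator (Measurable.const_mul ?_ _)
    (measurableSet_lt measurable_const hL)
  exact Measurable.lintegral_prod_right' (f := fun z : ℝ × ℝ => ‖g (z.1 + z.2) - g z.1‖ₑ)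
    (((hg.comp (measurable_fst.add measurable_snd)).sub (hg.comp measurable_fst)).enorm)

theorem kerAvg_congr_ae {k : ℝ → ℂ} (hk : IsKer k) {F G : ℝ → ℂ} {Ω : Set ℝ}
    (h : F =ᵐ[volume.restrict Ω] G) {x y : ℝ} (hy : 0 < y)
    (hsub : Metric.closedBall x y ⊆ Ω) : kerAvg k F x y = kerAvg k G x y := by
  rw [kerAvg_eq_setIntegral hk F hy hsub, kerAvg_eq_setIntegral hk G hy hsub]
  congr 1
  refine integral_congr_ae ?_
  filter_upwards [h] with s hs
  rw [hs]

/-- Scales below ℓ(x) only see values in `Ω`, so a measurable representative of `g` may be used. The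
value at `x` itself must agree, which holds for almost every `x`. -/
theorem dyadicMax_le_fracMaximal {Ω : Set ℝ} (hΩ : MeasurableSet Ω) {ℓ : ℝ → ℝ} (β : ℝ)
    {g g' : ℝ → ℂ} (h : g' =ᵐ[volume.restrict Ω] g) {x : ℝ} (hx : x ∈ Ω) (hgx : g' x = g x)
    (hball : ∀ y < Ω.indicator ℓ x, Metric.closedBall x y ⊆ Ω) :
    dyadicMax (Ω.indicator ℓ) β g' x ≤ fracMaximal ℓ β g x := by
  refine iSup_le fun n => ?_
  by_cases hn : (2 : ℝ) ^ n < Ω.indicator ℓ x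
  · rw [indicator_of_mem (s := {x | (2 : ℝ) ^ n < Ω.indicator ℓ x}) hn]
    have h2 : (0 : ℝ) < 2 ^ n := by positivity
    have hmem : (2 : ℝ) ^ n ∈ Ioo 0 (ℓ x) := ⟨h2, by rwa [indicator_of_mem hx] at hn⟩
    refine le_trans (le_of_eq ?_) (le_iSup₂ (f := fun δ _ => ENNReal.ofReal (1 / δ ^ (1 + β)) *
      ∫⁻ u in Icc (-(δ / 2)) (δ / 2), ‖g (x + u) - g x‖ₑ) _ hmem)
    congr 1
    rw [Filter.EventuallyEq, ae_restrict_iff' hΩ] at h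
    refine setLIntegral_congr_fun_ae measurableSet_Icc ?_
    filter_upwards [(measurePreserving_add_left volume x).quasiMeasurePreserving.ae h] with u hu hu2
    rw [hu (hball _ hn ?_), hgx]
    rw [Metric.mem_closedBall, Real.dist_eq, add_sub_cancel_left, abs_le]
    constructor <;> linarith [hu2.1, hu2.2]
  · rw [indicator_of_notMem (s := {x | (2 : ℝ) ^ n < Ω.indicator ℓ x}) hn]
    exact zero_le

/-- The kernel has mean zero, so `g x` may be subtracted. The dyadic δ with 2y < δ ≤ 4y is large
enough for [-δ/2, δ/2] to contain the support and small enough to stay below `L x`. -/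
theorem enorm_kerAvg_le_dyadicMax {k : ℝ → ℂ} (hk : IsKer k) {C : ℝ} (hC : ∀ u, ‖k u‖ ≤ C)
    (hk0 : ∫ u, k u = 0) {L : ℝ → ℝ} {β : ℝ} (hβ : 0 ≤ β) {g : ℝ → ℂ} {x y : ℝ} (hy : 0 < y)
    (hyL : 4 * y < L x) (hg : IntegrableOn g (Metric.closedBall x y)) :
    ‖kerAvg k g x y‖ₑ ≤ ENNReal.ofReal (C * 4 ^ (1 + β) * y ^ β) * dyadicMax L β g x := by
  have hC0 : 0 ≤ C := (norm_nonneg _).trans (hC 0)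
  obtain ⟨n, hn1, hn2⟩ := exists_zpow_two_mem (by positivity : 0 < 2 * y)
  set δ : ℝ := 2 ^ n with hδ
  have hδ0 : 0 < δ := by linarith
  have h0 : kerAvg k g x y = kerAvg k (fun s => g s - g x) x y := by
    rw [kerAvg_sub_const hk _ hy hg, hk0, zero_mul, sub_zero]
  have h1 := enorm_kerAvg_le hk hC (fun s => g s - g x) x hy
  have h2 : ∫⁻ s in Metric.closedBall x y, ‖g s - g x‖ₑ ≤
      ∫⁻ u in Icc (-(δ / 2)) (δ / 2), ‖g (x + u) - g x‖ₑ := by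
    rw [← lintegral_indicator Metric.isClosed_closedBall.measurableSet,
      ← lintegral_indicator measurableSet_Icc, ← lintegral_add_left_eq_self _ x]
    refine lintegral_mono fun u => ?_
    by_cases hu : x + u ∈ Metric.closedBall x y
    · have hu' : u ∈ Icc (-(δ / 2)) (δ / 2) := by
        rw [Metric.mem_closedBall, Real.dist_eq, add_sub_cancel_left, abs_le] at hu
        constructor <;> linarith [hu.1, hu.2]
      rw [indicator_of_mem hu, indicator_of_mem hu']
    · rw [indicator_of_notMem hu]
      exact zero_le
  have h3 : ENNReal.ofReal (1 / δ ^ (1 + β)) *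
      ∫⁻ u in Icc (-(δ / 2)) (δ / 2), ‖g (x + u) - g x‖ₑ ≤ dyadicMax L β g x := by
    refine le_trans (le_of_eq ?_) (le_iSup _ n)
    rw [indicator_of_mem (s := {x | (2 : ℝ) ^ n < L x})
      (show (2 : ℝ) ^ n < L x by rw [← hδ]; linarith)]
  have h4 : C / y ≤ C * 4 ^ (1 + β) * y ^ β * (1 / δ ^ (1 + β)) := by
    rw [mul_one_div, div_le_div_iff₀ hy (by positivity)]
    calc C * δ ^ (1 + β) ≤ C * (4 * y) ^ (1 + β) := by
          gcongr
          linarith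
      _ = C * 4 ^ (1 + β) * y ^ β * y := by
          rw [Real.mul_rpow (by norm_num) hy.le, Real.rpow_add hy, Real.rpow_one]
          ring
  rw [h0]
  calc _ ≤ _ := h1
    _ ≤ ENNReal.ofReal (C * 4 ^ (1 + β) * y ^ β * (1 / δ ^ (1 + β))) *
        ∫⁻ u in Icc (-(δ / 2)) (δ / 2), ‖g (x + u) - g x‖ₑ := by gcongr
    _ ≤ _ := by
        rw [ENNReal.ofReal_mul (by positivity), mul_assoc]
        gcongr

theorem enorm_kerAvg_le_maxFn {k : ℝ → ℂ} (hk : IsKer k) {C : ℝ} (hC : ∀ u, ‖k u‖ ≤ C)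
    {F : ℝ → ℂ} {N : ℝ → ℝ≥0∞} {x y : ℝ} (hy : 0 < y) {D : ℝ≥0∞} (hD : D ≠ ⊤)
    (hFN : ∀ s ∈ Metric.closedBall x y, ‖F s‖ₑ ≤ D * N s) :
    ‖kerAvg k F x y‖ₑ ≤ ENNReal.ofReal (2 * C) * (D * maxFn N x) := by
  have hC0 : 0 ≤ C := (norm_nonneg _).trans (hC 0)
  calc _ ≤ _ := enorm_kerAvg_le hk hC F x hy
    _ ≤ ENNReal.ofReal (C / y) * ∫⁻ s in Metric.closedBall x y, D * N s := by
        gcongr 1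
        exact setLIntegral_mono_ae' Metric.isClosed_closedBall.measurableSet
          (ae_of_all _ hFN)
    _ ≤ ENNReal.ofReal (C / y) * (D * (ENNReal.ofReal (2 * y) * maxFn N x)) := by
        rw [lintegral_const_mul' _ _ hD]
        gcongr
        exact lintegral_closedBall_le_maxFn N x hy
    _ = ENNReal.ofReal (C / y) * ENNReal.ofReal (2 * y) * (D * maxFn N x) := by ring
    _ = _ := by
        rw [← ENNReal.ofReal_mul (by positivity)]
        congr 2
        field_simp

/-- A majorant of the `∂x + i ∂y` derivative of an average, in terms of a weak derivative. -/
theorem exists_dbar_majorant {κ : ℕ} {γ p : ℝ} (hp : 1 < p) (hγ : 0 ≤ γ) (hγκ : ⌊γ⌋₊ ≤ κ + 1)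
    {ζ : ℝ → ℝ} (hζ : ContDiff ℝ ∞ ζ) (h0 : ∀ u, 1 < |u| → ζ u = 0) :
    ∃ C : ℝ≥0, ∀ (Ω : Set ℝ) (ℓ : ℝ → ℝ) (F g : ℝ → ℂ), IsOpen Ω → Measurable (Ω.indicator ℓ) →
      (∀ x, ∀ y < Ω.indicator ℓ x, 0 < y → Metric.closedBall x y ⊆ Ω) →
      IsWeakDeriv Ω ⌊γ⌋₊ F g → ∃ m : ℝ → ℝ≥0∞, Measurable m ∧
        (∫⁻ x, m x ^ p) ^ (1 / p) ≤ C * fracSeminorm Ω ℓ p (γ - ⌊γ⌋₊) g ∧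
        ∀ x y : ℝ, 0 < y → 4 * y < Ω.indicator ℓ x →
          ‖kerAvg (derivKer ζ (κ + 1 + 1)) F x y‖ₑ ≤ ENNReal.ofReal (C * y ^ γ) * m x := by
  have hp0 : 0 < p := by linarith
  set j := ⌊γ⌋₊ with hj
  set β := γ - j with hβ
  have hβ0 : 0 ≤ β := sub_nonneg.2 (Nat.floor_le hγ)
  -- `j` derivatives are moved to the weak derivative `g`, and at least one stays on the kernel, so
  -- that it has mean zero.
  obtain ⟨n, hn⟩ : ∃ n, κ + 1 + 1 = n + 1 + j := ⟨κ + 1 - j, by omega⟩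
  have hk := isKer_derivKer hζ h0 (n + 1)
  have hk0 := integral_derivKer_succ hζ h0 n
  obtain ⟨D, hD0, hD⟩ := hk.exists_bound
  obtain ⟨Cm, hCm⟩ := lintegral_maxFn_rpow_le hp
  have hweak : ∀ {Ω : Set ℝ} {F g : ℝ → ℂ}, IsWeakDeriv Ω j F g → ∀ x y, 0 < y →
      Metric.closedBall x y ⊆ Ω → ‖kerAvg (derivKer ζ (κ + 1 + 1)) F x y‖ₑ =
        ENNReal.ofReal (y ^ j) * ‖kerAvg (derivKer ζ (n + 1)) g x y‖ₑ := by
    intro Ω F g hw x y hy hsub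
    rw [hn, hw.kerAvg_derivKer_add hζ h0 (n + 1) hy hsub, enorm_mul]
    congr 1
    rw [← ofReal_norm, norm_pow, norm_neg, Complex.norm_real, Real.norm_of_nonneg hy.le]
  have hyγ : ∀ y : ℝ, 0 < y → y ^ γ = y ^ j * y ^ β := fun y hy => by
    rw [← Real.rpow_natCast, ← Real.rpow_add hy]
    congr 1
    ring
  -- For integer γ the majorant is the maximal function of `g` and needs the maximal theorem;
  -- otherwise it is the dyadic fractional maximal function itself.
  by_cases hβz : β = 0
  · refine ⟨Real.toNNReal (2 * D) + Cm ^ (1 / p), fun Ω ℓ F g hΩ hL hball hw => ?_⟩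
    have hgm : AEStronglyMeasurable g (volume.restrict Ω) :=
      hw.locallyIntegrableOn_deriv.aestronglyMeasurable
    set g' := Ω.indicator g with hg'
    have hgm' : AEStronglyMeasurable g' volume :=
      (aestronglyMeasurable_indicator_iff hΩ.measurableSet).2 hgm
    refine ⟨maxFn fun s => ‖g' s‖ₑ, measurable_maxFn_enorm hgm', ?_, fun x y hy hyL => ?_⟩
    · rw [fracSeminorm, if_pos hβz, eLpNorm_ofReal_exponent hp0]
      rw [maxFn_enorm_ae hgm']
      refine (ENNReal.rpow_le_rpow (hCm _ hgm'.stronglyMeasurable_mk.measurable.enorm)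
        (by positivity)).trans ?_
      rw [ENNReal.mul_rpow_of_nonneg _ _ (by positivity)]
      have e : ∫⁻ s, ‖hgm'.mk g' s‖ₑ ^ p = ∫⁻ s in Ω, ‖g s‖ₑ ^ p := by
        rw [← lintegral_indicator hΩ.measurableSet]
        refine lintegral_congr_ae ?_
        filter_upwards [hgm'.ae_eq_mk] with s hs
        rw [← hs, hg']
        by_cases hsΩ : s ∈ Ω
        · simp [hsΩ]
        · simp [hsΩ, hp0]
      rw [e]
      gcongr
      rw [ENNReal.coe_add, ← ENNReal.coe_rpow_of_nonneg _ (by positivity)]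
      exact le_add_self
    · have hsub := hball x y (by linarith) hy
      rw [hweak hw x y hy hsub]
      have h1 := enorm_kerAvg_le_maxFn hk hD (F := g) (N := fun s => ‖g' s‖ₑ) hy
        ENNReal.one_ne_top (fun s hs => by rw [hg', indicator_of_mem (hsub hs), one_mul])
      rw [hyγ y hy, hβz, Real.rpow_zero, mul_one]
      rw [one_mul] at h1
      calc _ ≤ ENNReal.ofReal (y ^ j) * (ENNReal.ofReal (2 * D) * maxFn (fun s => ‖g' s‖ₑ) x) := by
            gcongr
        _ = ENNReal.ofReal (2 * D * y ^ j) * maxFn (fun s => ‖g' s‖ₑ) x := by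
            rw [← mul_assoc, ← ENNReal.ofReal_mul (by positivity), mul_comm (2 * D)]
        _ ≤ _ := by
            gcongr
            rw [NNReal.coe_add, Real.coe_toNNReal _ (by positivity)]
            exact le_add_of_nonneg_right (NNReal.coe_nonneg _)
  · refine ⟨Real.toNNReal (D * 4 ^ (1 + β)) + 1, fun Ω ℓ F g hΩ hL hball hw => ?_⟩
    have hgm : AEStronglyMeasurable g (volume.restrict Ω) :=
      hw.locallyIntegrableOn_deriv.aestronglyMeasurable
    set g' := hgm.mk g with hg'
    have hball' : ∀ x ∈ Ω, ∀ y < Ω.indicator ℓ x, Metric.closedBall x y ⊆ Ω := fun x hx y hy => by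
      rcases lt_trichotomy y 0 with h | rfl | h
      · simp [Metric.closedBall_eq_empty.2 h]
      · simpa using hx
      · exact hball x y hy h
    refine ⟨Ω.indicator (dyadicMax (Ω.indicator ℓ) β g'),
      (measurable_dyadicMax hL β hgm.stronglyMeasurable_mk.measurable).indicator hΩ.measurableSet,
      ?_, fun x y hy hyL => ?_⟩
    · rw [fracSeminorm, if_neg hβz]
      have e : ∫⁻ x, Ω.indicator (dyadicMax (Ω.indicator ℓ) β g') x ^ p ≤
          ∫⁻ x in Ω, fracMaximal ℓ β g x ^ p := by
        rw [← lintegral_indicator hΩ.measurableSet]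
        refine lintegral_mono_ae ?_
        have h1 := hgm.ae_eq_mk
        rw [Filter.EventuallyEq, ae_restrict_iff' hΩ.measurableSet] at h1
        filter_upwards [h1] with x hx
        by_cases hxΩ : x ∈ Ω
        · rw [indicator_of_mem hxΩ, indicator_of_mem hxΩ]
          gcongr
          exact dyadicMax_le_fracMaximal hΩ.measurableSet β hgm.ae_eq_mk.symm hxΩ (hx hxΩ).symm
            (hball' x hxΩ)
        · simp [hxΩ, hp0]
      refine (ENNReal.rpow_le_rpow e (by positivity)).trans ?_
      rw [ENNReal.coe_add, add_mul, ENNReal.coe_one, one_mul]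
      exact le_add_self
    · have hsub := hball x y (by linarith) hy
      have hx : x ∈ Ω := hsub (Metric.mem_closedBall_self hy.le)
      rw [hweak hw x y hy hsub, kerAvg_congr_ae hk hgm.ae_eq_mk hy hsub,
        indicator_of_mem hx]
      have hgi : IntegrableOn g' (Metric.closedBall x y) :=
        (hw.locallyIntegrableOn_deriv.integrableOn_compact_subset hsub
          (isCompact_closedBall x y)).congr (ae_mono (Measure.restrict_mono hsub le_rfl)
          hgm.ae_eq_mk)
      have h1 := enorm_kerAvg_le_dyadicMax hk hD hk0 hβ0 hy hyL hgi
      calc _ ≤ ENNReal.ofReal (y ^ j) * (ENNReal.ofReal (D * 4 ^ (1 + β) * y ^ β) *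
            dyadicMax (Ω.indicator ℓ) β g' x) := by gcongr
        _ = ENNReal.ofReal (D * 4 ^ (1 + β) * y ^ γ) * dyadicMax (Ω.indicator ℓ) β g' x := by
            rw [← mul_assoc, ← ENNReal.ofReal_mul (by positivity), hyγ y hy]
            congr 2
            ring
        _ ≤ _ := by
            gcongr
            rw [NNReal.coe_add, Real.coe_toNNReal _ (by positivity)]
            exact le_add_of_nonneg_right (NNReal.coe_nonneg _)

/-! ### Pointwise estimates for the extension, and the integral over scales. -/

theorem norm_cpow_le_of_norm_sub_le {w : ℂ} {P γ : ℝ} (hP : 0 < P) (hγ : 0 ≤ γ)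
    (hw : ‖w - P‖ ≤ P / 2) : ‖w ^ (γ : ℂ)‖ ≤ 2 ^ γ * P ^ γ := by
  have h1 : ‖w‖ ≤ 2 * P := by
    have := norm_add_le (w - P) (P : ℂ)
    rw [sub_add_cancel, Complex.norm_real, Real.norm_of_nonneg hP.le] at this
    linarith
  rw [Complex.norm_cpow_real, ← Real.mul_rpow (by norm_num) hP.le]
  exact Real.rpow_le_rpow (norm_nonneg _) h1 hγ

theorem half_le_norm_of_norm_sub_le {w : ℂ} {P : ℝ} (hP : 0 < P)
    (hw : ‖w - P‖ ≤ P / 2) : P / 2 ≤ ‖w‖ := by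
  have := norm_sub_le w (w - P)
  rw [sub_sub_cancel, Complex.norm_real, Real.norm_of_nonneg hP.le] at this
  linarith

theorem norm_cpow_sub_one_le_of_norm_sub_le {w : ℂ} {P γ : ℝ} (hP : 0 < P) (hγ : 0 ≤ γ)
    (hw : ‖w - P‖ ≤ P / 2) : ‖w ^ ((γ : ℂ) - 1)‖ ≤ 2 * 2 ^ γ * (P ^ γ / P) := by
  have h1 := half_le_norm_of_norm_sub_le hP hw
  have hw0 : w ≠ 0 := fun h => by
    rw [h, norm_zero] at h1
    linarith
  rw [Complex.cpow_sub _ _ hw0, Complex.cpow_one, norm_div, div_le_iff₀ (norm_pos_iff.2 hw0)]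
  calc ‖w ^ (γ : ℂ)‖ ≤ 2 ^ γ * P ^ γ := norm_cpow_le_of_norm_sub_le hP hγ hw
    _ = 2 * 2 ^ γ * (P ^ γ / P) * (P / 2) := by field_simp
    _ ≤ _ := by gcongr

theorem re_pos_of_norm_sub_le {w : ℂ} {P : ℝ} (hP : 0 < P) (hw : ‖w - P‖ ≤ P / 2) :
    0 < w.re := by
  have h1 := (abs_le.1 ((Complex.abs_re_le_norm _).trans hw)).1
  rw [Complex.sub_re, Complex.ofReal_re] at h1
  linarith

theorem norm_exp_I_mul_le {z : ℂ} {t b : ℝ} (ht : 0 ≤ t) (hz : b ≤ z.im) :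
    ‖Complex.exp (Complex.I * t * z)‖ ≤ Real.exp (-(t * b)) := by
  rw [Complex.norm_exp]
  apply Real.exp_le_exp.2
  simp only [Complex.mul_re, Complex.I_re, Complex.ofReal_re, zero_mul, Complex.I_im,
    Complex.ofReal_im, mul_zero, sub_self, Complex.mul_im, one_mul, zero_add, zero_sub]
  have := mul_le_mul_of_nonneg_left hz ht
  simp
  linarith

/-- Differentiating the exponential produces a factor tyφ'; half of the decay is spent on absorbing
it. -/
theorem mul_exp_neg_half_le {s : ℝ} : s * Real.exp (-(s / 2)) ≤ 4 * Real.exp (-(s / 4)) := by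
  have h1 : s / 4 ≤ Real.exp (s / 4) := by linarith [Real.add_one_le_exp (s / 4)]
  have h2 : Real.exp (-(s / 2)) = Real.exp (-(s / 4)) * Real.exp (-(s / 4)) := by
    rw [← Real.exp_add]; congr 1; ring
  have h3 : Real.exp (s / 4) * Real.exp (-(s / 4)) = 1 := by
    rw [← Real.exp_add]; simp
  have h4 := Real.exp_pos (-(s / 4))
  rw [h2]
  nlinarith [mul_le_mul_of_nonneg_right h1 h4.le]

/-- Pointwise bound for the `∂x + i ∂y` derivative of the extended function. -/
theorem norm_dbar_product_le {F DF w Dw z Dz χ χ' : ℂ} {P L y t γ C M₁ M₂ : ℝ} (hP : 0 < P)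
    (hL : 0 < L) (hy : 0 < y) (ht : 0 < t) (hγ : 0 < γ) (hC : 0 < C) (hM₁ : 0 ≤ M₁)
    (hM₂ : 0 ≤ M₂) (hχ : ‖χ‖ ≤ 1) (hχ' : ‖χ'‖ ≤ 2 * C / y) (hχL : χ' ≠ 0 → L ≤ C * y)
    (hF : ‖F‖ ≤ C * L ^ γ * M₁) (hDF : ‖DF‖ ≤ C * (y ^ γ / y) * M₂) (hw : ‖w - P‖ ≤ P / 2)
    (hDw : ‖Dw‖ ≤ C * (P / y) * (y ^ γ / L ^ γ)) (hz : y * P / 2 ≤ z.im)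
    (hDz : ‖Dz‖ ≤ C * P * (y ^ γ / L ^ γ)) :
    ‖χ' * (F * w ^ (γ : ℂ) * Complex.exp (Complex.I * t * z)) +
      χ * (DF * w ^ (γ : ℂ) * Complex.exp (Complex.I * t * z) +
        F * (γ * w ^ ((γ : ℂ) - 1) * Dw) * Complex.exp (Complex.I * t * z) +
        F * w ^ (γ : ℂ) * (Complex.exp (Complex.I * t * z) * (Complex.I * t * Dz)))‖ ≤
    (2 * C * C * C ^ γ * 2 ^ γ + C * 2 ^ γ + 2 * C * C * γ * 2 ^ γ + 4 * C * C * 2 ^ γ) *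
      (M₁ + M₂) * (P ^ γ * (y ^ γ / y) * Real.exp (-(t * (y * P) / 4))) := by
  have hW := norm_cpow_le_of_norm_sub_le hP hγ.le hw
  have hW1 := norm_cpow_sub_one_le_of_norm_sub_le hP hγ.le hw
  have hE := norm_exp_I_mul_le ht.le hz
  set W := w ^ (γ : ℂ)
  set W1 := w ^ ((γ : ℂ) - 1)
  set E := Complex.exp (Complex.I * t * z)
  set e2 := Real.exp (-(t * (y * P / 2))) with he2
  set e4 := Real.exp (-(t * (y * P) / 4)) with he4
  have he24 : e2 ≤ e4 := by
    apply Real.exp_le_exp.2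
    have : 0 < t * (y * P) := by positivity
    linarith
  have hse : t * (y * P) * e2 ≤ 4 * e4 := by
    have := mul_exp_neg_half_le (s := t * (y * P))
    rwa [mul_div_assoc] at this
  have hLγ : 0 < L ^ γ := by positivity
  have hyγ : 0 < y ^ γ := by positivity
  have hPγ : 0 < P ^ γ := by positivity
  have h2γ : (0 : ℝ) < 2 ^ γ := by positivity
  have hCγ : 0 < C ^ γ := by positivity
  have he4p : 0 < e4 := Real.exp_pos _
  have he2p : 0 < e2 := Real.exp_pos _
  set X := P ^ γ * (y ^ γ / y) * e4 with hX
  have hX0 : 0 < X := by positivity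
  have hγn : ‖(γ : ℂ)‖ = γ := by rw [Complex.norm_real, Real.norm_of_nonneg hγ.le]
  have htn : ‖(t : ℂ)‖ = t := by rw [Complex.norm_real, Real.norm_of_nonneg ht.le]
  -- Where the cutoff varies, `L ≤ C * y`, so the factor `L ^ γ` from the average of `F` becomes `y
  -- ^ γ`.
  have T1 : ‖χ' * (F * W * E)‖ ≤ 2 * C * C * C ^ γ * 2 ^ γ * M₁ * X := by
    by_cases h0 : χ' = 0
    · rw [h0, zero_mul, norm_zero]
      positivity
    · have hLy : L ^ γ ≤ C ^ γ * y ^ γ := by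
        rw [← Real.mul_rpow hC.le hy.le]
        exact Real.rpow_le_rpow hL.le (hχL h0) hγ.le
      rw [norm_mul, norm_mul, norm_mul]
      calc _ ≤ 2 * C / y * (C * (C ^ γ * y ^ γ) * M₁ * (2 ^ γ * P ^ γ) * e4) := by
            gcongr
            · exact hF.trans (by gcongr)
            · exact hE.trans he24
        _ = _ := by rw [hX]; field_simp
  have T2 : ‖DF * W * E‖ ≤ C * 2 ^ γ * M₂ * X := by
    rw [norm_mul, norm_mul]
    calc _ ≤ C * (y ^ γ / y) * M₂ * (2 ^ γ * P ^ γ) * e4 := by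
          gcongr
          exact hE.trans he24
      _ = _ := by rw [hX]; field_simp
  -- Here and in the next term, `L ^ γ` from the average of `F` cancels `L ^ (-γ)` from the phase.
  have T3 : ‖F * (γ * W1 * Dw) * E‖ ≤ 2 * C * C * γ * 2 ^ γ * M₁ * X := by
    rw [norm_mul, norm_mul, norm_mul, norm_mul, hγn]
    calc _ ≤ C * L ^ γ * M₁ * (γ * (2 * 2 ^ γ * (P ^ γ / P)) * (C * (P / y) * (y ^ γ / L ^ γ))) *
          e4 := by
          gcongr
          exact hE.trans he24
      _ = _ := by rw [hX]; field_simp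
  have T4 : ‖F * W * (E * (Complex.I * t * Dz))‖ ≤ 4 * C * C * 2 ^ γ * M₁ * X := by
    rw [norm_mul, norm_mul, norm_mul, norm_mul, norm_mul, Complex.norm_I, one_mul, htn]
    calc _ ≤ C * L ^ γ * M₁ * (2 ^ γ * P ^ γ) * (e2 * (t * (C * P * (y ^ γ / L ^ γ)))) := by
          gcongr
      _ = C * C * 2 ^ γ * M₁ * (P ^ γ * (y ^ γ / y)) * (t * (y * P) * e2) := by field_simp
      _ ≤ C * C * 2 ^ γ * M₁ * (P ^ γ * (y ^ γ / y)) * (4 * e4) := by gcongr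
      _ = _ := by rw [hX]; ring
  have hsum : ‖χ * (DF * W * E + F * (γ * W1 * Dw) * E + F * W * (E * (Complex.I * t * Dz)))‖ ≤
      C * 2 ^ γ * M₂ * X + 2 * C * C * γ * 2 ^ γ * M₁ * X + 4 * C * C * 2 ^ γ * M₁ * X := by
    rw [norm_mul]
    refine (mul_le_of_le_one_left (norm_nonneg _) hχ).trans ?_
    exact (norm_add₃_le).trans (add_le_add (add_le_add T2 T3) T4)
  refine (norm_add_le _ _).trans ((add_le_add T1 hsum).trans ?_)
  have r1 : 0 ≤ 2 * C * C * C ^ γ * 2 ^ γ * M₂ * X := by positivity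
  have r2 : 0 ≤ C * 2 ^ γ * M₁ * X := by positivity
  have r3 : 0 ≤ 2 * C * C * γ * 2 ^ γ * M₂ * X := by positivity
  have r4 : 0 ≤ 4 * C * C * 2 ^ γ * M₂ * X := by positivity
  linarith

/-- This bound and that of `norm_deriv_product_le` only provide the integrability required by
Green's formula; they do not influence the constant of the theorem. -/
theorem norm_product_le {F w z χ : ℂ} {P y t γ N : ℝ} (hP : 0 < P) (hy : 0 < y) (ht : 0 < t)
    (hγ : 0 < γ) (hχ : ‖χ‖ ≤ 1) (hF : ‖F‖ * P ^ γ ≤ N) (hw : ‖w - P‖ ≤ P / 2)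
    (hz : y * P / 2 ≤ z.im) :
    ‖χ * (F * w ^ (γ : ℂ) * Complex.exp (Complex.I * t * z))‖ ≤ 2 ^ γ * N := by
  have hW := norm_cpow_le_of_norm_sub_le hP hγ.le hw
  have hE := norm_exp_I_mul_le ht.le hz
  have hE1 : Real.exp (-(t * (y * P / 2))) ≤ 1 := Real.exp_le_one_iff.2 (by
    have : 0 < t * (y * P / 2) := by positivity
    linarith)
  rw [norm_mul, norm_mul, norm_mul]
  calc _ ≤ 1 * (‖F‖ * (2 ^ γ * P ^ γ) * 1) := by
        gcongr
        exact hE.trans hE1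
    _ = 2 ^ γ * (‖F‖ * P ^ γ) := by ring
    _ ≤ _ := by gcongr

/-- Pointwise bound for the horizontal derivative of the extended function. -/
theorem norm_deriv_product_le {F DF w Dw z Dz χ χ' : ℂ} {P y t γ C N : ℝ} (hP : 0 < P)
    (hy : 0 < y) (ht : 0 < t) (hγ : 0 < γ) (hC : 0 < C) (hN : 0 ≤ N)
    (hχ : ‖χ‖ ≤ 1) (hχ' : ‖χ'‖ ≤ C / y) (hF : ‖F‖ * P ^ γ ≤ N)
    (hDF : ‖DF‖ * P ^ γ ≤ N / y) (hw : ‖w - P‖ ≤ P / 2)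
    (hDw : ‖Dw‖ ≤ C * (P / y)) (hz : y * P / 2 ≤ z.im) (hDz : ‖Dz‖ ≤ C * P) :
    ‖χ' * (F * w ^ (γ : ℂ) * Complex.exp (Complex.I * t * z)) +
      χ * (DF * w ^ (γ : ℂ) * Complex.exp (Complex.I * t * z) +
        F * (γ * w ^ ((γ : ℂ) - 1) * Dw) * Complex.exp (Complex.I * t * z) +
        F * w ^ (γ : ℂ) * (Complex.exp (Complex.I * t * z) * (Complex.I * t * Dz)))‖ ≤
    (C + 1 + 2 * γ * C + 4 * C) * 2 ^ γ * (1 / y * N) := by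
  have hW := norm_cpow_le_of_norm_sub_le hP hγ.le hw
  have hW1 := norm_cpow_sub_one_le_of_norm_sub_le hP hγ.le hw
  have hE := norm_exp_I_mul_le ht.le hz
  set W := w ^ (γ : ℂ)
  set W1 := w ^ ((γ : ℂ) - 1)
  set E := Complex.exp (Complex.I * t * z)
  set e2 := Real.exp (-(t * (y * P / 2))) with he2
  have he21 : e2 ≤ 1 := Real.exp_le_one_iff.2 (by
    have : 0 < t * (y * P / 2) := by positivity
    linarith)
  have hE1 : ‖E‖ ≤ 1 := hE.trans he21
  have hse : t * (y * P) * e2 ≤ 4 := by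
    have h1 := mul_exp_neg_half_le (s := t * (y * P))
    rw [mul_div_assoc] at h1
    have h2 : Real.exp (-(t * (y * P) / 4)) ≤ 1 := Real.exp_le_one_iff.2 (by
      have : 0 < t * (y * P) := by positivity
      linarith)
    linarith
  have hPγ : 0 < P ^ γ := by positivity
  have hγn : ‖(γ : ℂ)‖ = γ := by rw [Complex.norm_real, Real.norm_of_nonneg hγ.le]
  have htn : ‖(t : ℂ)‖ = t := by rw [Complex.norm_real, Real.norm_of_nonneg ht.le]
  have T1 : ‖χ' * (F * W * E)‖ ≤ C * 2 ^ γ * (1 / y * N) := by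
    rw [norm_mul, norm_mul, norm_mul]
    calc _ ≤ C / y * (‖F‖ * (2 ^ γ * P ^ γ) * 1) := by gcongr
      _ = C / y * 2 ^ γ * (‖F‖ * P ^ γ) := by ring
      _ ≤ C / y * 2 ^ γ * N := by gcongr
      _ = _ := by ring
  have T2 : ‖DF * W * E‖ ≤ 2 ^ γ * (1 / y * N) := by
    rw [norm_mul, norm_mul]
    calc _ ≤ ‖DF‖ * (2 ^ γ * P ^ γ) * 1 := by gcongr
      _ = 2 ^ γ * (‖DF‖ * P ^ γ) := by ring
      _ ≤ 2 ^ γ * (N / y) := by gcongr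
      _ = _ := by ring
  have T3 : ‖F * (γ * W1 * Dw) * E‖ ≤ 2 * γ * C * 2 ^ γ * (1 / y * N) := by
    rw [norm_mul, norm_mul, norm_mul, norm_mul, hγn]
    calc _ ≤ ‖F‖ * (γ * (2 * 2 ^ γ * (P ^ γ / P)) * (C * (P / y))) * 1 := by gcongr
      _ = 2 * γ * C * 2 ^ γ * (1 / y) * (‖F‖ * P ^ γ) := by field_simp
      _ ≤ 2 * γ * C * 2 ^ γ * (1 / y) * N := by gcongr
      _ = _ := by ring
  have T4 : ‖F * W * (E * (Complex.I * t * Dz))‖ ≤ 4 * C * 2 ^ γ * (1 / y * N) := by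
    rw [norm_mul, norm_mul, norm_mul, norm_mul, norm_mul, Complex.norm_I, one_mul, htn]
    calc _ ≤ ‖F‖ * (2 ^ γ * P ^ γ) * (e2 * (t * (C * P))) := by gcongr
      _ = C * 2 ^ γ * (1 / y) * (‖F‖ * P ^ γ) * (t * (y * P) * e2) := by field_simp
      _ ≤ C * 2 ^ γ * (1 / y) * N * 4 := by gcongr
      _ = _ := by ring
  have hsum : ‖χ * (DF * W * E + F * (γ * W1 * Dw) * E + F * W * (E * (Complex.I * t * Dz)))‖ ≤
      2 ^ γ * (1 / y * N) + 2 * γ * C * 2 ^ γ * (1 / y * N) + 4 * C * 2 ^ γ * (1 / y * N) := by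
    rw [norm_mul]
    refine (mul_le_of_le_one_left (norm_nonneg _) hχ).trans ?_
    exact (norm_add₃_le).trans (add_le_add (add_le_add T2 T3) T4)
  refine (norm_add_le _ _).trans ((add_le_add T1 hsum).trans (le_of_eq ?_))
  ring

/-- A Gamma integral, and the source of t^{-γ}. By scaling, the value does not depend on `P`, which
stands for φ'(x). -/
theorem lintegral_rpow_mul_exp {γ t P : ℝ} (hγ : 0 < γ) (ht : 0 < t) (hP : 0 < P) :
    ∫⁻ y in Ioi (0 : ℝ), ENNReal.ofReal (P ^ γ * (y ^ γ / y) * Real.exp (-(t * (y * P) / 4))) =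
      ENNReal.ofReal (4 ^ γ * Real.Gamma γ * (1 / t ^ γ)) := by
  have h1 := Real.integral_rpow_mul_exp_neg_mul_Ioi hγ (by positivity : 0 < t * P / 4)
  have hi : IntegrableOn (fun y : ℝ => y ^ (γ - 1) * Real.exp (-(t * P / 4 * y))) (Ioi 0) := by
    by_contra h
    rw [integral_undef h] at h1
    have : 0 < (1 / (t * P / 4)) ^ γ * Real.Gamma γ :=
      mul_pos (by positivity) (Real.Gamma_pos_of_pos hγ)
    linarith
  have e : ∀ y ∈ Ioi (0 : ℝ), ENNReal.ofReal (P ^ γ * (y ^ γ / y) *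
      Real.exp (-(t * (y * P) / 4))) =
      ENNReal.ofReal (P ^ γ * (y ^ (γ - 1) * Real.exp (-(t * P / 4 * y)))) := by
    intro y hy
    rw [Real.rpow_sub_one (ne_of_gt hy)]
    congr 1
    rw [mul_assoc]
    congr 4
    ring
  rw [setLIntegral_congr_fun measurableSet_Ioi e,
    ← ofReal_integral_eq_lintegral_ofReal (hi.const_mul _), integral_const_mul, h1]
  · congr 1
    rw [one_div, Real.inv_rpow (by positivity), Real.div_rpow (by positivity) (by norm_num),
      Real.mul_rpow ht.le hP.le]
    have : 0 < P ^ γ := by positivity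
    field_simp
  · refine (ae_restrict_iff' measurableSet_Ioi).2 (ae_of_all _ fun y hy => ?_)
    have : (0 : ℝ) < y := hy
    simp only [Pi.zero_apply]
    positivity

theorem rpow_mul_exp_neg_le {γ s : ℝ} (hγ : 0 < γ) (hs : 0 < s) :
    s ^ γ * Real.exp (-(s / 4)) ≤ (4 * γ) ^ γ := by
  have h1 : s / (4 * γ) ≤ Real.exp (s / (4 * γ)) := by
    linarith [Real.add_one_le_exp (s / (4 * γ))]
  have h2 : (s / (4 * γ)) ^ γ ≤ Real.exp (s / 4) := by
    refine (Real.rpow_le_rpow (by positivity) h1 hγ.le).trans (le_of_eq ?_)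
    rw [← Real.exp_mul]
    congr 1
    field_simp
  rw [Real.div_rpow hs.le (by positivity), div_le_iff₀ (by positivity)] at h2
  rw [Real.exp_neg, ← div_eq_mul_inv, div_le_iff₀ (Real.exp_pos _)]
  linarith

/-! ### Boundary values of averages. -/

/-- Lebesgue differentiation for averages against a kernel. -/
theorem ae_tendsto_kerAvg {k : ℝ → ℂ} (hk : IsKer k) (hk1 : ∫ u, k u = 1) {H : ℝ → ℂ}
    (hH : Integrable H) :
    ∀ᵐ x, Tendsto (fun y => kerAvg k H x y) (𝓝[>] 0) (𝓝 (H x)) := by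
  obtain ⟨C, hC0, hC⟩ := hk.exists_bound
  filter_upwards [IsUnifLocDoublingMeasure.ae_tendsto_average_norm_sub volume
    hH.locallyIntegrable 1] with x hx
  have h1 := hx (fun _ : ℝ => x) (fun y : ℝ => y) (l := 𝓝[>] 0) tendsto_id (by
    filter_upwards [self_mem_nhdsWithin] with y hy
    simpa using le_of_lt (mem_Ioi.1 hy))
  rw [tendsto_iff_norm_sub_tendsto_zero]
  have h2 := h1.const_mul (2 * C)
  rw [mul_zero] at h2
  refine squeeze_zero' (Eventually.of_forall fun y => norm_nonneg _) ?_ h2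
  filter_upwards [self_mem_nhdsWithin] with y hy
  have hy0 : 0 < y := hy
  have hi : IntegrableOn (fun s => H s - H x) (Metric.closedBall x y) :=
    hH.integrableOn.sub (integrableOn_const_closedBall _ x y)
  have e : kerAvg k H x y - H x = kerAvg k (fun s => H s - H x) x y := by
    rw [kerAvg_sub_const hk _ hy0 hH.integrableOn, hk1, one_mul]
  rw [e, kerAvg_eq_setIntegral hk _ hy0 Subset.rfl, norm_mul, norm_inv, Complex.norm_real,
    Real.norm_of_nonneg hy0.le, setAverage_eq, Real.volume_real_closedBall hy0.le, smul_eq_mul]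
  have h3 : ‖∫ s in Metric.closedBall x y, k ((s - x) / y) * (H s - H x)‖ ≤
      C * ∫ s in Metric.closedBall x y, ‖H s - H x‖ := by
    rw [← integral_const_mul]
    refine norm_integral_le_of_norm_le (hi.norm.const_mul C) (ae_of_all _ fun s => ?_)
    rw [norm_mul]
    gcongr
    exact hC _
  calc _ ≤ y⁻¹ * (C * ∫ s in Metric.closedBall x y, ‖H s - H x‖) := by gcongr
    _ = _ := by field_simp

/-- Small averages near a point of `Ω` only see a compact interval with rational endpoints contained
in `Ω`, and there are countably many of these. -/
theorem ae_tendsto_kerAvg_of_locallyIntegrableOn {k : ℝ → ℂ} (hk : IsKer k)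
    (hk1 : ∫ u, k u = 1) {Ω : Set ℝ} (hΩ : IsOpen Ω) {F : ℝ → ℂ}
    (hF : LocallyIntegrableOn F Ω) :
    ∀ᵐ x, x ∈ Ω → Tendsto (fun y => kerAvg k F x y) (𝓝[>] 0) (𝓝 (F x)) := by
  have key : ∀ q r : ℚ, Icc (q : ℝ) r ⊆ Ω → ∀ᵐ x : ℝ, x ∈ Ioo (q : ℝ) r →
      Tendsto (fun y => kerAvg k F x y) (𝓝[>] 0) (𝓝 (F x)) := by
    intro q r hqr
    have hi : Integrable ((Icc (q : ℝ) r).indicator F) :=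
      (integrable_indicator_iff measurableSet_Icc).2
        (hF.integrableOn_compact_subset hqr isCompact_Icc)
    filter_upwards [ae_tendsto_kerAvg hk hk1 hi] with x hx hxm
    rw [indicator_of_mem (Ioo_subset_Icc_self hxm)] at hx
    refine hx.congr' ?_
    have hpos : 0 < min (x - q) (r - x) := lt_min (by linarith [hxm.1]) (by linarith [hxm.2])
    filter_upwards [Ioo_mem_nhdsGT hpos] with y hy
    refine kerAvg_congr_ae (Ω := Icc (q : ℝ) r) hk ?_ hy.1 ?_
    · filter_upwards [ae_restrict_mem measurableSet_Icc] with s hs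
      rw [indicator_of_mem hs]
    · rw [Real.closedBall_eq_Icc]
      have h1 := hy.2.le.trans (min_le_left _ _)
      have h2 := hy.2.le.trans (min_le_right _ _)
      exact Icc_subset_Icc (by linarith) (by linarith)
  have key' : ∀ᵐ x : ℝ, ∀ q r : ℚ, Icc (q : ℝ) r ⊆ Ω → x ∈ Ioo (q : ℝ) r →
      Tendsto (fun y => kerAvg k F x y) (𝓝[>] 0) (𝓝 (F x)) := by
    simp only [ae_all_iff]
    exact key
  filter_upwards [key'] with x hx hxΩ
  obtain ⟨ε, hε, hball⟩ := Metric.isOpen_iff.1 hΩ x hxΩ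
  obtain ⟨q, hq1, hq2⟩ := exists_rat_btwn (by linarith : x - ε < x)
  obtain ⟨r, hr1, hr2⟩ := exists_rat_btwn (by linarith : x < x + ε)
  refine hx q r ?_ ⟨hq2, hr1⟩
  rw [Real.ball_eq_Ioo] at hball
  exact (Icc_subset_Ioo hq1 hr2).trans hball

theorem tendsto_kerAvg_of_continuousOn {k : ℝ → ℂ} (hk : IsKer k) (hk1 : ∫ u, k u = 1)
    {Ω : Set ℝ} (hΩ : IsOpen Ω) {F : ℝ → ℂ} (hF : ContinuousOn F Ω) {x : ℝ} (hx : x ∈ Ω) :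
    Tendsto (fun y => kerAvg k F x y) (𝓝[>] 0) (𝓝 (F x)) := by
  obtain ⟨C, hC0, hC⟩ := hk.exists_bound
  rw [Metric.tendsto_nhds]
  intro ε hε
  have h1 : ∀ᶠ s in 𝓝 x, ‖F s - F x‖ ≤ ε / (4 * C) := by
    have := (hF.continuousAt (hΩ.mem_nhds hx)).eventually
      (Metric.closedBall_mem_nhds (F x) (by positivity : 0 < ε / (4 * C)))
    filter_upwards [this] with s hs
    rwa [← dist_eq_norm]
  obtain ⟨d, hd, hball⟩ := Metric.eventually_nhds_iff.1 (h1.and (hΩ.mem_nhds hx))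
  filter_upwards [Ioo_mem_nhdsGT hd] with y hy
  have hmem : ∀ s ∈ Metric.closedBall x y, dist s x < d := fun s hs =>
    (Metric.mem_closedBall.1 hs).trans_lt hy.2
  have hi : IntegrableOn F (Metric.closedBall x y) :=
    (hF.mono fun s hs => (hball (hmem s hs)).2).integrableOn_compact (isCompact_closedBall x y)
  have h2 := norm_kerAvg_sub_const_le hk hC (F x) hy.1 hi fun s hs => (hball (hmem s hs)).1
  rw [hk1, one_mul] at h2
  rw [dist_eq_norm]
  refine h2.trans_lt ?_
  have : 2 * C * (ε / (4 * C)) = ε / 2 := by field_simp; norm_num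
  linarith

/-! ### Maximal functions of `f` and of the weighted quotient. -/

theorem measurable_maxFn_of_aemeasurable {f : ℝ → ℝ≥0∞} (hf : AEMeasurable f) :
    Measurable (maxFn f) := by
  rw [maxFn_congr_ae hf.ae_eq_mk]
  exact measurable_maxFn hf.measurable_mk

theorem lintegral_maxFn_rpow_le_of_aemeasurable {p : ℝ} (hp : 1 < p) :
    ∃ C : ℝ≥0, ∀ f : ℝ → ℝ≥0∞, AEMeasurable f →
      (∫⁻ x, maxFn f x ^ p) ^ (1 / p) ≤ C * (∫⁻ x, f x ^ p) ^ (1 / p) := by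
  obtain ⟨C, hC⟩ := lintegral_maxFn_rpow_le hp
  refine ⟨C ^ (1 / p), fun f hf => ?_⟩
  have hp0 : 0 < p := by linarith
  rw [maxFn_congr_ae hf.ae_eq_mk]
  refine (ENNReal.rpow_le_rpow (hC _ hf.measurable_mk) (by positivity)).trans ?_
  rw [ENNReal.mul_rpow_of_nonneg _ _ (by positivity), ENNReal.coe_rpow_of_nonneg _ (by positivity)]
  refine le_of_eq ?_
  congr 2
  refine lintegral_congr_ae ?_
  filter_upwards [hf.ae_eq_mk] with x hx
  rw [hx]

theorem norm_le_mul_toReal {z : ℂ} {a : ℝ} {m : ℝ≥0∞} (ha : 0 ≤ a) (hm : m ≠ ⊤)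
    (h : ‖z‖ₑ ≤ ENNReal.ofReal a * m) : ‖z‖ ≤ a * m.toReal := by
  have h1 := ENNReal.toReal_mono (ENNReal.mul_ne_top ENNReal.ofReal_ne_top hm) h
  rwa [toReal_enorm, ENNReal.toReal_mul, ENNReal.toReal_ofReal ha] at h1

theorem enorm_le_of_norm_le {z : ℂ} {a : ℝ} {m : ℝ≥0∞} (ha : 0 ≤ a) (hm : m ≠ ⊤)
    (h : ‖z‖ ≤ a * m.toReal) : ‖z‖ₑ ≤ ENNReal.ofReal a * m := by
  rw [← ofReal_norm, ← ENNReal.ofReal_toReal hm, ← ENNReal.ofReal_mul ha]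
  exact ENNReal.ofReal_le_ofReal h

theorem hasDerivAt_mul_cpow_mul_exp {F W Z : ℝ → ℂ} {F' W' Z' : ℂ} {x : ℝ} (γ t : ℝ)
    (hF : HasDerivAt F F' x) (hW : HasDerivAt W W' x) (hZ : HasDerivAt Z Z' x)
    (hre : 0 < (W x).re) :
    HasDerivAt (fun x => F x * W x ^ (γ : ℂ) * Complex.exp (Complex.I * t * Z x))
      (F' * W x ^ (γ : ℂ) * Complex.exp (Complex.I * t * Z x) +
        F x * (γ * W x ^ ((γ : ℂ) - 1) * W') * Complex.exp (Complex.I * t * Z x) +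
        F x * W x ^ (γ : ℂ) * (Complex.exp (Complex.I * t * Z x) * (Complex.I * t * Z'))) x := by
  have h1 : HasDerivAt (fun x => W x ^ (γ : ℂ)) (γ * W x ^ ((γ : ℂ) - 1) * W') x := by
    have := ((hasDerivAt_id (W x)).cpow_const (c := (γ : ℂ)) (Or.inl hre)).comp x hW
    simp only [id, mul_one] at this
    exact this
  have h2 : HasDerivAt (fun x => Complex.exp (Complex.I * t * Z x))
      (Complex.exp (Complex.I * t * Z x) * (Complex.I * t * Z')) x :=
    (Complex.hasDerivAt_exp _).comp x (hZ.const_mul (Complex.I * t))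
  refine ((hF.mul h1).mul h2).congr_deriv ?_
  simp only [Pi.mul_apply]
  ring

section

variable {f : ℝ → ℂ} {Ω : Set ℝ} {φ ℓ : ℝ → ℝ} {γ : ℝ}

theorem enorm_div_rpow (f : ℝ → ℂ) {φ : ℝ → ℝ} (γ : ℝ) {s : ℝ} (hs : 0 < deriv φ s) :
    ‖f s / ((deriv φ s ^ γ : ℝ) : ℂ)‖ₑ = ENNReal.ofReal (1 / deriv φ s ^ γ) * ‖f s‖ₑ := by
  have h : 0 < deriv φ s ^ γ := by positivity
  rw [← ofReal_norm, norm_div, Complex.norm_real, Real.norm_of_nonneg h.le, ← ofReal_norm,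
    ← ENNReal.ofReal_mul (by positivity)]
  congr 1
  ring

theorem enorm_div_rpow_le (hγ : 0 ≤ γ) {P s : ℝ} (hP : 0 < P) (hs : |deriv φ s - P| ≤ P / 2) :
    ‖f s / ((deriv φ s ^ γ : ℝ) : ℂ)‖ₑ ≤ ENNReal.ofReal (2 ^ γ / P ^ γ) * ‖f s‖ₑ := by
  have h1 : P / 2 ≤ deriv φ s := by linarith [(abs_le.1 hs).1]
  rw [enorm_div_rpow f γ (by linarith)]
  gcongr ENNReal.ofReal ?_ * _
  rw [div_le_div_iff₀ (Real.rpow_pos_of_pos (by linarith) _) (by positivity), one_mul,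
    ← Real.mul_rpow (by norm_num) (by linarith)]
  exact Real.rpow_le_rpow hP.le (by linarith) hγ

/-- Inserting ℓ^γ/ℓ^γ gains the factor `L ^ γ` that compensates the loss in the derivative bounds
for the phase; this is where the first norm in the theorem comes from. -/
theorem enorm_div_rpow_le_weight (hγ : 0 ≤ γ) {L s : ℝ} (hs : 0 < deriv φ s) (hℓ : 0 < ℓ s)
    (hL : ℓ s ≤ 2 * L) :
    ‖f s / ((deriv φ s ^ γ : ℝ) : ℂ)‖ₑ ≤ ENNReal.ofReal (2 ^ γ * L ^ γ) *
      (‖f s‖ₑ / ENNReal.ofReal ((deriv φ s * ℓ s) ^ γ)) := by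
  have hL0 : 0 < L := by linarith
  have h1 : ENNReal.ofReal (1 / deriv φ s ^ γ) =
      ENNReal.ofReal (ℓ s ^ γ) * (ENNReal.ofReal ((deriv φ s * ℓ s) ^ γ))⁻¹ := by
    rw [← ENNReal.ofReal_inv_of_pos (by positivity), ← ENNReal.ofReal_mul (by positivity),
      Real.mul_rpow hs.le hℓ.le]
    congr 1
    have : 0 < deriv φ s ^ γ := by positivity
    field_simp
  rw [enorm_div_rpow f γ hs, h1, ENNReal.div_eq_inv_mul, mul_assoc]
  gcongr
  rw [← Real.mul_rpow (by norm_num) hL0.le]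
  exact Real.rpow_le_rpow hℓ.le hL hγ

end

theorem rpow_lintegral_const_mul {p : ℝ} (hp : 0 < p) {a : ℝ≥0∞} (ha : a ≠ ⊤) (h : ℝ → ℝ≥0∞) :
    (∫⁻ x, (a * h x) ^ p) ^ (1 / p) = a * (∫⁻ x, h x ^ p) ^ (1 / p) := by
  simp_rw [ENNReal.mul_rpow_of_nonneg _ _ hp.le]
  rw [lintegral_const_mul' _ _ (ENNReal.rpow_ne_top_of_nonneg hp.le ha),
    ENNReal.mul_rpow_of_nonneg _ _ (by positivity), ← ENNReal.rpow_mul, mul_one_div_cancel hp.ne',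
    ENNReal.rpow_one]

theorem lintegral_indicator_rpow {p : ℝ} (hp : 0 < p) {Ω : Set ℝ} (hΩ : MeasurableSet Ω)
    (h : ℝ → ℝ≥0∞) : ∫⁻ x, Ω.indicator h x ^ p = ∫⁻ x in Ω, h x ^ p := by
  rw [← lintegral_indicator hΩ]
  congr 1
  funext x
  by_cases hx : x ∈ Ω <;> simp [hx, hp]

/-- The weighted maximal function has norm controlled by the weighted norm of `f`, and `f`
vanishes almost everywhere on the zero set of the weight. -/
theorem exists_weight_majorant {p : ℝ} (hp : 1 < p) : ∃ C : ℝ≥0, ∀ (Ω : Set ℝ) (φ ℓ : ℝ → ℝ)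
    (γ : ℝ) (f : ℝ → ℂ), IsOpen Ω → Measurable (Ω.indicator ℓ) →
      AEStronglyMeasurable f (volume.restrict Ω) →
      Measurable (maxFn (Ω.indicator fun x =>
        ‖f x‖ₑ / ENNReal.ofReal ((deriv φ x * ℓ x) ^ γ))) ∧
      (∫⁻ x, maxFn (Ω.indicator fun x =>
        ‖f x‖ₑ / ENNReal.ofReal ((deriv φ x * ℓ x) ^ γ)) x ^ p) ^ (1 / p) ≤
          C * weightedNorm Ω φ ℓ p γ f ∧
      (0 < γ → weightedNorm Ω φ ℓ p γ f ≠ ⊤ → ∀ᵐ x, x ∈ Ω → ℓ x = 0 → f x = 0) := by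
  have hp0 : 0 < p := by linarith
  obtain ⟨C, hC⟩ := lintegral_maxFn_rpow_le_of_aemeasurable hp
  refine ⟨C, fun Ω φ ℓ γ f hΩ hL hf => ?_⟩
  set V : ℝ → ℝ≥0∞ := fun x => ‖f x‖ₑ / ENNReal.ofReal ((deriv φ x * ℓ x) ^ γ) with hV
  have hVm : AEMeasurable V (volume.restrict Ω) := by
    have h1 : Measurable fun x => ENNReal.ofReal ((deriv φ x * Ω.indicator ℓ x) ^ γ) :=
      (((measurable_deriv φ).mul hL).pow_const γ).ennreal_ofReal
    refine hf.enorm.div (h1.aemeasurable.congr ?_)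
    filter_upwards [ae_restrict_mem hΩ.measurableSet] with x hx
    rw [indicator_of_mem hx]
  have hVi : AEMeasurable (Ω.indicator V) := (aemeasurable_indicator_iff hΩ.measurableSet).2 hVm
  refine ⟨measurable_maxFn_of_aemeasurable hVi, ?_, fun hγ hfin => ?_⟩
  · refine (hC _ hVi).trans (le_of_eq ?_)
    rw [lintegral_indicator_rpow hp0 hΩ.measurableSet, weightedNorm]
  · have h1 : ∫⁻ x in Ω, V x ^ p ≠ ⊤ := fun h => hfin (by
      rw [weightedNorm]
      change (∫⁻ x in Ω, V x ^ p) ^ (1 / p) = ⊤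
      rw [h, ENNReal.top_rpow_of_pos (by positivity)])
    have h2 := ae_lt_top' (hVm.pow_const p) h1
    rw [ae_restrict_iff' hΩ.measurableSet] at h2
    filter_upwards [h2] with x hx hxΩ hℓ
    have h3 := hx hxΩ
    by_contra hne
    rw [hV] at h3
    simp only [hℓ, mul_zero, Real.zero_rpow hγ.ne', ENNReal.ofReal_zero] at h3
    rw [ENNReal.div_zero (by simpa using hne), ENNReal.top_rpow_of_pos hp0] at h3
    exact lt_irrefl _ h3

/-! ### The almost analytic extension. -/

set_option maxHeartbeats 1600000 in
/-- An almost analytic extension of `e^{itφ} f` to the upper half plane, which decays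
exponentially in `t φ' y` at scales below `ℓ` and vanishes at larger scales. -/
theorem exists_extension (κ : ℕ) {α A c p : ℝ} (hp : 1 < p) (hα : 0 ≤ α) (hα1 : α ≤ 1)
    (hγ : 0 < κ + α) (hA : 0 < A) (hc : 0 < c) : ∃ K : ℝ≥0, ∀ (Ω : Set ℝ) (φ ℓ : ℝ → ℝ),
    IsOpen Ω → IsPhase κ α Ω φ → IsAdmissible κ α A c Ω φ ℓ → ∀ f g : ℝ → ℂ,
    MemLp f (ENNReal.ofReal p) (volume.restrict Ω) →
    LocallyIntegrableOn (fun x => f x / ((deriv φ x ^ ((κ : ℝ) + α) : ℝ) : ℂ)) Ω →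
    IsWeakDeriv Ω ⌊(κ : ℝ) + α⌋₊ (fun x => f x / ((deriv φ x ^ ((κ : ℝ) + α) : ℝ) : ℂ)) g →
    weightedNorm Ω φ ℓ p (κ + α) f ≠ ⊤ → fracSeminorm Ω ℓ p (κ + α - ⌊(κ : ℝ) + α⌋₊) g ≠ ⊤ →
    ∀ t : ℝ, 0 < t → ∃ (G Gx Gy : ℝ → ℝ → ℂ) (B : ℝ → ℝ≥0∞) (k : ℝ → ℝ → ℝ≥0∞) (m : ℝ → ℝ≥0∞),
      (∀ x y, 0 < y → HasDerivAt (fun x => G x y) (Gx x y) x) ∧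
      (∀ x y, 0 < y → HasDerivAt (fun y => G x y) (Gy x y) y) ∧
      Measurable B ∧ ∫⁻ x, B x ^ p ≠ ⊤ ∧
      (∀ x y, 0 < y → ‖G x y‖ₑ ≤ B x) ∧
      (∀ x y, 0 < y → ‖Gx x y‖ₑ ≤ ENNReal.ofReal (1 / y) * B x) ∧
      (∀ x y, 0 < y → ‖Gx x y + Complex.I * Gy x y‖ₑ ≤ ENNReal.ofReal (1 / y) * B x) ∧
      Measurable (Function.uncurry k) ∧
      (∀ x y, 0 < y → ‖Gx x y + Complex.I * Gy x y‖ₑ ≤ k x y) ∧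
      (∀ᵐ x, Tendsto (fun y => G x y) (𝓝[>] 0)
        (𝓝 (Ω.indicator (fun x => Complex.exp (Complex.I * t * φ x) * f x) x))) ∧
      (∀ x, ∀ᶠ y in atTop, G x y = 0) ∧
      Measurable m ∧
      (∀ x, ∫⁻ y in Ioi (0 : ℝ), k x y ≤
        K * ENNReal.ofReal (1 / t ^ ((κ : ℝ) + α)) * m x) ∧
      (∫⁻ x, m x ^ p) ^ (1 / p) ≤ K * (weightedNorm Ω φ ℓ p (κ + α) f +
        fracSeminorm Ω ℓ p (κ + α - ⌊(κ : ℝ) + α⌋₊) g) := by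
  have hp0 : 0 < p := by linarith
  obtain ⟨η, ζ, a, hη⟩ := exists_isExtensionKer (K := κ + 1) (by omega)
  obtain ⟨D₀, hD₀, hη₀⟩ := hη.isKer.exists_bound
  obtain ⟨D₁, hD₁, hη₁⟩ := hη.isKer.deriv.exists_bound
  obtain ⟨Mφ, Cφ, hMφ, hCφ, hphase⟩ := exists_phaseBounds κ hα hγ hA hc hη
  -- The 5 leaves room: on the support of the cutoff the ball of radius 2y lies in `Ω`, as needed to
  -- differentiate the averages, and 4y < L, as needed for the fractional maximal function.
  obtain ⟨Cχ, hCχ, hcut⟩ := exists_cutoff (max Mφ 5) (by positivity)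
  have hfloor : ⌊(κ : ℝ) + α⌋₊ ≤ κ + 1 := by
    refine Nat.floor_le_of_le ?_
    push_cast
    linarith
  obtain ⟨C₂, hmaj⟩ := exists_dbar_majorant (κ := κ) hp hγ.le hfloor hη.contDiff hη.eq_zero
  obtain ⟨C₁, hwt⟩ := exists_weight_majorant hp
  obtain ⟨C₀, hmax⟩ := lintegral_maxFn_rpow_le_of_aemeasurable hp
  set γ : ℝ := (κ : ℝ) + α with hγdef
  have h2γ : (0 : ℝ) < 2 ^ γ := by positivity
  obtain ⟨C, hC, hCCχ, hCD₀, hCa, hCφ1, hCφ2⟩ : ∃ C : ℝ, 0 < C ∧ Cχ ≤ C ∧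
      2 * D₀ * 2 ^ γ ≤ C ∧ ‖a‖ * C₂ ≤ C ∧ ‖a‖ * Cφ ≤ C ∧ Cφ ≤ C := by
    have h1 : 0 ≤ ‖a‖ * C₂ := by positivity
    have h2 : 0 ≤ ‖a‖ * Cφ := by positivity
    have h3 : 0 < 2 * D₀ * 2 ^ γ := by positivity
    exact ⟨Cχ + 2 * D₀ * 2 ^ γ + ‖a‖ * C₂ + ‖a‖ * Cφ + Cφ, by positivity, by linarith, by linarith,
      by linarith, by linarith, by linarith⟩
  obtain ⟨D, hD, hDD₀, hDD₁⟩ : ∃ D : ℝ, 0 < D ∧ 2 * D₀ * 2 ^ γ ≤ D ∧ 2 * D₁ * 2 ^ γ ≤ D :=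
    ⟨2 * D₀ * 2 ^ γ + 2 * D₁ * 2 ^ γ, by positivity, le_add_of_nonneg_right (by positivity),
      le_add_of_nonneg_left (by positivity)⟩
  set Q : ℝ := 2 * C * C * C ^ γ * 2 ^ γ + C * 2 ^ γ + 2 * C * C * γ * 2 ^ γ + 4 * C * C * 2 ^ γ
    with hQ
  have hQ0 : 0 < Q := by positivity
  set R : ℝ := (C + 1 + 2 * γ * C + 4 * C) * 2 ^ γ * D with hR
  have hR0 : 0 < R := by positivity
  have hRD : 2 ^ γ * D ≤ R := by
    rw [hR]
    gcongr
    have : 0 ≤ C + 2 * γ * C + 4 * C := by positivity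
    nlinarith
  set T : ℝ := 4 ^ γ * Real.Gamma γ with hT
  have hT0 : 0 < T := mul_pos (by positivity) (Real.Gamma_pos_of_pos hγ)
  refine ⟨Real.toNNReal (Q * T) + (C₁ + C₂), fun Ω φ ℓ hΩ hφ hℓ f g hf hFloc hw hWfin hSfin t ht => ?_⟩
  set L := Ω.indicator ℓ with hLdef
  set F : ℝ → ℂ := fun x => f x / ((deriv φ x ^ γ : ℝ) : ℂ) with hF
  set P : ℝ → ℝ := Ω.indicator (deriv φ) with hP
  have hLlip := hℓ.abs_indicator_sub_le hΩ
  have hLc : Continuous L := by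
    have : LipschitzWith 1 L := LipschitzWith.of_dist_le_mul fun x y => by
      simpa [Real.dist_eq] using hLlip x y
    exact this.continuous
  obtain ⟨χ, χx, χy, dχx, dχy, hχ1, hχlow, hχhigh, hχb⟩ := hcut L hℓ.indicator_nonneg hLlip
  obtain ⟨m₂, hm₂m, hm₂n, hm₂⟩ := hmaj Ω ℓ F g hΩ hLc.measurable
    (fun x y hy _ => hℓ.closedBall_subset hΩ hy) hw
  obtain ⟨hm₁m, hm₁n, hzero⟩ := hwt Ω φ ℓ γ f hΩ hLc.measurable hf.1
  set V : ℝ → ℝ≥0∞ := Ω.indicator fun x => ‖f x‖ₑ / ENNReal.ofReal ((deriv φ x * ℓ x) ^ γ) with hV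
  set m₁ := maxFn V with hm₁
  set N : ℝ → ℝ≥0∞ := maxFn (Ω.indicator fun x => ‖f x‖ₑ) with hN
  have hNae : AEMeasurable (Ω.indicator fun x => ‖f x‖ₑ) :=
    (aemeasurable_indicator_iff hΩ.measurableSet).2 hf.1.enorm
  have hNm : Measurable N := measurable_maxFn_of_aemeasurable hNae
  have hNn : (∫⁻ x, N x ^ p) ^ (1 / p) ≠ ⊤ := by
    refine ne_top_of_le_ne_top ?_ (hmax _ hNae)
    rw [lintegral_indicator_rpow hp0 hΩ.measurableSet, ← eLpNorm_ofReal_exponent hp0]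
    exact ENNReal.mul_ne_top ENNReal.coe_ne_top hf.2.ne
  set m : ℝ → ℝ≥0∞ := fun x => m₁ x + m₂ x with hm
  have hmm : Measurable m := hm₁m.add hm₂m
  have hmn : (∫⁻ x, m x ^ p) ^ (1 / p) ≤ (C₁ + C₂) * (weightedNorm Ω φ ℓ p γ f +
      fracSeminorm Ω ℓ p (γ - ⌊γ⌋₊) g) := by
    refine (ENNReal.lintegral_Lp_add_le hm₁m.aemeasurable hm₂m.aemeasurable hp.le).trans
      ((add_le_add hm₁n hm₂n).trans ?_)
    rw [add_mul, mul_add, mul_add]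
    exact add_le_add le_self_add le_add_self
  have hmfin : (∫⁻ x, m x ^ p) ^ (1 / p) ≠ ⊤ :=
    ne_top_of_le_ne_top (ENNReal.mul_ne_top (by simp) (ENNReal.add_ne_top.2 ⟨hWfin, hSfin⟩)) hmn
  set W : ℝ → ℂ := fun s => ((deriv φ s : ℝ) : ℂ) with hW
  set Z : ℝ → ℂ := fun s => (φ s : ℂ) with hZ
  set kx : (ℝ → ℂ) → ℝ → ℝ → ℂ := fun H x y => -(y : ℂ)⁻¹ * kerAvg (deriv η) H x y with hkx
  set ky : (ℝ → ℂ) → ℝ → ℝ → ℂ := fun H x y =>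
    -(y : ℂ)⁻¹ * kerAvg (deriv fun u : ℝ => (u : ℂ) * η u) H x y with hky
  -- The three factors of F (φ')^γ e^{itφ} are averaged separately, since each has its own
  -- regularity. The power is holomorphic because the average of φ' stays within φ'(x)/2 of φ'(x).
  set E : ℝ → ℝ → ℂ := fun x y => kerAvg η F x y * kerAvg η W x y ^ (γ : ℂ) *
    Complex.exp (Complex.I * t * kerAvg η Z x y) with hE
  set dE : ℝ → ℝ → ℂ → ℂ → ℂ → ℂ := fun x y F' W' Z' =>
    F' * kerAvg η W x y ^ (γ : ℂ) * Complex.exp (Complex.I * t * kerAvg η Z x y) +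
      kerAvg η F x y * (γ * kerAvg η W x y ^ ((γ : ℂ) - 1) * W') *
        Complex.exp (Complex.I * t * kerAvg η Z x y) +
      kerAvg η F x y * kerAvg η W x y ^ (γ : ℂ) *
        (Complex.exp (Complex.I * t * kerAvg η Z x y) * (Complex.I * t * Z')) with hdE
  set G : ℝ → ℝ → ℂ := fun x y => (χ x y : ℂ) * E x y with hG
  set Gx : ℝ → ℝ → ℂ := fun x y => (χx x y : ℂ) * E x y +
    (χ x y : ℂ) * dE x y (kx F x y) (kx W x y) (kx Z x y) with hGx
  set Gy : ℝ → ℝ → ℂ := fun x y => (χy x y : ℂ) * E x y +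
    (χ x y : ℂ) * dE x y (ky F x y) (ky W x y) (ky Z x y) with hGy
  have hWc : ContinuousOn W Ω :=
    Complex.continuous_ofReal.comp_continuousOn (hφ.continuousOn_deriv hΩ)
  have hZc : ContinuousOn Z Ω := Complex.continuous_ofReal.comp_continuousOn hφ.continuousOn
  have hgood : ∀ x y : ℝ, 0 < y → max Mφ 5 * y ≤ L x → x ∈ Ω ∧ 4 * y < L x ∧
      Metric.closedBall x (2 * y) ⊆ Ω ∧ PhaseBounds κ γ Cφ η ζ φ (L x) x y ∧ 0 < deriv φ x ∧
      ∀ H, (H = F ∨ H = W ∨ H = Z) → IntegrableOn H (Metric.closedBall x (2 * y)) := by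
    intro x y hy hxy
    have h5 : 5 * y ≤ L x := (mul_le_mul_of_nonneg_right (le_max_right _ _) hy.le).trans hxy
    have hsub : Metric.closedBall x (2 * y) ⊆ Ω := hℓ.closedBall_subset hΩ (by
      rw [← hLdef]; linarith)
    have hx : x ∈ Ω := hsub (Metric.mem_closedBall_self (by positivity))
    refine ⟨hx, by linarith, hsub, hphase Ω φ ℓ hΩ hφ hℓ x y hy
      ((mul_le_mul_of_nonneg_right (le_max_left _ _) hy.le).trans hxy), hφ.deriv_pos x hx, ?_⟩
    rintro H (rfl | rfl | rfl)
    · exact hFloc.integrableOn_compact_subset hsub (isCompact_closedBall _ _)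
    · exact (hWc.mono hsub).integrableOn_compact (isCompact_closedBall _ _)
    · exact (hZc.mono hsub).integrableOn_compact (isCompact_closedBall _ _)
  have hGlow : ∀ x y, 0 < y → L x ≤ max Mφ 5 * y → G x y = 0 ∧ Gx x y = 0 ∧ Gy x y = 0 := by
    intro x y hy hxy
    obtain ⟨h1, h2, h3⟩ := hχlow x y hy hxy
    simp [hG, hGx, hGy, h1, h2, h3]
  have dGx : ∀ x y, 0 < y → HasDerivAt (fun x => G x y) (Gx x y) x := by
    intro x y hy
    -- Under the strict inequality `G` vanishes in a neighbourhood; otherwise, including the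
    -- borderline case, all averages are defined and the product rule applies.
    rcases lt_or_ge (L x) (max Mφ 5 * y) with hxy | hxy
    · rw [(hGlow x y hy hxy.le).2.1]
      refine (hasDerivAt_const x (0 : ℂ)).congr_of_eventuallyEq ?_
      filter_upwards [hLc.continuousAt.eventually (gt_mem_nhds hxy)] with v hv
      exact (hGlow v y hy (le_of_lt hv)).1
    · obtain ⟨hx, -, -, hb, hPx, hi⟩ := hgood x y hy hxy
      have hd := fun H hH => hasDerivAt_kerAvg_left hη.isKer hy (by linarith : y < 2 * y) (hi H hH)
      exact (dχx x y hy).ofReal_comp.mul (hasDerivAt_mul_cpow_mul_exp γ t (hd F (by simp))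
        (hd W (by simp)) (hd Z (by simp)) (re_pos_of_norm_sub_le hPx hb.norm_sub_le))
  have dGy : ∀ x y, 0 < y → HasDerivAt (fun y => G x y) (Gy x y) y := by
    intro x y hy
    rcases lt_or_ge (L x) (max Mφ 5 * y) with hxy | hxy
    · rw [(hGlow x y hy hxy.le).2.2]
      refine (hasDerivAt_const y (0 : ℂ)).congr_of_eventuallyEq ?_
      have hc : ContinuousAt (fun v : ℝ => max Mφ 5 * v) y := by fun_prop
      filter_upwards [hc.eventually (lt_mem_nhds hxy), lt_mem_nhds hy] with v hv hv0
      exact (hGlow x v hv0 (le_of_lt hv)).1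
    · obtain ⟨hx, -, -, hb, hPx, hi⟩ := hgood x y hy hxy
      have hd := fun H hH => hasDerivAt_kerAvg_right hη.isKer hy (by linarith : y < 2 * y) (hi H hH)
      exact (dχy x y hy).ofReal_comp.mul (hasDerivAt_mul_cpow_mul_exp γ t (hd F (by simp))
        (hd W (by simp)) (hd Z (by simp)) (re_pos_of_norm_sub_le hPx hb.norm_sub_le))
  have hdbar : ∀ x y, Gx x y + Complex.I * Gy x y =
      ((χx x y : ℂ) + Complex.I * χy x y) * E x y +
        (χ x y : ℂ) * dE x y (kx F x y + Complex.I * ky F x y) (kx W x y + Complex.I * ky W x y)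
          (kx Z x y + Complex.I * ky Z x y) := by
    intro x y
    simp only [hGx, hGy, hdE]
    ring
  have hχn : ∀ x y, ‖(χ x y : ℂ)‖ ≤ 1 := fun x y => by
    rw [Complex.norm_real]; exact hχ1 x y
  have hχxn : ∀ x y, 0 < y → ‖(χx x y : ℂ)‖ ≤ C / y := fun x y hy => by
    rw [Complex.norm_real]
    exact (hχb x y hy).1.trans (div_le_div_of_nonneg_right hCCχ hy.le)
  have hχyn : ∀ x y, 0 < y → ‖(χy x y : ℂ)‖ ≤ C / y := fun x y hy => by
    rw [Complex.norm_real]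
    exact (hχb x y hy).2.trans (div_le_div_of_nonneg_right hCCχ hy.le)
  have hynorm : ∀ y : ℝ, 0 < y → ‖-(y : ℂ)⁻¹‖ = 1 / y := fun y hy => by
    rw [norm_neg, norm_inv, Complex.norm_real, Real.norm_of_nonneg hy.le, one_div]
  -- As φ' is nearly constant on the ball, the averages of `F` times φ'(x)^γ are controlled by the
  -- unweighted maximal function of `f`.
  have hFN : ∀ {k : ℝ → ℂ} {D' : ℝ}, IsKer k → (∀ u, ‖k u‖ ≤ D') → 0 < D' →
      2 * D' * 2 ^ γ ≤ D → ∀ x y : ℝ, 0 < y → max Mφ 5 * y ≤ L x → N x ≠ ⊤ →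
      ‖kerAvg k F x y‖ * deriv φ x ^ γ ≤ D * (N x).toReal := by
    intro k D' hk hD' hD'0 hle x y hy hxy hNx
    obtain ⟨hx, hyL, hsub, hb, hPx, hi⟩ := hgood x y hy hxy
    have hsub' := (Metric.closedBall_subset_closedBall (by linarith : y ≤ 2 * y)).trans hsub
    have h1 := enorm_kerAvg_le_maxFn hk hD' (F := F) (N := Ω.indicator fun x => ‖f x‖ₑ) hy
      (D := ENNReal.ofReal (2 ^ γ / deriv φ x ^ γ)) ENNReal.ofReal_ne_top (fun s hs => by
        rw [indicator_of_mem (hsub' hs)]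
        exact enorm_div_rpow_le hγ.le hPx (hb.oscillation s hs))
    rw [← mul_assoc, ← ENNReal.ofReal_mul (by positivity)] at h1
    have hPγ : 0 < deriv φ x ^ γ := by positivity
    have h2 := norm_le_mul_toReal (by positivity) hNx h1
    calc _ ≤ 2 * D' * (2 ^ γ / deriv φ x ^ γ) * (N x).toReal * deriv φ x ^ γ := by gcongr
      _ = 2 * D' * 2 ^ γ * (N x).toReal := by field_simp
      _ ≤ _ := by gcongr
  have bG : ∀ x y, 0 < y → N x ≠ ⊤ → ‖G x y‖ ≤ R * (N x).toReal := by
    intro x y hy hNx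
    rcases le_or_gt (L x) (max Mφ 5 * y) with hxy | hxy
    · rw [(hGlow x y hy hxy).1, norm_zero]
      positivity
    · obtain ⟨hx, hyL, hsub, hb, hPx, hi⟩ := hgood x y hy hxy.le
      have h1 := norm_product_le hPx hy ht hγ (hχn x y)
        (hFN hη.isKer hη₀ hD₀ hDD₀ x y hy hxy.le hNx) hb.norm_sub_le hb.im_ge
      refine h1.trans ?_
      rw [← mul_assoc]
      gcongr
  have bGx : ∀ x y, 0 < y → N x ≠ ⊤ → ‖Gx x y‖ ≤ 1 / y * (R * (N x).toReal) := by
    intro x y hy hNx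
    rcases le_or_gt (L x) (max Mφ 5 * y) with hxy | hxy
    · rw [(hGlow x y hy hxy).2.1, norm_zero]
      positivity
    · obtain ⟨hx, hyL, hsub, hb, hPx, hi⟩ := hgood x y hy hxy.le
      have h1 := norm_deriv_product_le (C := C) (N := D * (N x).toReal) hPx hy ht hγ hC
        (by positivity) (hχn x y) (hχxn x y hy)
        (hFN hη.isKer hη₀ hD₀ hDD₀ x y hy hxy.le hNx) (DF := kx F x y) ?_ hb.norm_sub_le
        (Dw := kx W x y) ?_ hb.im_ge (Dz := kx Z x y) ?_
      · refine h1.trans (le_of_eq ?_)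
        rw [hR]
        ring
      · simp only [hkx]
        rw [norm_mul, hynorm y hy, mul_assoc, one_div, inv_mul_eq_div]
        exact div_le_div_of_nonneg_right
          (hFN hη.isKer.deriv hη₁ hD₁ hDD₁ x y hy hxy.le hNx) hy.le
      · simp only [hkx]
        rw [norm_mul, hynorm y hy]
        calc _ ≤ 1 / y * (Cφ * deriv φ x) := by
              gcongr
              exact hb.norm_deriv_deriv_le
          _ ≤ 1 / y * (C * deriv φ x) := by gcongr
          _ = _ := by ring
      · simp only [hkx]
        rw [norm_mul, hynorm y hy]
        calc _ ≤ 1 / y * (Cφ * (y * deriv φ x)) := by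
              gcongr
              exact hb.norm_deriv_le
          _ = Cφ * deriv φ x := by field_simp
          _ ≤ _ := by gcongr
  have bD : ∀ x y, 0 < y → m x ≠ ⊤ → ‖Gx x y + Complex.I * Gy x y‖ ≤
      Q * (m x).toReal * (P x ^ γ * (y ^ γ / y) * Real.exp (-(t * (y * P x) / 4))) := by
    intro x y hy hmx
    rcases le_or_gt (L x) (max Mφ 5 * y) with hxy | hxy
    · rw [(hGlow x y hy hxy).2.1, (hGlow x y hy hxy).2.2, mul_zero, add_zero, norm_zero]
      have : 0 ≤ P x := Set.indicator_nonneg (fun s hs => (hφ.deriv_pos s hs).le) x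
      positivity
    · obtain ⟨hx, hyL, hsub, hb, hPx, hi⟩ := hgood x y hy hxy.le
      have hsub' := (Metric.closedBall_subset_closedBall (by linarith : y ≤ 2 * y)).trans hsub
      have hPe : P x = deriv φ x := indicator_of_mem hx _
      have hLx : 0 < L x := by linarith
      obtain ⟨hm1, hm2⟩ := ENNReal.add_ne_top.1 hmx
      have hmt : (m x).toReal = (m₁ x).toReal + (m₂ x).toReal := ENNReal.toReal_add hm1 hm2
      have hdb : ∀ H, (H = F ∨ H = W ∨ H = Z) → kx H x y + Complex.I * ky H x y =
          -(y : ℂ)⁻¹ * (a * kerAvg (derivKer ζ (κ + 1 + 1)) H x y) := fun H hH =>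
        hη.dbar_eq hy ((hi H hH).mono_set
          (Metric.closedBall_subset_closedBall (by linarith : y ≤ 2 * y)))
      rw [hdbar, hPe, hmt]
      refine norm_dbar_product_le hPx hLx hy ht hγ hC ENNReal.toReal_nonneg ENNReal.toReal_nonneg
        (hχn x y) ?_ ?_ ?_ ?_ hb.norm_sub_le ?_ hb.im_ge ?_
      · refine (norm_add_le _ _).trans ?_
        rw [norm_mul, Complex.norm_I, one_mul]
        calc _ ≤ C / y + C / y := add_le_add (hχxn x y hy) (hχyn x y hy)
          _ = _ := by ring
      · intro h0
        by_contra! hlt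
        obtain ⟨-, h2, h3⟩ := hχhigh x y hy
          ((mul_le_mul_of_nonneg_right hCCχ hy.le).trans hlt.le)
        exact h0 (by simp [h2, h3])
      · have h1 := enorm_kerAvg_le_maxFn hη.isKer hη₀ (F := F) (N := V) hy
          (D := ENNReal.ofReal (2 ^ γ * L x ^ γ)) ENNReal.ofReal_ne_top (fun s hs => by
            have hsΩ := hsub' hs
            rw [hV, indicator_of_mem hsΩ]
            have h1 := hLlip s x
            have h2 := Real.dist_eq s x ▸ Metric.mem_closedBall.1 hs
            have h3 := abs_le.1 h1
            have h4 : L s = ℓ s := indicator_of_mem hsΩ _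
            exact enorm_div_rpow_le_weight hγ.le (hφ.deriv_pos s hsΩ) (by linarith)
              (by linarith))
        rw [← mul_assoc, ← ENNReal.ofReal_mul (by positivity)] at h1
        refine (norm_le_mul_toReal (by positivity) hm1 h1).trans ?_
        calc _ = 2 * D₀ * 2 ^ γ * L x ^ γ * (m₁ x).toReal := by ring
          _ ≤ _ := by gcongr
      · rw [hdb F (by simp), norm_mul, hynorm y hy, norm_mul]
        have h1 := norm_le_mul_toReal (by positivity) hm2 (hm₂ x y hy hyL)
        calc _ ≤ 1 / y * (‖a‖ * (C₂ * y ^ γ * (m₂ x).toReal)) := by gcongr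
          _ = ‖a‖ * C₂ * (y ^ γ / y) * (m₂ x).toReal := by ring
          _ ≤ _ := by gcongr
      · rw [hdb W (by simp), norm_mul, hynorm y hy, norm_mul]
        calc _ ≤ 1 / y * (‖a‖ * (Cφ * deriv φ x * (y ^ γ / L x ^ γ))) := by
              gcongr
              exact hb.norm_dbar_deriv_le
          _ = ‖a‖ * Cφ * (deriv φ x / y) * (y ^ γ / L x ^ γ) := by ring
          _ ≤ _ := by gcongr
      · rw [hdb Z (by simp), norm_mul, hynorm y hy, norm_mul]
        calc _ ≤ 1 / y * (‖a‖ * (Cφ * (y * deriv φ x) * (y ^ γ / L x ^ γ))) := by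
              gcongr
              exact hb.norm_dbar_le
          _ = ‖a‖ * Cφ * deriv φ x * (y ^ γ / L x ^ γ) := by field_simp
          _ ≤ _ := by gcongr
  have hP0 : ∀ x, 0 ≤ P x := Set.indicator_nonneg fun s hs => (hφ.deriv_pos s hs).le
  have hPm : Measurable P := (measurable_deriv φ).indicator hΩ.measurableSet
  set X : ℝ → ℝ → ℝ := fun x y => P x ^ γ * (y ^ γ / y) * Real.exp (-(t * (y * P x) / 4)) with hX
  have hX0 : ∀ x y, 0 < y → 0 ≤ X x y := fun x y hy => by
    have := hP0 x
    positivity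
  set k : ℝ → ℝ → ℝ≥0∞ := fun x y => ENNReal.ofReal Q * m x * ENNReal.ofReal (X x y) with hk
  -- The maximum over y of the exponential factor against y^γ. It yields the 1/y bound needed for
  -- integrability, and its dependence on `t` is harmless since `B` is only required to have finite
  -- norm.
  set S : ℝ := Q * (4 * γ) ^ γ / t ^ γ with hS
  have hS0 : 0 < S := by positivity
  set B : ℝ → ℝ≥0∞ := fun x => ENNReal.ofReal R * N x + ENNReal.ofReal S * m x with hB
  have hXS : ∀ x y, 0 < y → Q * X x y ≤ S * (1 / y) := by
    intro x y hy
    rcases (hP0 x).eq_or_lt with h | h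
    · have : X x y = 0 := by rw [hX]; simp [← h, Real.zero_rpow hγ.ne']
      rw [this, mul_zero]
      positivity
    · have h1 := rpow_mul_exp_neg_le hγ (by positivity : 0 < t * (y * P x))
      rw [Real.mul_rpow ht.le (by positivity), Real.mul_rpow hy.le h.le] at h1
      have htγ : 0 < t ^ γ := by positivity
      calc Q * X x y = Q * (1 / t ^ γ) * (1 / y) *
            (t ^ γ * (y ^ γ * P x ^ γ) * Real.exp (-(t * (y * P x) / 4))) := by
            rw [hX]; field_simp
        _ ≤ Q * (1 / t ^ γ) * (1 / y) * (4 * γ) ^ γ := by gcongr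
        _ = _ := by rw [hS]; ring
  have hkB : ∀ x y, 0 < y → k x y ≤ ENNReal.ofReal (1 / y) * B x := by
    intro x y hy
    calc k x y = ENNReal.ofReal (Q * X x y) * m x := by
          rw [hk, ENNReal.ofReal_mul hQ0.le]; ring
      _ ≤ ENNReal.ofReal (S * (1 / y)) * m x :=
          mul_le_mul_left (ENNReal.ofReal_le_ofReal (hXS x y hy)) _
      _ = ENNReal.ofReal (1 / y) * (ENNReal.ofReal S * m x) := by
          rw [ENNReal.ofReal_mul hS0.le]; ring
      _ ≤ _ := by
          gcongr
          exact le_add_self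
  have hDk : ∀ x y, 0 < y → ‖Gx x y + Complex.I * Gy x y‖ₑ ≤ k x y := by
    intro x y hy
    -- Where `m` is infinite, either `G` vanishes nearby scales by the cutoff or the majorant `k` is
    -- infinite, because its remaining factors are positive.
    by_cases hmx : m x = ⊤
    · rcases le_or_gt (L x) (max Mφ 5 * y) with hxy | hxy
      · rw [(hGlow x y hy hxy).2.1, (hGlow x y hy hxy).2.2]
        simp
      · obtain ⟨hx, -, -, -, hPx, -⟩ := hgood x y hy hxy.le
        have hPe : P x = deriv φ x := indicator_of_mem hx _
        have hXp : 0 < X x y := by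
          rw [hX]
          simp only [hPe]
          positivity
        have : k x y = ⊤ := by
          rw [hk]
          simp only [hmx]
          rw [ENNReal.mul_top (by simpa using hQ0), ENNReal.top_mul (by simpa using hXp)]
        rw [this]
        exact le_top
    · have h1 := bD x y hy hmx
      rw [← ofReal_norm, hk]
      simp only
      rw [← ENNReal.ofReal_toReal hmx, ← ENNReal.ofReal_mul hQ0.le,
        ← ENNReal.ofReal_mul (by positivity)]
      exact ENNReal.ofReal_le_ofReal h1
  refine ⟨G, Gx, Gy, B, k, m, dGx, dGy, (hNm.const_mul _).add (hmm.const_mul _), ?_,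
    fun x y hy => ?_, fun x y hy => ?_, fun x y hy => (hDk x y hy).trans (hkB x y hy), ?_, hDk, ?_,
    fun x => ?_, hmm, fun x => ?_, ?_⟩
  · have h1 := ENNReal.lintegral_Lp_add_le (hNm.const_mul (ENNReal.ofReal R)).aemeasurable
      (hmm.const_mul (ENNReal.ofReal S)).aemeasurable hp.le (μ := volume)
    rw [rpow_lintegral_const_mul hp0 ENNReal.ofReal_ne_top,
      rpow_lintegral_const_mul hp0 ENNReal.ofReal_ne_top] at h1
    have h2 := ne_top_of_le_ne_top (ENNReal.add_ne_top.2
      ⟨ENNReal.mul_ne_top ENNReal.ofReal_ne_top hNn,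
        ENNReal.mul_ne_top ENNReal.ofReal_ne_top hmfin⟩) h1
    exact ((ENNReal.rpow_lt_top_iff_of_pos (by positivity)).1 h2.lt_top).ne
  · by_cases hNx : N x = ⊤
    · rw [hB]
      simp only [hNx]
      rw [ENNReal.mul_top (by simpa using hR0), top_add]
      exact le_top
    · exact (enorm_le_of_norm_le hR0.le hNx (bG x y hy hNx)).trans le_self_add
  · by_cases hNx : N x = ⊤
    · rw [hB]
      simp only [hNx]
      rw [ENNReal.mul_top (by simpa using hR0), top_add, ENNReal.mul_top (by simpa using hy)]
      exact le_top
    · have h1 := bGx x y hy hNx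
      rw [← mul_assoc] at h1
      refine (enorm_le_of_norm_le (by positivity) hNx h1).trans ?_
      rw [ENNReal.ofReal_mul (by positivity), mul_assoc]
      gcongr
      exact le_self_add
  · refine ((hmm.const_mul _).comp measurable_fst).mul (Measurable.ennreal_ofReal ?_)
    have h1 : Measurable fun z : ℝ × ℝ => P z.1 := hPm.comp measurable_fst
    exact ((h1.pow_const γ).mul ((measurable_snd.pow_const γ).div measurable_snd)).mul
      (Real.measurable_exp.comp (((measurable_snd.mul h1).const_mul t).div_const 4).neg)
  · filter_upwards [hzero hγ hWfin,
      ae_tendsto_kerAvg_of_locallyIntegrableOn hη.isKer hη.integral_eq hΩ hFloc] with x hx0 hxF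
    by_cases hLx : 0 < L x
    · have hx : x ∈ Ω := by
        by_contra h
        rw [hLdef, indicator_of_notMem h] at hLx
        exact lt_irrefl _ hLx
      have hPx := hφ.deriv_pos x hx
      have h1 := hxF hx
      have h2 := tendsto_kerAvg_of_continuousOn hη.isKer hη.integral_eq hΩ hWc hx
      have h3 := tendsto_kerAvg_of_continuousOn hη.isKer hη.integral_eq hΩ hZc hx
      have h4 : Tendsto (fun y => E x y) (𝓝[>] 0)
          (𝓝 (F x * W x ^ (γ : ℂ) * Complex.exp (Complex.I * t * Z x))) :=
        (h1.mul (h2.cpow tendsto_const_nhds (Or.inl (by simpa [hW] using hPx)))).mul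
          ((Complex.continuous_exp.tendsto _).comp (h3.const_mul _))
      have e : F x * W x ^ (γ : ℂ) * Complex.exp (Complex.I * t * Z x) =
          Ω.indicator (fun x => Complex.exp (Complex.I * t * φ x) * f x) x := by
        rw [indicator_of_mem hx, hF, hW, hZ]
        simp only
        rw [← Complex.ofReal_cpow hPx.le]
        have : ((deriv φ x ^ γ : ℝ) : ℂ) ≠ 0 := by
          exact_mod_cast (Real.rpow_pos_of_pos hPx γ).ne'
        field_simp
      rw [← e]
      refine h4.congr' ?_
      filter_upwards [Ioo_mem_nhdsGT (div_pos hLx hCχ)] with y hy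
      have h5 := (hχhigh x y hy.1 (by
        rw [mul_comm]
        exact ((lt_div_iff₀ hCχ).1 hy.2).le)).1
      simp only [hG, h5]
      rw [Complex.ofReal_one, one_mul]
    -- Where ℓ = 0 the cutoff makes `G` vanish at every height. The limit is still correct almost
    -- everywhere, since finiteness of the weighted norm forces `f` to vanish there.
    · have hL0 : L x = 0 := le_antisymm (not_lt.1 hLx) (hℓ.indicator_nonneg x)
      have e : Ω.indicator (fun x => Complex.exp (Complex.I * t * φ x) * f x) x = 0 := by
        by_cases hx : x ∈ Ω
        · rw [indicator_of_mem hx, hx0 hx, mul_zero]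
          rwa [hLdef, indicator_of_mem hx] at hL0
        · rw [indicator_of_notMem hx]
      rw [e]
      refine tendsto_const_nhds.congr' ?_
      filter_upwards [self_mem_nhdsWithin] with y hy
      have hy0 : (0 : ℝ) < y := hy
      exact (hGlow x y hy0 (by rw [hL0]; positivity)).1.symm
  · filter_upwards [eventually_gt_atTop 0, eventually_ge_atTop (L x)] with y hy hyL
    refine (hGlow x y hy ?_).1
    have : 5 * y ≤ max Mφ 5 * y := mul_le_mul_of_nonneg_right (le_max_right _ _) hy.le
    linarith
  · have h1 : ∫⁻ y in Ioi (0 : ℝ), ENNReal.ofReal (X x y) ≤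
        ENNReal.ofReal (T * (1 / t ^ γ)) := by
      rcases (hP0 x).eq_or_lt with h | h
      · have : ∀ y, X x y = 0 := fun y => by rw [hX]; simp [← h, Real.zero_rpow hγ.ne']
        simp [this]
      · exact (lintegral_rpow_mul_exp hγ ht h).le
    have hXm : Measurable fun y => ENNReal.ofReal (X x y) :=
      Measurable.ennreal_ofReal ((((measurable_id.pow_const γ).div measurable_id).const_mul _).mul
        (Real.measurable_exp.comp (((measurable_id.mul_const _).const_mul t).div_const 4).neg))
    simp only [hk]
    rw [lintegral_const_mul _ hXm]
    calc _ ≤ ENNReal.ofReal Q * m x * ENNReal.ofReal (T * (1 / t ^ γ)) := by gcongr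
      _ = ENNReal.ofReal (Q * T) * ENNReal.ofReal (1 / t ^ γ) * m x := by
          rw [ENNReal.ofReal_mul hT0.le, ENNReal.ofReal_mul hQ0.le]; ring
      _ ≤ _ := by
          gcongr
          rw [ENNReal.coe_add]
          exact le_self_add
  · refine hmn.trans ?_
    gcongr
    rw [ENNReal.coe_add, ENNReal.coe_add]
    exact le_add_self

/-! ### The estimate by duality, and the theorem. -/

theorem IsPhase.locallyIntegrableOn_div {κ : ℕ} {α : ℝ} {Ω : Set ℝ} {φ : ℝ → ℝ}
    (hφ : IsPhase κ α Ω φ) (hΩ : IsOpen Ω) {p : ℝ} (hp : 1 ≤ p) {f : ℝ → ℂ}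
    (hf : MemLp f (ENNReal.ofReal p) (volume.restrict Ω)) (γ : ℝ) :
    LocallyIntegrableOn (fun x => f x / ((deriv φ x ^ γ : ℝ) : ℂ)) Ω := by
  rw [locallyIntegrableOn_iff hΩ.isLocallyClosed]
  intro K hK hKc
  have : IsFiniteMeasure (volume.restrict K) := ⟨by
    rw [Measure.restrict_apply_univ]; exact hKc.measure_lt_top⟩
  have h1 : IntegrableOn f K :=
    (hf.mono_measure (Measure.restrict_mono hK le_rfl)).integrable (by
      rw [← ENNReal.ofReal_one]; exact ENNReal.ofReal_le_ofReal hp)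
  have h2 : ContinuousOn (fun x => ((deriv φ x ^ γ : ℝ) : ℂ)⁻¹) K := by
    refine ContinuousOn.inv₀ (Complex.continuous_ofReal.comp_continuousOn
      (((hφ.continuousOn_deriv hΩ).mono hK).rpow_const fun x hx =>
        Or.inl (hφ.deriv_pos x (hK hx)).ne')) fun x hx => ?_
    exact_mod_cast (Real.rpow_pos_of_pos (hφ.deriv_pos x (hK hx)) γ).ne'
  simp_rw [div_eq_mul_inv]
  exact h1.mul_continuousOn h2 hKc

theorem isWeakDeriv_zero {Ω : Set ℝ} {F : ℝ → ℂ} (hF : LocallyIntegrableOn F Ω) :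
    IsWeakDeriv Ω 0 F F :=
  ⟨hF, hF, fun ψ _ _ _ => by simp⟩

theorem memLp_indicator_exp_mul {Ω : Set ℝ} (hΩ : IsOpen Ω) {φ : ℝ → ℝ} (hφ : ContinuousOn φ Ω)
    {p : ℝ≥0∞} {f : ℝ → ℂ} (hf : MemLp f p (volume.restrict Ω)) (t : ℝ) :
    MemLp (Ω.indicator fun x => Complex.exp (Complex.I * t * φ x) * f x) p volume := by
  rw [memLp_indicator_iff_restrict hΩ.measurableSet]
  refine hf.of_le ?_ (ae_of_all _ fun x => ?_)
  · refine AEStronglyMeasurable.mul (ContinuousOn.aestronglyMeasurable ?_ hΩ.measurableSet) hf.1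
    exact Complex.continuous_exp.comp_continuousOn
      (continuousOn_const.mul (Complex.continuous_ofReal.comp_continuousOn hφ))
  · rw [norm_mul, show Complex.I * t * φ x = ((t * φ x : ℝ) : ℂ) * Complex.I by push_cast; ring,
      Complex.norm_exp_ofReal_mul_I, one_mul]

/-- The estimate for a fixed weak derivative, for positive order. -/
theorem exists_eLpNorm_le_of_isWeakDeriv (κ : ℕ) {α A c p : ℝ} (hp : 1 < p) (hα : 0 ≤ α)
    (hα1 : α ≤ 1) (hγ : 0 < κ + α) (hA : 0 < A) (hc : 0 < c) : ∃ C : ℝ≥0, 0 < C ∧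
    ∀ (Ω : Set ℝ) (φ ℓ : ℝ → ℝ), IsOpen Ω → IsPhase κ α Ω φ → IsAdmissible κ α A c Ω φ ℓ →
    ∀ f g h : ℝ → ℂ, MemLp f (ENNReal.ofReal p) (volume.restrict Ω) →
    IsWeakDeriv Ω ⌊(κ : ℝ) + α⌋₊ (fun x => f x / ((deriv φ x ^ ((κ : ℝ) + α) : ℝ) : ℂ)) g →
    ∀ t : ℝ, 0 < t → IsCauchyMinus (ENNReal.ofReal p)
      (Ω.indicator fun x => Complex.exp (Complex.I * t * φ x) * f x) h →
    eLpNorm h (ENNReal.ofReal p) volume ≤ C * ENNReal.ofReal (1 / t ^ ((κ : ℝ) + α)) *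
      (weightedNorm Ω φ ℓ p (κ + α) f + fracSeminorm Ω ℓ p (κ + α - ⌊(κ : ℝ) + α⌋₊) g) := by
  have hp0 : 0 < p := by linarith
  have hpq : p.HolderConjugate p.conjExponent := Real.HolderConjugate.conjExponent hp
  set q := p.conjExponent with hq
  have hq0 : 0 < q := hpq.symm.pos
  obtain ⟨K, hK⟩ := exists_extension κ hp hα hα1 hγ hA hc
  obtain ⟨C₀, hmax⟩ := lintegral_maxFn_rpow_le_of_aemeasurable hpq.symm.lt
  obtain ⟨C₁, hcp⟩ := eLpNorm_cauchyPlus_le hpq.symm.lt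
  -- The summand 1 makes the constant positive, so that the bound is trivially true when a norm on
  -- the right is infinite.
  refine ⟨K * K * 8 * C₀ * C₁ + 1, by positivity, ?_⟩
  intro Ω φ ℓ hΩ hφ hℓ f g h hf hw t ht hh
  set F : ℝ → ℂ := fun x => f x / ((deriv φ x ^ ((κ : ℝ) + α) : ℝ) : ℂ)
  set N := weightedNorm Ω φ ℓ p (κ + α) f + fracSeminorm Ω ℓ p (κ + α - ⌊(κ : ℝ) + α⌋₊) g with hN
  have htγ : 0 < 1 / t ^ ((κ : ℝ) + α) := by positivity
  by_cases hfin : N = ⊤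
  · rw [hfin, ENNReal.mul_top]
    · exact le_top
    · refine mul_ne_zero (by
        rw [ENNReal.coe_ne_zero]
        positivity) (by simpa using htγ)
  obtain ⟨hW, hS⟩ := ENNReal.add_ne_top.1 hfin
  obtain ⟨G, Gx, Gy, B, k, m, dGx, dGy, hBm, hBp, bG, bGx, bD, hkm, hk, hlim, hz, hmm, hkint, hmn⟩ :=
    hK Ω φ ℓ hΩ hφ hℓ f g hf (hφ.locallyIntegrableOn_div hΩ hp.le hf _) hw hW hS t ht
  refine eLpNorm_le_of_forall_schwartz hpq hh.2.1 fun ψ => ?_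
  rw [hh.integral_mul_schwartz hpq ψ]
  refine (enorm_integral_mul_cauchyPlus_le hpq dGx dGy hBm hBp bG bGx bD hkm hk hlim hz ψ).trans ?_
  set τ := ENNReal.ofReal (1 / t ^ ((κ : ℝ) + α)) with hτ
  set M := maxFn fun s => ‖cauchyPlus ψ s‖ₑ with hM
  have hMm : Measurable M := measurable_maxFn_enorm (aestronglyMeasurable_cauchyPlus ψ)
  have hMn : (∫⁻ x, M x ^ q) ^ (1 / q) ≤ C₀ * (C₁ * eLpNorm ψ (ENNReal.ofReal q) volume) := by
    refine (hmax _ (aestronglyMeasurable_cauchyPlus ψ).enorm).trans ?_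
    rw [← eLpNorm_ofReal_exponent hq0]
    gcongr
    exact hcp ψ
  calc ∫⁻ x, (∫⁻ y in Ioi (0 : ℝ), k x y) * (8 * M x)
      ≤ ∫⁻ x, K * τ * 8 * (m x * M x) := by
        refine lintegral_mono fun x => ?_
        calc _ ≤ K * τ * m x * (8 * M x) := by gcongr; exact hkint x
          _ = _ := by ring
    _ = K * τ * 8 * ∫⁻ x, m x * M x := lintegral_const_mul _ (hmm.mul hMm)
    _ ≤ K * τ * 8 * ((∫⁻ x, m x ^ p) ^ (1 / p) * (∫⁻ x, M x ^ q) ^ (1 / q)) := by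
        gcongr
        exact ENNReal.lintegral_mul_le_Lp_mul_Lq volume hpq hmm.aemeasurable hMm.aemeasurable
    _ ≤ K * τ * 8 * ((K * N) * (C₀ * (C₁ * eLpNorm ψ (ENNReal.ofReal q) volume))) := by
        gcongr
    _ = (K * K * 8 * C₀ * C₁) * τ * N * eLpNorm ψ (ENNReal.ofReal q) volume := by ring
    _ ≤ _ := by
        gcongr
        push_cast
        exact le_self_add

theorem theorem2 (κ : ℕ) (α : ℝ) (hα : α ∈ Set.Icc (0 : ℝ) 1) (p : ℝ) (hp : 1 < p)
    (A c : ℝ) (hc : 0 < c) :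
    ∃ C : ℝ≥0, ∀ (Ω : Set ℝ) (φ ℓ : ℝ → ℝ), IsOpen Ω → IsPhase κ α Ω φ →
      IsAdmissible κ α A c Ω φ ℓ →
      ∀ f : ℝ → ℂ, MemLp f (ENNReal.ofReal p) (volume.restrict Ω) → ∀ t : ℝ, 0 < t →
        (∃ h : ℝ → ℂ, IsCauchyMinus (ENNReal.ofReal p)
          (Ω.indicator fun x => Complex.exp (Complex.I * t * φ x) * f x) h) ∧
        ∀ h : ℝ → ℂ, IsCauchyMinus (ENNReal.ofReal p)
          (Ω.indicator fun x => Complex.exp (Complex.I * t * φ x) * f x) h →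
          eLpNorm h (ENNReal.ofReal p) volume ≤
            C * ENNReal.ofReal (1 / t ^ ((κ : ℝ) + α)) *
              (weightedNorm Ω φ ℓ p (κ + α) f +
                xSeminorm Ω ℓ p (κ + α) (fun x => f x / ((deriv φ x ^ ((κ : ℝ) + α) : ℝ) : ℂ))) := by
  have hex : ∀ (Ω : Set ℝ) (φ : ℝ → ℝ), IsOpen Ω → IsPhase κ α Ω φ → ∀ f : ℝ → ℂ,
      MemLp f (ENNReal.ofReal p) (volume.restrict Ω) → ∀ t : ℝ,
      ∃ h : ℝ → ℂ, IsCauchyMinus (ENNReal.ofReal p)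
        (Ω.indicator fun x => Complex.exp (Complex.I * t * φ x) * f x) h := fun Ω φ hΩ hφ f hf t =>
    exists_isCauchyMinus hp (memLp_indicator_exp_mul hΩ hφ.continuousOn hf t)
  -- The extension argument needs γ > 0, since the Gamma integral diverges at γ = 0.
  rcases (show (0 : ℝ) ≤ κ + α from add_nonneg κ.cast_nonneg hα.1).eq_or_lt with hγ | hγ
  · obtain ⟨C, hC⟩ := IsCauchyMinus.eLpNorm_le hp
    refine ⟨C, fun Ω φ ℓ hΩ hφ hℓ f hf t ht => ⟨hex Ω φ hΩ hφ f hf t, fun h hh => ?_⟩⟩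
    have e : eLpNorm (Ω.indicator fun x => Complex.exp (Complex.I * t * φ x) * f x)
        (ENNReal.ofReal p) volume = eLpNorm f (ENNReal.ofReal p) (volume.restrict Ω) := by
      rw [eLpNorm_indicator_eq_eLpNorm_restrict hΩ.measurableSet]
      refine eLpNorm_congr_norm_ae (ae_of_all _ fun x => ?_)
      rw [norm_mul, show Complex.I * t * φ x = ((t * φ x : ℝ) : ℂ) * Complex.I by push_cast; ring,
        Complex.norm_exp_ofReal_mul_I, one_mul]
    have h1 := hC _ h hh
    rw [e] at h1
    rw [← hγ]
    simp only [Real.rpow_zero, div_one, ENNReal.ofReal_one, mul_one, Complex.ofReal_one, xSeminorm,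
      zero_lt_one, if_true, fracSeminorm]
    exact h1.trans (by gcongr; exact le_add_self)
  · obtain ⟨C, hC0, hC⟩ := exists_eLpNorm_le_of_isWeakDeriv κ hp hα.1 hα.2 hγ
      (by positivity : 0 < max A 1) hc
    refine ⟨C, fun Ω φ ℓ hΩ hφ hℓ f hf t ht => ⟨hex Ω φ hΩ hφ f hf t, fun h hh => ?_⟩⟩
    have hℓ' := hℓ.mono hφ.deriv_pos (le_max_left A 1)
    have key := fun g hg => hC Ω φ ℓ hΩ hφ hℓ' f g h hf hg t ht hh
    have htγ : 0 < 1 / t ^ ((κ : ℝ) + α) := by positivity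
    have hCt : (C : ℝ≥0∞) * ENNReal.ofReal (1 / t ^ ((κ : ℝ) + α)) ≠ 0 :=
      mul_ne_zero (by exact_mod_cast hC0.ne') (by simpa using htγ)
    have hCt' : (C : ℝ≥0∞) * ENNReal.ofReal (1 / t ^ ((κ : ℝ) + α)) ≠ ⊤ :=
      ENNReal.mul_ne_top ENNReal.coe_ne_top ENNReal.ofReal_ne_top
    -- For γ < 1 the function is its own weak derivative of order zero. Otherwise the estimate holds
    -- for every weak derivative, hence for the infimum; if there is none, the infimum is `⊤`.
    -- Pulling the infimum out of the product uses that the constant is positive and finite.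
    by_cases h1 : (κ : ℝ) + α < 1
    · have hfl : ⌊(κ : ℝ) + α⌋₊ = 0 := Nat.floor_eq_zero.2 h1
      rw [hfl, Nat.cast_zero, sub_zero] at key
      rw [xSeminorm, if_pos h1]
      exact key _ (isWeakDeriv_zero (hφ.locallyIntegrableOn_div hΩ hp.le hf _))
    · rw [xSeminorm, if_neg h1]
      simp only [ENNReal.add_iInf, ENNReal.mul_iInf_of_ne hCt hCt']
      exact le_iInf₂ key
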